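/- Conventions. $B(z,r)$ is the open disk in $\mathbb C$, $dA$ is Lebesgue measure, $\partial=\frac12(\partial_x-i\partial_y)$, $\bar\partial=\frac12(\partial_x+i\partial_y)$, and $\Delta=\partial\bar\partial=\frac14(\partial_x^2+\partial_y^2)$. Let $\phi:\mathbb C\to\mathbb R$ be subharmonic, with distributional Laplacian $\Delta\phi$ given by a locally integrable function. The Fock space $\mathcal F_\phi$ consists of the entire functions $f$ with $\int_{\mathbb C}|f|^2e^{-\phi}\,dA<\infty$, and $\bar\partial^*_\phi f:=-e^{\phi}\,\partial(e^{-\phi}f)$; write $(\bar\partial^*_\phi)^j$ for its $j$-th iterate. A set with multiplicities $(\Lambda,m_\Lambda)$ is a set $\Lambda\subseteq\mathbb C$ with a bounded function $m_\Lambda:\Lambda\to\mathbb N$; put $n_\Lambda:=\sup_\Lambda m_\Lambda-1$. - It is *separated* if $\rho(\Lambda):=\inf\{|\lambda-\mu|:\lambda\ne\mu\in\Lambda\}>0$ (with $\inf\emptyset=+\infty$). - It is *compatible* with $\phi$ if $m<\Delta\phi<M$ almost everywhere for some constants $m,M>0$ and, in case $n_\Lambda\ge2$, additionally $\phi\in C^{n_\Lambda+1}(\mathbb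 C)$ and $\sup_{z\in\mathbb C}|\partial^j\Delta\phi(z)|<\infty$ for $1\le j\le n_\Lambda-1$. - It is *interpolating* for $\mathcal F_\phi$ if for all complex numbers $c_{(\lambda,j)}$ ($\lambda\in\Lambda$, $0\le j\le m_\Lambda(\lambda)-1$) with $\sum_{\lambda\in\Lambda}\sum_{j=0}^{m_\Lambda(\lambda)-1}|c_{(\lambda,j)}|^2e^{-\phi(\lambda)}<\infty$ there is $f\in\mathcal F_\phi$ with $(\bar\partial^*_\phi)^jf(\lambda)=c_{(\lambda,j)}$ for all $\lambda\in\Lambda$ and $0\le j\le m_\Lambda(\lambda)-1$. - Its lower and upper weighted Beurling densities are $$D^-_\phi(\Lambda,m_\Lambda)=\liminf_{r\to\infty}\inf_{z\in\mathbb C}\frac{\sum_{\lambda\in\Lambda\cap B(z,r)}m_\Lambda(\lambda)}{\int_{B(z,r)}\Delta\phi\,dA},\qquad D^+_\phi(\Lambda,m_\Lambda)=\limsup_{r\to\infty}\sup_{z\in\mathbb C}\frac{\sum_{\lambda\in\Lambda\cap B(z,r)}m_\Lambda(\lambda)}{\int_{B(z,r)}\Delta\phi\,dA}.$$ **Proposition.**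 Let $(\Lambda,m_\Lambda)$ be a separated set with multiplicities that is compatible with $\phi$ and interpolating for $\mathcal F_\phi$, and suppose that $\sup_{\lambda\in\Lambda}m_\Lambda(\lambda)=n_\Lambda+1\ge2$. Let $\Lambda_{\max}=\{\lambda\in\Lambda: m_\Lambda(\lambda)=n_\Lambda+1\}$. Then there is $\varepsilon_0>0$ such that for every $0<\varepsilon<\varepsilon_0$ and every choice of points $\lambda'\in\mathbb C$ with $|\lambda-\lambda'|=\varepsilon$ $(\lambda\in\Lambda_{\max})$, the set $\tilde\Lambda=\Lambda\cup\{\lambda':\lambda\in\Lambda_{\max}\}$ with the multiplicities $$m_{\tilde\Lambda}(z)=\min\{m_\Lambda(z),n_\Lambda\}\quad(z\in\Lambda),\qquad m_{\tilde\Lambda}(z)=1\quad(z\in\tilde\Lambda\setminus\Lambda)$$ is separated and interpolating for $\mathcal F_\phi$, has $\sup_{\tilde\Lambda}m_{\tilde\Lambda}=n_\Lambda$, and satisfies $D^-_\phi(\tilde\Lambda,m_{\tilde\Lambda})=D^-_\phi(\Lambda,m_\Lambda)$ and $D^+_\phi(\tilde\Lambda,m_{\tilde\Lambda})=D^+_\phi(\Lambda,m_\Lambda)$.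 In particular, a separated interpolating set with these properties exists. -/

import Mathlib

open MeasureTheory Filter
open scoped ENNReal ContDiff

noncomputable section

namespace Fock

/-- A set with multiplicities `(Λ, m_Λ)`: a subset of `ℂ` with a bounded multiplicity function.
Only the values of `mult` at the points of the set are ever used. -/
structure MultSet where
  points : Set ℂ
  mult : ℂ → ℕ
  bddAbove_mult : BddAbove (mult '' points)

/-- `φ : ℂ → ℝ` is subharmonic: upper semicontinuous with the sub-mean value property on circles
(the circle averages of a finite-valued such function are automatically finite). -/
def Subharmonic (φ : ℂ → ℝ) : Prop :=
  UpperSemicontinuous φ ∧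
    ∀ (z : ℂ) (r : ℝ), 0 < r → CircleIntegrable φ z r ∧ φ z ≤ Real.circleAverage φ z r

open Laplacian in
/-- The normalized pointwise Laplacian `(1/4) (∂_x² + ∂_y²)`. -/
def lap (f : ℂ → ℝ) (z : ℂ) : ℝ := (1 / 4) * (Δ f) z

/-- The locally integrable function `L` is the normalized Laplacian of `φ` in the sense of
distributions. -/
def HasLaplacian (φ L : ℂ → ℝ) : Prop :=
  LocallyIntegrable φ ∧ LocallyIntegrable L ∧
    ∀ ψ : ℂ → ℝ, ContDiff ℝ ∞ ψ → HasCompactSupport ψ →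
      ∫ z, φ z * lap ψ z = ∫ z, L z * ψ z

/-- The Wirtinger derivative `∂ = (1/2) (∂_x - i ∂_y)`. -/
def wirtinger (f : ℂ → ℂ) (z : ℂ) : ℂ :=
  (1 / 2) * (fderiv ℝ f z 1 - Complex.I * fderiv ℝ f z Complex.I)

/-- The operator `f ↦ - e^φ ∂ (e^{-φ} f)`, the formal adjoint of `∂̄` in `L²(e^{-φ})`. -/
def dbarStar (φ : ℂ → ℝ) (f : ℂ → ℂ) (z : ℂ) : ℂ :=
  -((Real.exp (φ z) : ℝ) : ℂ) * wirtinger (fun w => ((Real.exp (-φ w) : ℝ) : ℂ) * f w) z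

/-- Membership in the weighted Fock space: `f` is entire and `∫ |f|² e^{-φ} dA < ∞`. -/
def MemFock (φ : ℂ → ℝ) (f : ℂ → ℂ) : Prop :=
  Differentiable ℂ f ∧ Integrable (fun z => ‖f z‖ ^ 2 * Real.exp (-φ z))

namespace MultSet

/-- The supremum of the multiplicities. -/
def maxMult (Λ : MultSet) : ℕ := sSup (Λ.mult '' Λ.points)

/-- The points of maximal multiplicity. -/
def maxPoints (Λ : MultSet) : Set ℂ := {z ∈ Λ.points | Λ.mult z = Λ.maxMult}

/-- (Uniform) separation: the infimum of the distances between distinct points is positive. -/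
def IsSeparated (Λ : MultSet) : Prop := 0 < Λ.points.einfsep

/-- Compatibility of `(Λ, m_Λ)` with the weight `φ` whose distributional Laplacian is `L`.
Here `Λ.maxMult - 1` is `n_Λ`. -/
structure Compatible (Λ : MultSet) (φ L : ℂ → ℝ) : Prop where
  bounds : ∃ m M : ℝ, 0 < m ∧ 0 < M ∧ ∀ᵐ z, m < L z ∧ L z < M
  smooth : 2 ≤ Λ.maxMult - 1 → ContDiff ℝ ((Λ.maxMult - 1 + 1 : ℕ) : ℕ∞) φ
  deriv_bounded : 2 ≤ Λ.maxMult - 1 → ∀ j : ℕ, 1 ≤ j → j ≤ Λ.maxMult - 1 - 1 →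
    ∃ C : ℝ, ∀ z, ‖(wirtinger^[j] fun w => ((lap φ w : ℝ) : ℂ)) z‖ ≤ C

/-- The condition `c ∈ ℓ²_φ(Λ, m_Λ)`. Only the entries `c λ j` with `λ ∈ Λ`, `j < m_Λ(λ)` matter. -/
def MemEllTwo (Λ : MultSet) (φ : ℂ → ℝ) (c : ℂ → ℕ → ℂ) : Prop :=
  Summable fun z : Λ.points =>
    ∑ j ∈ Finset.range (Λ.mult z), ‖c z j‖ ^ 2 * Real.exp (-φ z)

/-- `(Λ, m_Λ)` is an interpolating set for the Fock space with weight `φ`. -/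
def IsInterpolating (Λ : MultSet) (φ : ℂ → ℝ) : Prop :=
  ∀ c : ℂ → ℕ → ℂ, Λ.MemEllTwo φ c →
    ∃ f : ℂ → ℂ, MemFock φ f ∧
      ∀ z ∈ Λ.points, ∀ j < Λ.mult z, ((dbarStar φ)^[j] f) z = c z j

/-- The number of points in the open disk `B(z, r)`, counted with multiplicities. -/
def count (Λ : MultSet) (z : ℂ) (r : ℝ) : ℝ≥0∞ :=
  ∑' w : ↥(Λ.points ∩ Metric.ball z r), (Λ.mult w : ℝ≥0∞)

/-- The lower Beurling density with respect to a weight with Laplacian `L`. -/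
def lowerDensity (Λ : MultSet) (L : ℂ → ℝ) : ℝ≥0∞ :=
  liminf (fun r : ℝ => ⨅ z : ℂ, Λ.count z r / ENNReal.ofReal (∫ w in Metric.ball z r, L w)) atTop

/-- The upper Beurling density with respect to a weight with Laplacian `L`. -/
def upperDensity (Λ : MultSet) (L : ℂ → ℝ) : ℝ≥0∞ :=
  limsup (fun r : ℝ => ⨆ z : ℂ, Λ.count z r / ENNReal.ofReal (∫ w in Metric.ball z r, L w)) atTop

open Classical in
/-- Lower each maximal multiplicity by one, and add the point `p λ` with multiplicity one for each
`λ` of maximal multiplicity. -/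
def lower (Λ : MultSet) (p : ℂ → ℂ) : MultSet where
  points := Λ.points ∪ p '' Λ.maxPoints
  mult z := if z ∈ Λ.points then min (Λ.mult z) (Λ.maxMult - 1) else 1
  bddAbove_mult := by
    refine ⟨max (Λ.maxMult - 1) 1, ?_⟩
    rintro _ ⟨z, -, rfl⟩
    dsimp only
    split_ifs
    · exact (min_le_right _ _).trans (le_max_left _ _)
    · exact le_max_right _ _

end MultSet

end Fock

end

/-! A node of multiplicity `n + 1` is a limit of a node of multiplicity `n` together with a nearby
simple node: if `g` is holomorphic near `a`, then `n!/(w - a)^n` times the difference of `g w` and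
its Taylor polynomial of degree `n - 1` at `a` differs from the `n`-th derivative of `g` at `a` by
`O(|w - a|)`. Surjectivity of a bounded operator onto `ℓ²` survives small perturbations, so the top
jets may be replaced by such divided differences, provided that the error is small in operator norm,
uniformly over all nodes.

To use ordinary Taylor expansions, the operator `dbarStar φ` is removed by a gauge
(`exists_hasGauge`): near every point `a` there is a holomorphic `H` with `φ ≤ 2 Re H + C`, the
constant being independent of `a`, such that `f ↦ f e^{-H}` turns the iterates of `dbarStar φ` at
`a` into ordinary derivatives up to the factor `(-1)^j e^{φ(a)/2}`. This requires `φ - 2 Re H` to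
have vanishing pure `∂`-derivatives at `a` up to order `n`. The Cauchy transform of a localized
Laplacian gives an `H` for which these derivatives are bounded
(`exists_gauge_of_wirtinger_lap_bounded`), and adding a polynomial makes them vanish
(`hasGauge_of_bounded`). For `n = 1` only bounds on the distributional Laplacian are available; then
`φ` is first compared with a smooth regularization (`exists_smooth_approximation`).

The Fock space is a closed subspace of `L²`. The mean value property, the Cauchy estimates and the
disjointness of discs around the nodes bound the jets, and the errors of the divided differences, in
`ℓ²` (`norm_jet_sq_le`, `norm_jetDiff_sub_jet_sq_le`). With `surjective_of_norm_sub_lt` this gives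
`exists_perturbedJet_eq`, and prescribing a divided difference together with the lower jets is the
same as prescribing the value at the new node (`isInterpolating_lower`).

The densities agree because mass is moved only by distance `ε`: each counting function is dominated
by the other one on discs enlarged by `ε`, and the annulus in between is negligible as the radius
grows (`density_le`). -/

namespace Fock

open Topology Complex

/-! ### Calculus of the Wirtinger derivatives. -/

/-- The Wirtinger derivative `∂̄ = (1/2) (∂_x + i ∂_y)`. -/
noncomputable def dbar (f : ℂ → ℂ) (z : ℂ) : ℂ :=
  (1 / 2) * (fderiv ℝ f z 1 + Complex.I * fderiv ℝ f z Complex.I)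

theorem fderiv_apply_eq_wirtinger (f : ℂ → ℂ) (z v : ℂ) :
    fderiv ℝ f z v = wirtinger f z * v + dbar f z * (starRingEnd ℂ) v := by
  have hv : v = v.re • (1 : ℂ) + v.im • I := by
    simp [Complex.re_add_im]
  conv_lhs => rw [hv, map_add, map_smul, map_smul]
  have hc : (starRingEnd ℂ) v = v.re - v.im * I := by
    apply Complex.ext <;> simp
  rw [hc]
  conv_rhs => rw [← Complex.re_add_im v]
  simp only [wirtinger, dbar, real_smul, add_re, ofReal_re, mul_re, I_re, ofReal_im, I_im, add_im,
    mul_im]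
  ring_nf
  rw [I_sq]
  ring

theorem wirtinger_congr {f g : ℂ → ℂ} {z : ℂ} (h : f =ᶠ[𝓝 z] g) :
    wirtinger f z = wirtinger g z := by
  simp only [wirtinger, h.fderiv_eq]

theorem wirtinger_congr_nhds {f g : ℂ → ℂ} {z : ℂ} (h : f =ᶠ[𝓝 z] g) :
    wirtinger f =ᶠ[𝓝 z] wirtinger g :=
  h.eventuallyEq_nhds.mono fun _ hw => wirtinger_congr hw

theorem wirtinger_iterate_congr_nhds {f g : ℂ → ℂ} {z : ℂ} (h : f =ᶠ[𝓝 z] g) (j : ℕ) :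
    wirtinger^[j] f =ᶠ[𝓝 z] wirtinger^[j] g := by
  induction j generalizing f g with
  | zero => simpa using h
  | succ j ih => simpa using ih (wirtinger_congr_nhds h)

theorem wirtinger_add {f g : ℂ → ℂ} {z : ℂ} (hf : DifferentiableAt ℝ f z)
    (hg : DifferentiableAt ℝ g z) :
    wirtinger (fun w => f w + g w) z = wirtinger f z + wirtinger g z := by
  simp only [wirtinger, fderiv_fun_add hf hg, add_apply]
  ring

theorem wirtinger_sub {f g : ℂ → ℂ} {z : ℂ} (hf : DifferentiableAt ℝ f z)
    (hg : DifferentiableAt ℝ g z) :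
    wirtinger (fun w => f w - g w) z = wirtinger f z - wirtinger g z := by
  simp only [wirtinger, fderiv_fun_sub hf hg, sub_apply]
  ring

theorem dbar_sub {f g : ℂ → ℂ} {z : ℂ} (hf : DifferentiableAt ℝ f z)
    (hg : DifferentiableAt ℝ g z) :
    dbar (fun w => f w - g w) z = dbar f z - dbar g z := by
  simp only [dbar, fderiv_fun_sub hf hg, sub_apply]
  ring

theorem wirtinger_mul {f g : ℂ → ℂ} {z : ℂ} (hf : DifferentiableAt ℝ f z)
    (hg : DifferentiableAt ℝ g z) :
    wirtinger (fun w => f w * g w) z = wirtinger f z * g z + f z * wirtinger g z := by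
  simp only [wirtinger, fderiv_fun_mul hf hg, add_apply,
    smul_apply, smul_eq_mul]
  ring

theorem wirtinger_of_differentiableAt {f : ℂ → ℂ} {z : ℂ} (hf : DifferentiableAt ℂ f z) :
    wirtinger f z = deriv f z := by
  have h : fderiv ℝ f z = (fderiv ℂ f z).restrictScalars ℝ :=
    (hf.hasFDerivAt.restrictScalars ℝ).fderiv
  simp only [wirtinger, h, ContinuousLinearMap.coe_restrictScalars', fderiv_eq_smul_deriv,
    smul_eq_mul, one_mul]
  linear_combination (-(1 / 2) * deriv f z) * I_mul_I

theorem dbar_of_differentiableAt {f : ℂ → ℂ} {z : ℂ} (hf : DifferentiableAt ℂ f z) :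
    dbar f z = 0 := by
  have h : fderiv ℝ f z = (fderiv ℂ f z).restrictScalars ℝ :=
    (hf.hasFDerivAt.restrictScalars ℝ).fderiv
  simp only [dbar, h, ContinuousLinearMap.coe_restrictScalars', fderiv_eq_smul_deriv,
    smul_eq_mul, one_mul]
  linear_combination ((1 / 2) * deriv f z) * I_mul_I

theorem differentiableAt_of_dbar_eq_zero {f : ℂ → ℂ} {z : ℂ} (hf : DifferentiableAt ℝ f z)
    (h : dbar f z = 0) : DifferentiableAt ℂ f z := by
  refine differentiableAt_complex_iff_differentiableAt_real.2 ⟨hf, ?_⟩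
  have h' : fderiv ℝ f z 1 + I * fderiv ℝ f z I = 0 := by
    simpa [dbar] using h
  rw [smul_eq_mul]
  linear_combination (-I) * h' + (fderiv ℝ f z I) * I_mul_I

theorem wirtinger_conj_comp {f : ℂ → ℂ} {z : ℂ} (hf : DifferentiableAt ℝ f z) :
    wirtinger (fun w => (starRingEnd ℂ) (f w)) z = (starRingEnd ℂ) (dbar f z) := by
  have h : fderiv ℝ (fun w => (starRingEnd ℂ) (f w)) z =
      (conjCLE : ℂ →L[ℝ] ℂ).comp (fderiv ℝ f z) :=
    ((conjCLE : ℂ →L[ℝ] ℂ).hasFDerivAt.comp z hf.hasFDerivAt).fderiv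
  simp only [wirtinger, dbar, h, ContinuousLinearMap.comp_apply, map_mul, map_add, conj_I,
    ContinuousLinearEquiv.coe_coe, conjCLE_apply, map_div₀, map_one, map_ofNat]
  ring

theorem wirtinger_ofReal {f : ℂ → ℝ} {z : ℂ} (hf : DifferentiableAt ℝ f z) :
    wirtinger (fun w => ((f w : ℝ) : ℂ)) z =
      (1 / 2) * ((fderiv ℝ f z 1 : ℝ) - I * (fderiv ℝ f z I : ℝ)) := by
  have h : fderiv ℝ (fun w => ((f w : ℝ) : ℂ)) z = ofRealCLM.comp (fderiv ℝ f z) :=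
    (ofRealCLM.hasFDerivAt.comp z hf.hasFDerivAt).fderiv
  simp [wirtinger, h]

theorem fderiv_eq_re_wirtinger {f : ℂ → ℝ} {z : ℂ} (hf : DifferentiableAt ℝ f z) (v : ℂ) :
    fderiv ℝ f z v = 2 * (wirtinger (fun w => ((f w : ℝ) : ℂ)) z * v).re := by
  have hv : v = v.re • (1 : ℂ) + v.im • I := by
    simp [Complex.re_add_im]
  conv_lhs => rw [hv, map_add, map_smul, map_smul]
  rw [wirtinger_ofReal hf]
  simp
  ring

theorem norm_fderiv_le_wirtinger {f : ℂ → ℝ} {z : ℂ} (hf : DifferentiableAt ℝ f z) :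
    ‖fderiv ℝ f z‖ ≤ 2 * ‖wirtinger (fun w => ((f w : ℝ) : ℂ)) z‖ := by
  refine ContinuousLinearMap.opNorm_le_bound _ (by positivity) fun v => ?_
  rw [fderiv_eq_re_wirtinger hf, Real.norm_eq_abs, abs_mul, abs_two, mul_assoc, ← norm_mul]
  gcongr
  exact abs_re_le_norm _

theorem norm_wirtinger_le (f : ℂ → ℂ) (z : ℂ) : ‖wirtinger f z‖ ≤ ‖fderiv ℝ f z‖ := by
  have h1 : ‖fderiv ℝ f z 1‖ ≤ ‖fderiv ℝ f z‖ := by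
    simpa using (fderiv ℝ f z).le_opNorm 1
  have h2 : ‖fderiv ℝ f z I‖ ≤ ‖fderiv ℝ f z‖ := by
    simpa using (fderiv ℝ f z).le_opNorm I
  have h3 : ‖fderiv ℝ f z 1 - I * fderiv ℝ f z I‖ ≤ ‖fderiv ℝ f z 1‖ + ‖fderiv ℝ f z I‖ := by
    simpa using norm_sub_le (fderiv ℝ f z 1) (I * fderiv ℝ f z I)
  rw [wirtinger, norm_mul]
  norm_num
  linarith

theorem wirtinger_comp_sub (f : ℂ → ℂ) (a : ℂ) :
    wirtinger (fun w => f (w - a)) = fun w => wirtinger f (w - a) := by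
  funext z
  simp only [wirtinger, fderiv_comp_sub]

theorem wirtinger_iterate_comp_sub (f : ℂ → ℂ) (a : ℂ) (j : ℕ) :
    wirtinger^[j] (fun w => f (w - a)) = fun w => wirtinger^[j] f (w - a) := by
  induction j generalizing f with
  | zero => rfl
  | succ j ih => rw [Function.iterate_succ_apply, wirtinger_comp_sub, ih]; rfl

theorem _root_.ContDiffAt.wirtinger {f : ℂ → ℂ} {z : ℂ} {k : ℕ}
    (hf : ContDiffAt ℝ (k + 1 : ℕ) f z) : ContDiffAt ℝ k (wirtinger f) z := by
  have h : ContDiffAt ℝ k (fderiv ℝ f) z := hf.fderiv_right (by norm_cast)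
  exact contDiffAt_const.mul
    ((h.clm_apply contDiffAt_const).sub (contDiffAt_const.mul (h.clm_apply contDiffAt_const)))

theorem _root_.ContDiffAt.dbar {f : ℂ → ℂ} {z : ℂ} {k : ℕ}
    (hf : ContDiffAt ℝ (k + 1 : ℕ) f z) : ContDiffAt ℝ k (dbar f) z := by
  have h : ContDiffAt ℝ k (fderiv ℝ f) z := hf.fderiv_right (by norm_cast)
  exact contDiffAt_const.mul
    ((h.clm_apply contDiffAt_const).add (contDiffAt_const.mul (h.clm_apply contDiffAt_const)))

theorem _root_.ContDiffAt.wirtinger_iterate {f : ℂ → ℂ} {z : ℂ} {k j : ℕ}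
    (hf : ContDiffAt ℝ (k + j : ℕ) f z) : ContDiffAt ℝ k (wirtinger^[j] f) z := by
  induction j generalizing f with
  | zero => exact hf
  | succ j ih => exact ih (ContDiffAt.wirtinger hf)

theorem _root_.HasCompactSupport.wirtinger {f : ℂ → ℂ} (hf : HasCompactSupport f) :
    HasCompactSupport (wirtinger f) := by
  refine (hf.fderiv (𝕜 := ℝ)).mono fun z hz => ?_
  rw [Function.mem_support] at hz ⊢
  contrapose! hz
  simp [Fock.wirtinger, hz]

theorem differentiableAt_eventually {f : ℂ → ℂ} {z : ℂ} {k : ℕ}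
    (hf : ContDiffAt ℝ (k + 1 : ℕ) f z) : ∀ᶠ w in 𝓝 z, DifferentiableAt ℝ f w :=
  (hf.eventually (by simp)).mono fun _ hw => hw.differentiableAt (by simp)

theorem wirtinger_mul_nhds {f g : ℂ → ℂ} {z : ℂ} {k : ℕ}
    (hf : ContDiffAt ℝ (k + 1 : ℕ) f z) (hg : ContDiffAt ℝ (k + 1 : ℕ) g z) :
    wirtinger (fun w => f w * g w) =ᶠ[𝓝 z]
      fun w => wirtinger f w * g w + f w * wirtinger g w := by
  filter_upwards [differentiableAt_eventually hf, differentiableAt_eventually hg] with w h1 h2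
    using wirtinger_mul h1 h2

theorem wirtinger_iterate_add {f g : ℂ → ℂ} {z : ℂ} {j : ℕ} (hf : ContDiffAt ℝ j f z)
    (hg : ContDiffAt ℝ j g z) :
    wirtinger^[j] (fun w => f w + g w) z = wirtinger^[j] f z + wirtinger^[j] g z := by
  induction j generalizing f g with
  | zero => rfl
  | succ j ih =>
    rw [Function.iterate_succ_apply, Function.iterate_succ_apply, Function.iterate_succ_apply,
      ← ih hf.wirtinger hg.wirtinger]
    refine (wirtinger_iterate_congr_nhds ?_ j).eq_of_nhds
    filter_upwards [differentiableAt_eventually hf, differentiableAt_eventually hg] with w h1 h2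
      using wirtinger_add h1 h2

theorem wirtinger_iterate_mul_succ {f g : ℂ → ℂ} {z : ℂ} {j : ℕ}
    (hf : ContDiffAt ℝ (j + 1 : ℕ) f z) (hg : ContDiffAt ℝ (j + 1 : ℕ) g z) :
    wirtinger^[j + 1] (fun w => f w * g w) z =
      wirtinger^[j] (fun w => wirtinger f w * g w) z +
        wirtinger^[j] (fun w => f w * wirtinger g w) z := by
  have hj : ((j : ℕ) : WithTop ℕ∞) ≤ ((j + 1 : ℕ) : WithTop ℕ∞) := by norm_cast; omega
  rw [Function.iterate_succ_apply, ← wirtinger_iterate_add (hf.wirtinger.mul (hg.of_le hj))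
    ((hf.of_le hj).mul hg.wirtinger)]
  exact (wirtinger_iterate_congr_nhds (wirtinger_mul_nhds hf hg) j).eq_of_nhds

theorem wirtinger_iterate_mul_eq_zero {f g : ℂ → ℂ} {z : ℂ} {j : ℕ} (hf : ContDiffAt ℝ j f z)
    (hg : ContDiffAt ℝ j g z) (h : ∀ i ≤ j, wirtinger^[i] f z = 0) :
    wirtinger^[j] (fun w => f w * g w) z = 0 := by
  induction j generalizing f g with
  | zero => simp [show f z = 0 from h 0 le_rfl]
  | succ j ih =>
    have hj : ((j : ℕ) : WithTop ℕ∞) ≤ ((j + 1 : ℕ) : WithTop ℕ∞) := by norm_cast; omega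
    rw [wirtinger_iterate_mul_succ hf hg,
      ih hf.wirtinger (hg.of_le hj) fun i hi => h (i + 1) (by omega),
      ih (hf.of_le hj) hg.wirtinger fun i hi => h i (by omega), add_zero]

/-- In the Leibniz formula every term with a derivative on `f` vanishes. Only pure `∂`-derivatives
enter, so nothing is required of the mixed ones. -/
theorem wirtinger_iterate_mul_of_flat {f g : ℂ → ℂ} {z : ℂ} {j : ℕ} (hf : ContDiffAt ℝ j f z)
    (hg : ContDiffAt ℝ j g z) (h : ∀ i, 1 ≤ i → i ≤ j → wirtinger^[i] f z = 0) :
    wirtinger^[j] (fun w => f w * g w) z = f z * wirtinger^[j] g z := by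
  induction j generalizing f g with
  | zero => rfl
  | succ j ih =>
    have hj : ((j : ℕ) : WithTop ℕ∞) ≤ ((j + 1 : ℕ) : WithTop ℕ∞) := by norm_cast; omega
    rw [wirtinger_iterate_mul_succ hf hg,
      wirtinger_iterate_mul_eq_zero hf.wirtinger (hg.of_le hj)
        fun i hi => h (i + 1) (by omega) (by omega),
      ih (hf.of_le hj) hg.wirtinger fun i hi hi' => h i hi (by omega), zero_add]
    rfl

/-- The bound depends on `j`, `A`, `B` alone; this makes the later estimates uniform in the centre
of the disc. -/
theorem exists_bound_wirtinger_iterate_mul (j : ℕ) (A B : ℝ) :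
    ∃ C : ℝ, ∀ (f g : ℂ → ℂ) (z : ℂ), ContDiffAt ℝ j f z → ContDiffAt ℝ j g z →
      (∀ i ≤ j, ‖wirtinger^[i] f z‖ ≤ A) → (∀ i ≤ j, ‖wirtinger^[i] g z‖ ≤ B) →
      ‖wirtinger^[j] (fun w => f w * g w) z‖ ≤ C := by
  induction j with
  | zero =>
    refine ⟨A * B, fun f g z _ _ h1 h2 => ?_⟩
    have h1' := h1 0 le_rfl
    have h2' := h2 0 le_rfl
    simp only [Function.iterate_zero, id_eq, norm_mul] at *
    exact mul_le_mul h1' h2' (norm_nonneg _) ((norm_nonneg _).trans h1')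
  | succ j ih =>
    obtain ⟨C, hC⟩ := ih
    have hj : ((j : ℕ) : WithTop ℕ∞) ≤ ((j + 1 : ℕ) : WithTop ℕ∞) := by norm_cast; omega
    refine ⟨C + C, fun f g z hf hg h1 h2 => ?_⟩
    rw [wirtinger_iterate_mul_succ hf hg]
    exact (norm_add_le _ _).trans (add_le_add
      (hC _ _ z hf.wirtinger (hg.of_le hj) (fun i hi => h1 (i + 1) (by omega))
        fun i hi => h2 i (by omega))
      (hC _ _ z (hf.of_le hj) hg.wirtinger (fun i hi => h1 i (by omega))
        fun i hi => h2 (i + 1) (by omega)))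

theorem wirtinger_iterate_of_differentiableOn {f : ℂ → ℂ} {U : Set ℂ} (hU : IsOpen U)
    (hf : DifferentiableOn ℂ f U) (j : ℕ) : ∀ z ∈ U, wirtinger^[j] f z = iteratedDeriv j f z := by
  induction j with
  | zero => simp
  | succ j ih =>
    intro z hz
    have hev : wirtinger^[j] f =ᶠ[𝓝 z] iteratedDeriv j f :=
      (hU.eventually_mem hz).mono ih
    rw [Function.iterate_succ_apply', iteratedDeriv_succ, wirtinger_congr hev]
    refine wirtinger_of_differentiableAt ?_
    have : DifferentiableOn ℂ (iteratedDeriv j f) U := by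
      rw [iteratedDeriv_eq_iterate]
      clear hev ih
      induction j with
      | zero => simpa using hf
      | succ j ih => rw [Function.iterate_succ_apply']; exact ih.deriv hU
    exact this.differentiableAt (hU.mem_nhds hz)

/-- After one differentiation the factor `∂ψ` appears, and it vanishes at `z` together with its
`∂`-derivatives up to order `j - 1`. -/
theorem wirtinger_iterate_exp_neg_eq_zero {ψ : ℂ → ℂ} {z : ℂ} {j : ℕ} (hψ : ContDiffAt ℝ j ψ z)
    (h : ∀ i, 1 ≤ i → i ≤ j → wirtinger^[i] ψ z = 0) (hj : 1 ≤ j) :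
    wirtinger^[j] (fun w => exp (-ψ w)) z = 0 := by
  obtain ⟨j, rfl⟩ : ∃ k, j = k + 1 := ⟨j - 1, by omega⟩
  have hle : ((j : ℕ) : WithTop ℕ∞) ≤ ((j + 1 : ℕ) : WithTop ℕ∞) := by norm_cast; omega
  have key : wirtinger (fun w => exp (-ψ w)) =ᶠ[𝓝 z]
      fun w => wirtinger ψ w * (-exp (-ψ w)) := by
    filter_upwards [differentiableAt_eventually hψ] with w hw
    have h1 : HasFDerivAt (fun w => exp (-ψ w)) (exp (-ψ w) • (-fderiv ℝ ψ w)) w :=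
      hw.hasFDerivAt.neg.cexp
    simp only [wirtinger, h1.fderiv, smul_apply, neg_apply,
      smul_eq_mul]
    ring
  rw [Function.iterate_succ_apply, (wirtinger_iterate_congr_nhds key j).eq_of_nhds]
  exact wirtinger_iterate_mul_eq_zero hψ.wirtinger (hψ.of_le hle).neg.cexp.neg
    fun i hi => h (i + 1) (by omega) (by omega)

/-- The operator is `-∂` conjugated by `e^{-φ}`, so in the iterates the inner exponentials cancel.
-/
theorem dbarStar_iterate (φ : ℂ → ℝ) (f : ℂ → ℂ) (j : ℕ) (z : ℂ) :
    (dbarStar φ)^[j] f z = (-1) ^ j * ((Real.exp (φ z) : ℝ) : ℂ) *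
      wirtinger^[j] (fun w => ((Real.exp (-φ w) : ℝ) : ℂ) * f w) z := by
  induction j generalizing z with
  | zero =>
    simp only [Function.iterate_zero, id_eq, pow_zero, one_mul]
    rw [← mul_assoc, ← ofReal_mul, ← Real.exp_add]
    simp
  | succ j ih =>
    rw [Function.iterate_succ_apply', Function.iterate_succ_apply', dbarStar]
    have : (fun w => ((Real.exp (-φ w) : ℝ) : ℂ) * (dbarStar φ)^[j] f w) =
        fun w => (-1) ^ j * wirtinger^[j] (fun w => ((Real.exp (-φ w) : ℝ) : ℂ) * f w) w := by
      funext w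
      rw [ih]
      have h : ((Real.exp (-φ w) : ℝ) : ℂ) * ((Real.exp (φ w) : ℝ) : ℂ) = 1 := by
        rw [← ofReal_mul, ← Real.exp_add]; simp
      linear_combination
        ((-1) ^ j * wirtinger^[j] (fun w => ((Real.exp (-φ w) : ℝ) : ℂ) * f w) w) * h
    rw [this]
    -- No differentiability is assumed, so `(-1) ^ j` is pulled out as a mere sign: `fderiv`
    -- commutes with negation unconditionally.
    rcases Nat.even_or_odd j with hj | hj
    · simp [hj.neg_one_pow, pow_succ]
    · have h2 : ∀ F : ℂ → ℂ, wirtinger (fun w => -F w) z = - wirtinger F z := by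
        intro F
        simp only [wirtinger, fderiv_fun_neg, neg_apply]
        ring
      simp [hj.neg_one_pow, pow_succ, h2]

theorem dbar_wirtinger_eq_lap {φ : ℂ → ℝ} (hφ : ContDiff ℝ 2 φ) (z : ℂ) :
    dbar (wirtinger fun w => ((φ w : ℝ) : ℂ)) z = ((lap φ z : ℝ) : ℂ) := by
  have hd : Differentiable ℝ φ := hφ.differentiable (by norm_num)
  have h1 : (wirtinger fun w => ((φ w : ℝ) : ℂ)) =
      fun w => (1 / 2) * (((fderiv ℝ φ w 1 : ℝ) : ℂ) - I * ((fderiv ℝ φ w I : ℝ) : ℂ)) :=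
    funext fun w => wirtinger_ofReal (hd w)
  have hd2 : DifferentiableAt ℝ (fderiv ℝ φ) z :=
    (hφ.fderiv_right (m := 1) (by norm_num)).differentiable (by norm_num) z
  have hv : ∀ v : ℂ, HasFDerivAt (fun w => ((fderiv ℝ φ w v : ℝ) : ℂ))
      (ofRealCLM.comp ((fderiv ℝ (fderiv ℝ φ) z).flip v)) z := fun v => by
    have := hd2.hasFDerivAt.clm_apply (hasFDerivAt_const v z)
    refine (ofRealCLM.hasFDerivAt.comp z this).congr_fderiv ?_
    ext; simp
  have h2 := (((hv 1).fun_sub ((hv I).const_mul I)).const_mul (1 / 2 : ℂ))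
  have hsymm : fderiv ℝ (fderiv ℝ φ) z 1 I = fderiv ℝ (fderiv ℝ φ) z I 1 :=
    (hφ.contDiffAt.isSymmSndFDerivAt (by simp)) 1 I
  rw [h1, dbar, h2.fderiv, lap, InnerProductSpace.laplacian_eq_iteratedFDeriv_complexPlane]
  simp only [iteratedFDeriv_two_apply]
  simp
  rw [hsymm]
  linear_combination (-(1 / 4) * ((fderiv ℝ (fderiv ℝ φ) z I) I : ℂ)) * I_sq

end Fock

namespace Fock

open Topology Complex Set

/-! ### Polar coordinates and circle averages. -/

theorem integrableOn_polarCoord_symm {E : Type*} [NormedAddCommGroup E] [NormedSpace ℝ E]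
    {F : ℂ → E} (hF : Integrable F) :
    IntegrableOn (fun p : ℝ × ℝ => p.1 • F (Complex.polarCoord.symm p))
      (Ioi (0 : ℝ) ×ˢ Ioo (-Real.pi) Real.pi) := by
  have h1 : Integrable (fun q : ℝ × ℝ => F (measurableEquivRealProd.symm q)) :=
    ((Complex.volume_preserving_equiv_real_prod.symm).integrable_comp_emb
      measurableEquivRealProd.symm.measurableEmbedding).2 hF
  have h2 := (integrableOn_image_iff_integrableOn_abs_det_fderiv_smul volume
    (s := _root_.polarCoord.target) _root_.polarCoord.open_target.measurableSet
    (f := _root_.polarCoord.symm)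
    (fun x _ => (hasFDerivAt_polarCoord_symm x).hasFDerivWithinAt)
    _root_.polarCoord.symm.injOn
    (fun q : ℝ × ℝ => F (measurableEquivRealProd.symm q))).1 h1.integrableOn
  refine h2.congr_fun ?_ _root_.polarCoord.open_target.measurableSet
  rintro ⟨ρ, θ⟩ ⟨hρ, -⟩
  dsimp only
  rw [det_fderivPolarCoordSymm, abs_of_pos hρ,
    Complex.measurableEquivRealProd_symm_polarCoord_symm_apply]

theorem polarCoord_symm_eq_circleMap (ρ θ : ℝ) :
    Complex.polarCoord.symm (ρ, θ) = circleMap 0 ρ θ := by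
  rw [Complex.polarCoord_symm_apply, circleMap, exp_mul_I]
  simp

theorem integral_eq_integral_polar {E : Type*} [NormedAddCommGroup E] [NormedSpace ℝ E]
    {F : ℂ → E} (hF : Integrable F) :
    ∫ w, F w = ∫ ρ in Ioi (0 : ℝ), ∫ θ in Ioo (-Real.pi) Real.pi, ρ • F (circleMap 0 ρ θ) := by
  rw [← Complex.integral_comp_polarCoord_symm]
  change ∫ p in Ioi (0 : ℝ) ×ˢ Ioo (-Real.pi) Real.pi, _ = _
  rw [Measure.volume_eq_prod, setIntegral_prod _ (integrableOn_polarCoord_symm hF)]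
  simp only [polarCoord_symm_eq_circleMap]

theorem integral_Ioo_circleMap (F : ℂ → ℂ) (z : ℂ) (ρ : ℝ) :
    ∫ θ in Ioo (-Real.pi) Real.pi, F (circleMap z ρ θ) =
      (2 * Real.pi) • Real.circleAverage F z ρ := by
  rw [Real.circleAverage_eq_integral_add (-Real.pi), smul_smul,
    mul_inv_cancel₀ (by positivity), one_smul,
    intervalIntegral.integral_comp_add_right (fun θ => F (circleMap z ρ θ)),
    intervalIntegral.integral_of_le (by linarith [Real.pi_pos]), integral_Ioc_eq_integral_Ioo]
  ring_nf

theorem integral_Ioo_circleMap_real (F : ℂ → ℝ) (z : ℂ) (ρ : ℝ) :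
    ∫ θ in Ioo (-Real.pi) Real.pi, F (circleMap z ρ θ) =
      (2 * Real.pi) * Real.circleAverage F z ρ := by
  rw [Real.circleAverage_eq_integral_add (-Real.pi), smul_eq_mul, ← mul_assoc,
    mul_inv_cancel₀ (by positivity), one_mul,
    intervalIntegral.integral_comp_add_right (fun θ => F (circleMap z ρ θ)),
    intervalIntegral.integral_of_le (by linarith [Real.pi_pos]), integral_Ioc_eq_integral_Ioo]
  ring_nf

theorem norm_circleMap_zero_of_pos {ρ : ℝ} (hρ : 0 < ρ) (θ : ℝ) : ‖circleMap 0 ρ θ‖ = ρ := by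
  simp [abs_of_pos hρ]

theorem integral_radial_mul {k : ℝ → ℝ} {F : ℂ → ℂ} {z : ℂ}
    (hF : Integrable fun w => k ‖w‖ • F (z + w)) :
    ∫ w, k ‖w‖ • F (z + w) =
      ∫ ρ in Ioi (0 : ℝ), (2 * Real.pi * ρ * k ρ) • Real.circleAverage F z ρ := by
  rw [integral_eq_integral_polar hF]
  refine setIntegral_congr_fun measurableSet_Ioi fun ρ hρ => ?_
  simp only [norm_circleMap_zero_of_pos hρ, integral_smul]
  have : ∀ θ, z + circleMap 0 ρ θ = circleMap z ρ θ := fun θ => by simp [circleMap]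
  simp only [this, integral_Ioo_circleMap, smul_smul]
  ring_nf

theorem integral_radial_mul_real {k : ℝ → ℝ} {F : ℂ → ℝ} {z : ℂ}
    (hF : Integrable fun w => k ‖w‖ * F (z + w)) :
    ∫ w, k ‖w‖ * F (z + w) =
      ∫ ρ in Ioi (0 : ℝ), (2 * Real.pi * ρ * k ρ) * Real.circleAverage F z ρ := by
  rw [integral_eq_integral_polar hF]
  refine setIntegral_congr_fun measurableSet_Ioi fun ρ hρ => ?_
  simp only [norm_circleMap_zero_of_pos hρ, integral_const_mul, smul_eq_mul]
  have : ∀ θ, z + circleMap 0 ρ θ = circleMap z ρ θ := fun θ => by simp [circleMap]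
  simp only [this, integral_Ioo_circleMap_real]
  ring_nf

/-! ### The Cauchy transform as a solution operator for `∂̄`. -/

/-- The kernel of the Cauchy transform. -/
noncomputable def cauchyKernel (w : ℂ) : ℂ := (Real.pi * w)⁻¹

theorem locallyIntegrable_cauchyKernel : LocallyIntegrable cauchyKernel := by
  refine locallyIntegrable_of_norm_le_rpow (C := Real.pi⁻¹) (α := 1)
    (by simp) (by simp) (Eventually.of_forall fun w => ?_) ?_
  · rw [cauchyKernel, norm_inv, norm_mul, mul_inv, Complex.norm_real, Real.norm_of_nonneg
      Real.pi_pos.le, Real.rpow_neg_one]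
  · exact ((measurable_const.mul measurable_id).inv).aestronglyMeasurable

theorem integrableOn_polar_of_bounded {h : ℝ × ℝ → ℂ} (hc : Continuous h) {R : ℝ}
    (hR : ∀ p : ℝ × ℝ, R < p.1 → h p = 0) :
    IntegrableOn h (Ioi (0 : ℝ) ×ˢ Ioo (-Real.pi) Real.pi) := by
  have h1 : IntegrableOn h (Icc 0 R ×ˢ Icc (-Real.pi) Real.pi) :=
    hc.continuousOn.integrableOn_compact (isCompact_Icc.prod isCompact_Icc)
  refine h1.of_forall_sdiff_eq_zero (measurableSet_Ioi.prod measurableSet_Ioo) ?_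
  rintro ⟨ρ, θ⟩ ⟨⟨hρ, hθ⟩, hn⟩
  refine hR _ ?_
  by_contra! hle
  exact hn ⟨⟨le_of_lt hρ, hle⟩, Ioo_subset_Icc_self hθ⟩

/-- `1/(π w)` is a fundamental solution of `∂̄`. In polar coordinates the Jacobian cancels the
singularity, and the integrand becomes `(A + iB)/(2π)` with `A` the radial derivative of `v` and `ρ
B` its angular derivative. The integral of `A` along each ray is `-v 0`, and `B` integrates to zero
over each circle by periodicity. -/
theorem integral_cauchyKernel_mul_dbar {v : ℂ → ℂ} (hv : ContDiff ℝ 1 v)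
    (hc : HasCompactSupport v) : ∫ w, cauchyKernel w * dbar v w = -v 0 := by
  have hfc : Continuous (fderiv ℝ v) := hv.continuous_fderiv one_ne_zero
  have hdc : Continuous (dbar v) := continuous_const.mul
    ((hfc.clm_apply continuous_const).add (continuous_const.mul (hfc.clm_apply continuous_const)))
  have hcd : HasCompactSupport (dbar v) := by
    refine (hc.fderiv (𝕜 := ℝ)).mono fun z hz => ?_
    rw [Function.mem_support] at hz ⊢
    contrapose! hz
    simp [dbar, hz]
  have hint : Integrable fun w => cauchyKernel w * dbar v w := by
    have := locallyIntegrable_cauchyKernel.integrable_smul_left_of_hasCompactSupport hdc hcd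
    simpa [mul_comm, smul_eq_mul] using this
  obtain ⟨R, hRpos, hR⟩ := (hc.fderiv (𝕜 := ℝ)).isCompact.isBounded.exists_pos_norm_lt
  have hzero : ∀ w : ℂ, R < ‖w‖ → fderiv ℝ v w = 0 := fun w hw =>
    image_eq_zero_of_notMem_tsupport fun hmem => absurd (hR w hmem) (by linarith)
  let A : ℝ × ℝ → ℂ := fun p => fderiv ℝ v (circleMap 0 p.1 p.2) (exp (p.2 * I))
  let B : ℝ × ℝ → ℂ := fun p => fderiv ℝ v (circleMap 0 p.1 p.2) (I * exp (p.2 * I))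
  have hcm : Continuous fun p : ℝ × ℝ => circleMap 0 p.1 p.2 := by
    unfold circleMap; fun_prop
  have hAc : Continuous A := (hfc.comp hcm).clm_apply (by fun_prop)
  have hBc : Continuous B := (hfc.comp hcm).clm_apply (by fun_prop)
  have hz : ∀ p : ℝ × ℝ, R < p.1 → fderiv ℝ v (circleMap 0 p.1 p.2) = 0 := fun p hp =>
    hzero _ (by rw [norm_circleMap_zero_of_pos (hRpos.trans hp)]; exact hp)
  have hA0 : ∀ p : ℝ × ℝ, R < p.1 → A p = 0 := fun p hp => by simp [A, hz p hp]
  have hB0 : ∀ p : ℝ × ℝ, R < p.1 → B p = 0 := fun p hp => by simp [B, hz p hp]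
  have hAi := integrableOn_polar_of_bounded hAc hA0
  have hBi := integrableOn_polar_of_bounded hBc hB0
  have hV : ∀ ρ θ : ℝ, HasDerivAt (fun ρ : ℝ => v (circleMap 0 ρ θ)) (A (ρ, θ)) ρ := by
    intro ρ θ
    have h1 : HasDerivAt (fun ρ : ℝ => circleMap 0 ρ θ) (exp (θ * I)) ρ := by
      have := ((hasDerivAt_id ρ).ofReal_comp.mul_const (exp (θ * I))).const_add 0
      simpa [circleMap] using! this
    exact ((hv.differentiable one_ne_zero _).hasFDerivAt.comp_hasDerivAt ρ h1)
  have hW : ∀ ρ θ : ℝ, HasDerivAt (fun θ : ℝ => v (circleMap 0 ρ θ)) (ρ * B (ρ, θ)) θ := by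
    intro ρ θ
    have h1 := (hv.differentiable one_ne_zero _).hasFDerivAt.comp_hasDerivAt θ
      (hasDerivAt_circleMap 0 ρ θ)
    refine h1.congr_deriv ?_
    have : circleMap 0 ρ θ * I = ρ • (I * exp (θ * I)) := by
      simp [circleMap]; ring
    rw [this, map_smul, real_smul]
  have hAint : ∫ p in Ioi (0 : ℝ) ×ˢ Ioo (-Real.pi) Real.pi, A p = -(2 * Real.pi) * v 0 := by
    have hAi' : Integrable A ((volume.restrict (Ioi (0 : ℝ))).prod
        (volume.restrict (Ioo (-Real.pi) Real.pi))) := by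
      rw [Measure.prod_restrict]; exact hAi
    rw [Measure.volume_eq_prod, ← Measure.prod_restrict, integral_prod_symm _ hAi']
    have : ∀ θ : ℝ, ∫ ρ in Ioi (0 : ℝ), A (ρ, θ) = - v 0 := by
      intro θ
      have hlim : Tendsto (fun ρ : ℝ => v (circleMap 0 ρ θ)) atTop (𝓝 0) := by
        obtain ⟨R', hR'pos, hR'⟩ := hc.isCompact.isBounded.exists_pos_norm_lt
        refine tendsto_const_nhds.congr' ?_
        filter_upwards [eventually_gt_atTop R'] with ρ hρ
        refine (image_eq_zero_of_notMem_tsupport fun hmem => absurd (hR' _ hmem) ?_).symm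
        rw [norm_circleMap_zero_of_pos (hR'pos.trans hρ)]
        exact not_lt.2 hρ.le
      have hi : IntegrableOn (fun ρ => A (ρ, θ)) (Ioi 0) := by
        have h1 : IntegrableOn (fun ρ => A (ρ, θ)) (Icc 0 R) :=
          (hAc.comp (by fun_prop : Continuous fun ρ : ℝ => (ρ, θ))).continuousOn.integrableOn_compact
            isCompact_Icc
        refine h1.of_forall_sdiff_eq_zero measurableSet_Ioi fun ρ hρ => hA0 _ ?_
        by_contra! hle
        exact hρ.2 ⟨le_of_lt hρ.1, hle⟩
      have := integral_Ioi_of_hasDerivAt_of_tendsto' (a := 0) (fun ρ _ => hV ρ θ) hi hlim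
      rw [this]
      simp [circleMap]
    simp only [this, setIntegral_const, measureReal_def, Real.volume_Ioo]
    rw [ENNReal.toReal_ofReal (by linarith [Real.pi_pos]), real_smul]
    push_cast
    ring
  have hBint : ∫ p in Ioi (0 : ℝ) ×ˢ Ioo (-Real.pi) Real.pi, B p = 0 := by
    rw [Measure.volume_eq_prod, setIntegral_prod _ hBi]
    refine (setIntegral_congr_fun measurableSet_Ioi fun ρ hρ => ?_).trans (integral_zero _ _)
    have hρ' : (ρ : ℂ) ≠ 0 := by exact_mod_cast (ne_of_gt hρ)
    have h1 : ∫ θ in (-Real.pi)..Real.pi, (ρ : ℂ) * B (ρ, θ) = 0 := by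
      rw [intervalIntegral.integral_eq_sub_of_hasDerivAt (fun θ _ => hW ρ θ)]
      · have : circleMap 0 ρ (-Real.pi) = circleMap 0 ρ Real.pi := by
          simp [circleMap, exp_neg]
        rw [this, sub_self]
      · exact (continuous_const.mul
          (hBc.comp (by fun_prop : Continuous fun θ : ℝ => (ρ, θ)))).intervalIntegrable _ _
    rw [intervalIntegral.integral_const_mul, mul_eq_zero, or_iff_right hρ',
      intervalIntegral.integral_of_le (by linarith [Real.pi_pos]),
      integral_Ioc_eq_integral_Ioo] at h1
    exact h1
  rw [← Complex.integral_comp_polarCoord_symm]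
  change ∫ p in Ioi (0 : ℝ) ×ˢ Ioo (-Real.pi) Real.pi, _ = _
  have hcongr : ∫ p in Ioi (0 : ℝ) ×ˢ Ioo (-Real.pi) Real.pi,
      p.1 • (cauchyKernel (Complex.polarCoord.symm p) * dbar v (Complex.polarCoord.symm p)) =
      ∫ p in Ioi (0 : ℝ) ×ˢ Ioo (-Real.pi) Real.pi, (2 * Real.pi : ℂ)⁻¹ * (A p + I * B p) := by
    refine setIntegral_congr_fun (measurableSet_Ioi.prod measurableSet_Ioo) ?_
    rintro ⟨ρ, θ⟩ ⟨hρ, -⟩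
    have hρ' : (ρ : ℂ) ≠ 0 := by exact_mod_cast (ne_of_gt hρ)
    have hπ : (Real.pi : ℂ) ≠ 0 := by exact_mod_cast Real.pi_ne_zero
    simp only [polarCoord_symm_eq_circleMap, A, B, fderiv_apply_eq_wirtinger v, map_mul, conj_I]
    have he : (starRingEnd ℂ) (exp (θ * I)) * exp (θ * I) = 1 := by
      rw [← exp_conj, ← exp_add]; simp
    have he0 : exp (θ * I) ≠ 0 := exp_ne_zero _
    have he' : (starRingEnd ℂ) (exp (θ * I)) = (exp (θ * I))⁻¹ := eq_inv_of_mul_eq_one_left he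
    have hcm' : circleMap 0 ρ θ = ρ * exp (θ * I) := by simp [circleMap]
    rw [he', cauchyKernel, real_smul]
    have : cauchyKernel (circleMap 0 ρ θ) = (Real.pi * (ρ * exp (θ * I)))⁻¹ := by
      rw [cauchyKernel, hcm']
    rw [show ((Real.pi : ℂ) * circleMap 0 ρ θ) = Real.pi * (ρ * exp (θ * I)) by rw [hcm']]
    set D := dbar v (circleMap 0 ρ θ)
    set W := wirtinger v (circleMap 0 ρ θ)
    set e := exp (θ * I)
    field_simp
    linear_combination (-W * e ^ 2 + D) * I_sq
  rw [hcongr, integral_const_mul, integral_add hAi (hBi.const_mul I), integral_const_mul, hAint,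
    hBint]
  have hπ : (Real.pi : ℂ) ≠ 0 := by exact_mod_cast Real.pi_ne_zero
  field_simp
  simp

/-- The Cauchy transform of a function. -/
noncomputable def cauchyTransform (g : ℂ → ℂ) (z : ℂ) : ℂ := ∫ w, cauchyKernel w * g (z - w)

theorem cauchyTransform_eq_convolution (g : ℂ → ℂ) :
    cauchyTransform g = convolution cauchyKernel g (ContinuousLinearMap.mul ℝ ℂ) volume := rfl

theorem contDiff_cauchyTransform {g : ℂ → ℂ} {k : ℕ} (hg : ContDiff ℝ k g)
    (hc : HasCompactSupport g) : ContDiff ℝ k (cauchyTransform g) := by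
  rw [cauchyTransform_eq_convolution]
  exact_mod_cast hc.contDiff_convolution_right (n := (k : ℕ∞)) _ locallyIntegrable_cauchyKernel hg

theorem fderiv_cauchyTransform {g : ℂ → ℂ} (hg : ContDiff ℝ 1 g)
    (hc : HasCompactSupport g) (z v : ℂ) :
    fderiv ℝ (cauchyTransform g) z v = cauchyTransform (fun w => fderiv ℝ g w v) z := by
  have h := hc.hasFDerivAt_convolution_right (ContinuousLinearMap.mul ℝ ℂ)
    locallyIntegrable_cauchyKernel hg z
  rw [cauchyTransform_eq_convolution, h.fderiv]
  have hex : ConvolutionExistsAt cauchyKernel (fderiv ℝ g) z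
      ((ContinuousLinearMap.mul ℝ ℂ).precompR ℂ) volume :=
    (hc.fderiv (𝕜 := ℝ)).convolutionExists_right _ locallyIntegrable_cauchyKernel
      (hg.continuous_fderiv one_ne_zero) z
  rw [convolution_def, ContinuousLinearMap.integral_apply hex]
  rfl

theorem integrable_cauchyKernel_mul {g : ℂ → ℂ} (hg : Continuous g)
    (hc : HasCompactSupport g) (z : ℂ) : Integrable fun w => cauchyKernel w * g (z - w) :=
  hc.convolutionExists_right (ContinuousLinearMap.mul ℝ ℂ) locallyIntegrable_cauchyKernel hg z

theorem wirtinger_cauchyTransform {g : ℂ → ℂ} (hg : ContDiff ℝ 1 g)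
    (hc : HasCompactSupport g) : wirtinger (cauchyTransform g) = cauchyTransform (wirtinger g) := by
  funext z
  have hi : ∀ v, Integrable fun w => cauchyKernel w * fderiv ℝ g (z - w) v := fun v =>
    integrable_cauchyKernel_mul ((hg.continuous_fderiv one_ne_zero).clm_apply continuous_const)
      (hc.fderiv_apply (𝕜 := ℝ) v) z
  simp only [wirtinger, fderiv_cauchyTransform hg hc]
  simp only [cauchyTransform, wirtinger]
  rw [← integral_const_mul, ← integral_sub (hi 1) ((hi I).const_mul I), ← integral_const_mul]
  congr 1
  funext w
  ring

/-- The derivative falls on `g`; the fundamental solution formula is then applied to `w ↦ g (z -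
w)`, whose value at `0` is `g z`. -/
theorem dbar_cauchyTransform {g : ℂ → ℂ} (hg : ContDiff ℝ 1 g)
    (hc : HasCompactSupport g) : dbar (cauchyTransform g) = g := by
  funext z
  have hi : ∀ v, Integrable fun w => cauchyKernel w * fderiv ℝ g (z - w) v := fun v =>
    integrable_cauchyKernel_mul ((hg.continuous_fderiv one_ne_zero).clm_apply continuous_const)
      (hc.fderiv_apply (𝕜 := ℝ) v) z
  have h1 : dbar (cauchyTransform g) z = ∫ w, cauchyKernel w * dbar g (z - w) := by
    simp only [dbar, fderiv_cauchyTransform hg hc, cauchyTransform]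
    rw [← integral_const_mul, ← integral_add (hi 1) ((hi I).const_mul I), ← integral_const_mul]
    congr 1
    funext w
    ring
  have h2 : ∀ w, dbar g (z - w) = -dbar (fun w => g (z - w)) w := fun w => by
    have : HasFDerivAt (fun w => g (z - w)) (-(fderiv ℝ g (z - w))) w := by
      have := (hg.differentiable one_ne_zero (z - w)).hasFDerivAt.comp w
        ((hasFDerivAt_const z w).sub (hasFDerivAt_id w))
      refine this.congr_fderiv ?_
      ext v
      simp
    simp only [dbar, this.fderiv, neg_apply]
    ring
  rw [h1]
  simp only [h2, mul_neg, integral_neg]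
  rw [integral_cauchyKernel_mul_dbar (v := fun w => g (z - w)) (hg.comp (contDiff_const.sub contDiff_id))
    (hc.comp_homeomorph (Homeomorph.subLeft z))]
  simp

theorem exists_bound_cauchyTransform : ∃ C : ℝ, 0 ≤ C ∧ ∀ (a : ℂ) (g : ℂ → ℂ) (B : ℝ),
    Continuous g → HasCompactSupport g → (∀ w, 2 ≤ ‖w - a‖ → g w = 0) → (∀ w, ‖g w‖ ≤ B) →
    ∀ z ∈ Metric.ball a 1, ‖cauchyTransform g z‖ ≤ C * B := by
  -- The radius `3` is `1 + 2`: for `z` in the unit disc about `a` and `‖w‖ > 3`, the point `z - w`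
  -- is at distance more than `2` from `a`. The constant does not depend on `a`.
  refine ⟨∫ w in Metric.closedBall (0 : ℂ) 3, ‖cauchyKernel w‖, by positivity,
    fun a g B hg hc h0 hB z hz => ?_⟩
  have hi := (locallyIntegrable_cauchyKernel.integrableOn_isCompact
    (isCompact_closedBall (0 : ℂ) 3)).norm
  have h1 : cauchyTransform g z =
      ∫ w in Metric.closedBall (0 : ℂ) 3, cauchyKernel w * g (z - w) := by
    refine (setIntegral_eq_integral_of_forall_compl_eq_zero fun w hw => ?_).symm
    rw [h0, mul_zero]
    rw [mem_closedBall_zero_iff, not_le] at hw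
    rw [Metric.mem_ball, dist_eq] at hz
    have h2 : ‖w‖ ≤ ‖z - w - a‖ + ‖z - a‖ := by
      have : w = -(z - w - a) + (z - a) := by ring
      conv_lhs => rw [this]
      exact (norm_add_le _ _).trans (by rw [norm_neg])
    linarith
  rw [h1, ← integral_mul_const]
  refine norm_integral_le_of_norm_le (hi.mul_const B) (Eventually.of_forall fun w => ?_)
  rw [norm_mul]
  exact mul_le_mul_of_nonneg_left (hB _) (norm_nonneg _)

/-! ### The mean value property over discs. -/

theorem setIntegral_ball_eq_of_differentiableOn {f : ℂ → ℂ} {z : ℂ} {r : ℝ} (hr : 0 ≤ r)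
    (hf : DifferentiableOn ℂ f (Metric.ball z r)) (hi : IntegrableOn f (Metric.ball z r)) :
    ∫ w in Metric.ball z r, f w = (Real.pi * r ^ 2) • f z := by
  have h1 : ∀ w, (Metric.ball z r).indicator f (z + w) =
      ((Iio r).indicator (fun _ => (1 : ℝ)) ‖w‖) • f (z + w) := fun w => by
    by_cases hw : ‖w‖ < r
    · rw [indicator_of_mem (by simpa using hw), indicator_of_mem (by simpa using hw), one_smul]
    · rw [indicator_of_notMem (by simpa using hw), indicator_of_notMem (by simpa using hw),
        zero_smul]
  rw [← integral_indicator measurableSet_ball, ← integral_add_left_eq_self _ z]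
  have hi' : Integrable fun w => (Metric.ball z r).indicator f (z + w) :=
    ((integrable_indicator_iff measurableSet_ball).2 hi).comp_add_left z
  simp only [h1] at hi' ⊢
  rw [integral_radial_mul hi']
  have h2 : ∫ ρ in Ioi (0 : ℝ), (2 * Real.pi * ρ * (Iio r).indicator (fun _ => (1 : ℝ)) ρ) •
      Real.circleAverage f z ρ =
      ∫ ρ in Ioi (0 : ℝ), (Iio r).indicator (fun ρ => (2 * Real.pi * ρ) • f z) ρ := by
    refine setIntegral_congr_fun measurableSet_Ioi fun ρ hρ => ?_
    by_cases hρr : ρ < r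
    · simp only [indicator_of_mem (mem_Iio.2 hρr), mul_one]
      rw [DiffContOnCl.circleAverage]
      rw [abs_of_pos hρ]
      exact (hf.mono ((closure_ball z (ne_of_gt hρ)).le.trans
        (Metric.closedBall_subset_ball hρr))).diffContOnCl
    · simp only [indicator_of_notMem (by simpa using hρr : ρ ∉ Iio r), mul_zero, zero_smul]
  rw [h2, setIntegral_indicator measurableSet_Iio, Ioi_inter_Iio, integral_smul_const,
    ← integral_Ioc_eq_integral_Ioo, ← intervalIntegral.integral_of_le hr,
    intervalIntegral.integral_const_mul, integral_id]
  congr 1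
  ring

/-- The mean value property of the holomorphic function `f ^ 2`. -/
theorem norm_sq_le_setIntegral_ball {f : ℂ → ℂ} {z : ℂ} {r : ℝ} (hr : 0 < r)
    (hf : DifferentiableOn ℂ f (Metric.ball z r))
    (hi : IntegrableOn (fun w => ‖f w‖ ^ 2) (Metric.ball z r)) :
    ‖f z‖ ^ 2 ≤ (Real.pi * r ^ 2)⁻¹ * ∫ w in Metric.ball z r, ‖f w‖ ^ 2 := by
  have hd : DifferentiableOn ℂ (fun w => f w ^ 2) (Metric.ball z r) := hf.pow 2
  have hi2 : IntegrableOn (fun w => f w ^ 2) (Metric.ball z r) := by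
    refine hi.mono' (hd.continuousOn.aestronglyMeasurable measurableSet_ball)
      (Eventually.of_forall fun w => by simp)
  have h := setIntegral_ball_eq_of_differentiableOn hr.le hd hi2
  have h2 : ‖(Real.pi * r ^ 2) • (f z ^ 2)‖ ≤ ∫ w in Metric.ball z r, ‖f w‖ ^ 2 := by
    rw [← h]
    refine (norm_integral_le_integral_norm _).trans_eq ?_
    simp only [norm_pow]
  rw [norm_smul, norm_pow, Real.norm_of_nonneg (by positivity)] at h2
  rw [le_inv_mul_iff₀ (by positivity)]
  exact h2

/-! ### Local holomorphic gauges for smooth weights. -/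

theorem exists_forall_lt_bound {F : ℕ → ℂ → ℂ} {n : ℕ}
    (h : ∀ i < n, ∃ A : ℝ, ∀ z, ‖F i z‖ ≤ A) : ∃ A : ℝ, ∀ i < n, ∀ z, ‖F i z‖ ≤ A := by
  induction n with
  | zero => exact ⟨0, fun i hi => absurd hi (by omega)⟩
  | succ n ih =>
    obtain ⟨A, hA⟩ := ih fun i hi => h i (by omega)
    obtain ⟨A', hA'⟩ := h n (by omega)
    refine ⟨max A A', fun i hi z => ?_⟩
    rcases Nat.lt_succ_iff_lt_or_eq.1 hi with hi | rfl
    · exact (hA i hi z).trans (le_max_left _ _)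
    · exact (hA' z).trans (le_max_right _ _)

theorem _root_.HasCompactSupport.wirtinger_iterate {f : ℂ → ℂ} (hf : HasCompactSupport f) (j : ℕ) :
    HasCompactSupport (wirtinger^[j] f) := by
  induction j with
  | zero => exact hf
  | succ j ih => rw [Function.iterate_succ_apply']; exact ih.wirtinger

theorem _root_.ContDiff.wirtinger_iterate {f : ℂ → ℂ} {k j : ℕ} (hf : ContDiff ℝ (k + j : ℕ) f) :
    ContDiff ℝ k (wirtinger^[j] f) :=
  contDiff_iff_contDiffAt.2 fun _ => hf.contDiffAt.wirtinger_iterate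

theorem wirtinger_zero : wirtinger (fun _ => 0) = fun _ => 0 := by
  funext z; simp [wirtinger]

theorem wirtinger_iterate_eq_zero_of_eventuallyEq {f : ℂ → ℂ} {z : ℂ} (h : f =ᶠ[𝓝 z] fun _ => 0)
    (j : ℕ) : wirtinger^[j] f z = 0 := by
  rw [(wirtinger_iterate_congr_nhds h j).eq_of_nhds, Function.iterate_fixed wirtinger_zero]

theorem wirtinger_iterate_cauchyTransform {g : ℂ → ℂ} {j : ℕ} (hg : ContDiff ℝ j g)
    (hc : HasCompactSupport g) :
    wirtinger^[j] (cauchyTransform g) = cauchyTransform (wirtinger^[j] g) := by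
  induction j with
  | zero => rfl
  | succ j ih =>
    have hj : ((j : ℕ) : WithTop ℕ∞) ≤ ((j + 1 : ℕ) : WithTop ℕ∞) := by norm_cast; omega
    rw [Function.iterate_succ_apply', Function.iterate_succ_apply', ih (hg.of_le hj),
      wirtinger_cauchyTransform _ (hc.wirtinger_iterate j)]
    have : ContDiff ℝ (1 + j : ℕ) g := by rwa [add_comm]
    exact_mod_cast this.wirtinger_iterate

/-- A smooth cutoff, equal to `1` on the unit disc and supported in the disc of radius `3/2`. -/
noncomputable def cutoff : ContDiffBump (0 : ℂ) := ⟨1, 3 / 2, by norm_num, by norm_num⟩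

theorem exists_bound_wirtinger_cutoff (n : ℕ) : ∃ A : ℝ, ∀ i < n, ∀ z,
    ‖wirtinger^[i] (fun w => ((cutoff w : ℝ) : ℂ)) z‖ ≤ A := by
  refine exists_forall_lt_bound fun i _ => ?_
  have hc : HasCompactSupport fun w => ((cutoff w : ℝ) : ℂ) :=
    cutoff.hasCompactSupport.comp_left (g := fun x : ℝ => (x : ℂ)) (by simp)
  have hs : ContDiff ℝ (0 + i : ℕ) fun w => ((cutoff w : ℝ) : ℂ) :=
    ofRealCLM.contDiff.comp cutoff.contDiff
  exact (hs.wirtinger_iterate.continuous).bounded_above_of_compact_support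
    (hc.wirtinger_iterate i)

theorem two_re_eq (h : ℂ) : ((2 * h.re : ℝ) : ℂ) = h + (starRingEnd ℂ) h := by
  rw [add_conj]

theorem wirtinger_sub_two_re {Φ : ℂ → ℝ} {H : ℂ → ℂ} {z : ℂ} (hΦ : DifferentiableAt ℝ Φ z)
    (hH : DifferentiableAt ℂ H z) :
    wirtinger (fun w => ((Φ w - 2 * (H w).re : ℝ) : ℂ)) z =
      wirtinger (fun w => ((Φ w : ℝ) : ℂ)) z - deriv H z := by
  have hHr : DifferentiableAt ℝ H z := hH.restrictScalars ℝ
  have hHc : DifferentiableAt ℝ (fun w => (starRingEnd ℂ) (H w)) z :=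
    (conjCLE : ℂ →L[ℝ] ℂ).differentiableAt.comp z hHr
  have h1 : (fun w => ((Φ w - 2 * (H w).re : ℝ) : ℂ)) =
      fun w => ((Φ w : ℝ) : ℂ) - (H w + (starRingEnd ℂ) (H w)) := by
    funext w; rw [ofReal_sub, two_re_eq]
  have hΦ' : DifferentiableAt ℝ (fun w => ((Φ w : ℝ) : ℂ)) z :=
    ofRealCLM.differentiableAt.comp z hΦ
  rw [h1, wirtinger_sub hΦ' (hHr.fun_add hHc),
    wirtinger_add hHr hHc, wirtinger_conj_comp hHr, dbar_of_differentiableAt hH,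
    wirtinger_of_differentiableAt hH]
  simp

/-- On the unit disc about `a`, both `∂Φ` and the Cauchy transform `P` of the localized Laplacian
solve `∂̄u = ΔΦ`, so `∂Φ - P` has a holomorphic primitive `H` there, and `∂(Φ - 2 Re H) = P`. Since
`∂` commutes with the Cauchy transform, bounds on `∂^j ΔΦ` give bounds on `∂^j P` that do not depend
on `a`. -/
theorem exists_gauge_of_wirtinger_lap_bounded {Φ : ℂ → ℝ} {k : ℕ} (hk : 1 ≤ k)
    (hΦ : ContDiff ℝ (k + 2 : ℕ) Φ) {B : ℝ}
    (hB : ∀ j ≤ k, ∀ z, ‖wirtinger^[j] (fun w => ((lap Φ w : ℝ) : ℂ)) z‖ ≤ B) :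
    ∃ C : ℝ, ∀ a : ℂ, ∃ H : ℂ → ℂ, DifferentiableOn ℂ H (Metric.ball a 1) ∧
      (∀ z ∈ Metric.ball a 1, |Φ z - 2 * (H z).re| ≤ C) ∧
      ∀ j, 1 ≤ j → j ≤ k + 1 →
        ‖wirtinger^[j] (fun w => ((Φ w - 2 * (H w).re : ℝ) : ℂ)) a‖ ≤ C := by
  have hΦ2 : ContDiff ℝ 2 Φ := hΦ.of_le (by norm_cast; omega)
  have hΦd : Differentiable ℝ Φ := hΦ2.differentiable (by norm_num)
  have hΦc : ContDiff ℝ (k + 2 : ℕ) fun w => ((Φ w : ℝ) : ℂ) := ofRealCLM.contDiff.comp hΦ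
  have hv : ContDiff ℝ (k + 1 : ℕ) (wirtinger fun w => ((Φ w : ℝ) : ℂ)) :=
    contDiff_iff_contDiffAt.2 fun z => (hΦc.contDiffAt (x := z)).wirtinger
  have hlap : (fun w => ((lap Φ w : ℝ) : ℂ)) = dbar (wirtinger fun w => ((Φ w : ℝ) : ℂ)) :=
    funext fun w => (dbar_wirtinger_eq_lap hΦ2 w).symm
  have hL : ContDiff ℝ k fun w => ((lap Φ w : ℝ) : ℂ) := by
    rw [hlap]; exact contDiff_iff_contDiffAt.2 fun z => (hv.contDiffAt (x := z)).dbar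
  obtain ⟨A, hA⟩ := exists_bound_wirtinger_cutoff (k + 1)
  have hD : ∀ j : ℕ, ∃ D : ℝ, ∀ (f g : ℂ → ℂ) (z : ℂ), ContDiffAt ℝ j f z → ContDiffAt ℝ j g z →
      (∀ i ≤ j, ‖wirtinger^[i] f z‖ ≤ A) → (∀ i ≤ j, ‖wirtinger^[i] g z‖ ≤ B) →
      ‖wirtinger^[j] (fun w => f w * g w) z‖ ≤ D := fun j =>
    exists_bound_wirtinger_iterate_mul j A B
  choose D hD using hD
  obtain ⟨C₀, hC₀, hC⟩ := exists_bound_cauchyTransform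
  set D' := ∑ j ∈ Finset.range (k + 1), |D j| with hD'
  have hD'le : ∀ j ≤ k, D j ≤ D' := fun j hj => (le_abs_self _).trans
    (Finset.single_le_sum (f := fun j => |D j|) (fun _ _ => abs_nonneg _)
      (Finset.mem_range.2 (by omega)))
  have hD'0 : 0 ≤ D' := Finset.sum_nonneg fun _ _ => abs_nonneg _
  -- `C₀ * D'` bounds the derivatives of the Cauchy transform. The factor `2` comes from bounding
  -- the full derivative of a real function by twice its `∂`-derivative, which is then integrated
  -- over a path of length at most `1`.
  refine ⟨2 * (C₀ * D'), fun a => ?_⟩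
  let g : ℂ → ℂ := fun w => ((cutoff (w - a) : ℝ) : ℂ) * ((lap Φ w : ℝ) : ℂ)
  have hcut : ContDiff ℝ k fun w => ((cutoff (w - a) : ℝ) : ℂ) :=
    ofRealCLM.contDiff.comp (cutoff.contDiff.comp (contDiff_id.sub contDiff_const))
  have hg : ContDiff ℝ k g := hcut.mul hL
  have hgc : HasCompactSupport g := by
    have h1 : HasCompactSupport fun w => ((cutoff (w - a) : ℝ) : ℂ) :=
      (cutoff.hasCompactSupport.comp_left (g := fun x : ℝ => (x : ℂ)) (by simp)).comp_homeomorph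
        (Homeomorph.subRight a)
    exact h1.mul_right
  have hg1 : ContDiff ℝ 1 g := hg.of_le (by norm_cast)
  have hg0 : ∀ j, ∀ w, 2 ≤ ‖w - a‖ → wirtinger^[j] g w = 0 := fun j w hw => by
    refine wirtinger_iterate_eq_zero_of_eventuallyEq ?_ j
    have : ∀ᶠ w' in 𝓝 w, 3 / 2 < ‖w' - a‖ :=
      (by fun_prop : Continuous fun w' => ‖w' - a‖).continuousAt.eventually_const_lt (by linarith)
    filter_upwards [this] with w' hw'
    have : cutoff (w' - a) = 0 := cutoff.zero_of_le_dist (by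
      rw [dist_zero_right]; exact hw'.le)
    simp [g, this]
  have hgB : ∀ j ≤ k, ∀ w, ‖wirtinger^[j] g w‖ ≤ D' := fun j hj w => by
    have hjk : ((j : ℕ) : WithTop ℕ∞) ≤ ((k : ℕ) : WithTop ℕ∞) := by exact_mod_cast hj
    refine (hD j _ _ w (hcut.of_le hjk).contDiffAt (hL.of_le hjk).contDiffAt (fun i hi => ?_)
      fun i hi => hB i (by omega) w).trans (hD'le j hj)
    rw [wirtinger_iterate_comp_sub (fun w => ((cutoff w : ℝ) : ℂ)) a]
    exact hA i (by omega) _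
  have hP : ContDiff ℝ k (cauchyTransform g) := contDiff_cauchyTransform hg hgc
  have hPd : Differentiable ℝ (cauchyTransform g) := hP.differentiable (by norm_cast; omega)
  have hPB : ∀ j ≤ k, ∀ z ∈ Metric.ball a 1, ‖wirtinger^[j] (cauchyTransform g) z‖ ≤ C₀ * D' :=
    fun j hj z hz => by
    have hjk : ((j : ℕ) : WithTop ℕ∞) ≤ ((k : ℕ) : WithTop ℕ∞) := by exact_mod_cast hj
    rw [wirtinger_iterate_cauchyTransform (hg.of_le hjk) hgc]
    have hcont : ContDiff ℝ (0 + j : ℕ) g := by rw [zero_add]; exact hg.of_le hjk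
    exact hC a _ _ hcont.wirtinger_iterate.continuous (hgc.wirtinger_iterate j) (hg0 j)
      (hgB j hj) z hz
  have hvd : Differentiable ℝ (wirtinger fun w => ((Φ w : ℝ) : ℂ)) :=
    hv.differentiable (by norm_cast)
  have hQ : DifferentiableOn ℂ
      (fun z => wirtinger (fun w => ((Φ w : ℝ) : ℂ)) z - cauchyTransform g z)
      (Metric.ball a 1) := fun z hz => by
    refine (differentiableAt_of_dbar_eq_zero ((hvd z).fun_sub (hPd z)) ?_).differentiableWithinAt
    rw [dbar_sub (hvd z) (hPd z), dbar_cauchyTransform hg1 hgc, dbar_wirtinger_eq_lap hΦ2]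
    have : cutoff (z - a) = 1 := cutoff.one_of_mem_closedBall (by
      rw [mem_closedBall_zero_iff]
      rw [Metric.mem_ball, dist_eq] at hz
      exact hz.le)
    simp [g, this]
  -- The primitive is normalized so that `Φ - 2 Re H` vanishes at `a`; the bound on its gradient
  -- then bounds its size.
  obtain ⟨H, hHa, hH⟩ := hQ.isExactOn_ball.with_val_at a ((Φ a / 2 : ℝ) : ℂ)
  have hψ1 : ∀ z ∈ Metric.ball a 1, wirtinger (fun w => ((Φ w - 2 * (H w).re : ℝ) : ℂ)) z =
      cauchyTransform g z := fun z hz => by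
    rw [wirtinger_sub_two_re (hΦd z) (hH z hz).differentiableAt, (hH z hz).deriv]
    ring
  have haball : a ∈ Metric.ball a 1 := Metric.mem_ball_self one_pos
  have hCD : 0 ≤ C₀ * D' := by positivity
  refine ⟨H, fun z hz => (hH z hz).differentiableAt.differentiableWithinAt, fun z hz => ?_,
    fun j hj1 hj => ?_⟩
  · have hψd : ∀ z ∈ Metric.ball a 1, DifferentiableAt ℝ (fun w => Φ w - 2 * (H w).re) z :=
      fun z hz => (hΦd z).sub ((reCLM.differentiableAt.comp z
        ((hH z hz).differentiableAt.restrictScalars ℝ)).const_mul 2)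
    have := (convex_ball a 1).norm_image_sub_le_of_norm_fderiv_le (𝕜 := ℝ) hψd
      (C := 2 * (C₀ * D')) (fun z hz => (norm_fderiv_le_wirtinger (hψd z hz)).trans (by
        rw [hψ1 z hz]
        exact mul_le_mul_of_nonneg_left (hPB 0 (by omega) z hz) (by norm_num))) haball hz
    simp only [hHa, ofReal_re] at this
    rw [show Φ z - 2 * (H z).re - (Φ a - 2 * (Φ a / 2)) = Φ z - 2 * (H z).re by ring,
      Real.norm_eq_abs] at this
    refine this.trans (mul_le_of_le_one_right (by positivity) ?_)
    rw [Metric.mem_ball, dist_eq] at hz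
    exact hz.le
  · obtain ⟨i, rfl⟩ : ∃ i, j = i + 1 := ⟨j - 1, by omega⟩
    have hev : wirtinger (fun w => ((Φ w - 2 * (H w).re : ℝ) : ℂ)) =ᶠ[𝓝 a] cauchyTransform g :=
      (Metric.isOpen_ball.eventually_mem haball).mono hψ1
    rw [Function.iterate_succ_apply, (wirtinger_iterate_congr_nhds hev i).eq_of_nhds]
    have := hPB i (by omega) a haball
    linarith

/-! ### Classical and distributional Laplacians. -/

theorem lap_eq_fderiv_fderiv {φ : ℂ → ℝ} (hφ : ContDiff ℝ 2 φ) (z : ℂ) :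
    lap φ z = (1 / 4) * (fderiv ℝ (fun w => fderiv ℝ φ w 1) z 1 +
      fderiv ℝ (fun w => fderiv ℝ φ w I) z I) := by
  have hd2 : DifferentiableAt ℝ (fderiv ℝ φ) z :=
    (hφ.fderiv_right (m := 1) (by norm_num)).differentiable (by norm_num) z
  rw [lap, InnerProductSpace.laplacian_eq_iteratedFDeriv_complexPlane]
  simp only [iteratedFDeriv_two_apply]
  rw [fderiv_clm_apply hd2 (differentiableAt_const _), fderiv_clm_apply hd2
    (differentiableAt_const _)]
  simp

theorem contDiff_fderiv_apply {φ : ℂ → ℝ} {k : ℕ} (hφ : ContDiff ℝ (k + 1 : ℕ) φ) (v : ℂ) :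
    ContDiff ℝ k fun w => fderiv ℝ φ w v :=
  (hφ.fderiv_right (m := k) (by norm_cast)).clm_apply contDiff_const

theorem continuous_lap {φ : ℂ → ℝ} (hφ : ContDiff ℝ 2 φ) : Continuous (lap φ) := by
  have h : ∀ v, Continuous fun z => fderiv ℝ (fun w => fderiv ℝ φ w v) z v := fun v =>
    (contDiff_fderiv_apply (k := 0) (contDiff_fderiv_apply (k := 1) hφ v) v).continuous
  rw [show lap φ = _ from funext (lap_eq_fderiv_fderiv hφ)]
  exact continuous_const.mul ((h 1).add (h I))

theorem integral_mul_fderiv_fderiv {φ ψ : ℂ → ℝ} (hφ : ContDiff ℝ 2 φ) (hψ : ContDiff ℝ 2 ψ)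
    (hc : HasCompactSupport ψ) (v : ℂ) :
    Integrable (fun z => φ z * fderiv ℝ (fun w => fderiv ℝ ψ w v) z v) ∧
    Integrable (fun z => fderiv ℝ (fun w => fderiv ℝ φ w v) z v * ψ z) ∧
    ∫ z, φ z * fderiv ℝ (fun w => fderiv ℝ ψ w v) z v =
      ∫ z, fderiv ℝ (fun w => fderiv ℝ φ w v) z v * ψ z := by
  have hφ1 := contDiff_fderiv_apply (k := 1) hφ v
  have hψ1 := contDiff_fderiv_apply (k := 1) hψ v
  have hφ2 := contDiff_fderiv_apply (k := 0) hφ1 v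
  have hψ2 := contDiff_fderiv_apply (k := 0) hψ1 v
  have hc1 : HasCompactSupport fun w => fderiv ℝ ψ w v := hc.fderiv_apply (𝕜 := ℝ) v
  have hc2 : HasCompactSupport fun z => fderiv ℝ (fun w => fderiv ℝ ψ w v) z v :=
    hc1.fderiv_apply (𝕜 := ℝ) v
  have i1 : Integrable fun z => fderiv ℝ φ z v * fderiv ℝ ψ z v :=
    (hφ1.continuous.mul hψ1.continuous).integrable_of_hasCompactSupport hc1.mul_left
  have i2 : Integrable fun z => φ z * fderiv ℝ (fun w => fderiv ℝ ψ w v) z v :=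
    (hφ.continuous.mul hψ2.continuous).integrable_of_hasCompactSupport hc2.mul_left
  have i3 : Integrable fun z => φ z * fderiv ℝ ψ z v :=
    (hφ.continuous.mul hψ1.continuous).integrable_of_hasCompactSupport hc1.mul_left
  have i4 : Integrable fun z => fderiv ℝ (fun w => fderiv ℝ φ w v) z v * ψ z :=
    (hφ2.continuous.mul hψ.continuous).integrable_of_hasCompactSupport hc.mul_left
  have i5 : Integrable fun z => fderiv ℝ φ z v * ψ z :=
    (hφ1.continuous.mul hψ.continuous).integrable_of_hasCompactSupport hc.mul_left
  have d0 : Differentiable ℝ φ := hφ.differentiable (by norm_num)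
  have d1 : Differentiable ℝ ψ := hψ.differentiable (by norm_num)
  have d2 : Differentiable ℝ fun w => fderiv ℝ φ w v := hφ1.differentiable (by norm_num)
  have d3 : Differentiable ℝ fun w => fderiv ℝ ψ w v := hψ1.differentiable (by norm_num)
  refine ⟨i2, i4, ?_⟩
  rw [integral_mul_fderiv_eq_neg_fderiv_mul_of_integrable i1 i2 i3 (fun x _ => d0 x)
    (fun x _ => d3 x),
    integral_mul_fderiv_eq_neg_fderiv_mul_of_integrable i4 i1 i5 (fun x _ => d2 x)
      (fun x _ => d1 x), neg_neg]

theorem integral_mul_lap {φ ψ : ℂ → ℝ} (hφ : ContDiff ℝ 2 φ) (hψ : ContDiff ℝ 2 ψ)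
    (hc : HasCompactSupport ψ) : ∫ z, φ z * lap ψ z = ∫ z, lap φ z * ψ z := by
  obtain ⟨a1, b1, e1⟩ := integral_mul_fderiv_fderiv hφ hψ hc 1
  obtain ⟨a2, b2, e2⟩ := integral_mul_fderiv_fderiv hφ hψ hc I
  have h1 : ∀ z, φ z * lap ψ z = (1 / 4) * (φ z * fderiv ℝ (fun w => fderiv ℝ ψ w 1) z 1 +
      φ z * fderiv ℝ (fun w => fderiv ℝ ψ w I) z I) := fun z => by
    rw [lap_eq_fderiv_fderiv hψ]; ring
  have h2 : ∀ z, lap φ z * ψ z = (1 / 4) * (fderiv ℝ (fun w => fderiv ℝ φ w 1) z 1 * ψ z +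
      fderiv ℝ (fun w => fderiv ℝ φ w I) z I * ψ z) := fun z => by
    rw [lap_eq_fderiv_fderiv hφ]; ring
  simp only [h1, h2]
  rw [integral_const_mul, integral_const_mul, integral_add a1 a2, integral_add b1 b2, e1, e2]

/-- Integration by parts against test functions identifies the classical Laplacian with `L` almost
everywhere. The bound then holds on a set that is closed, by continuity, and dense, having full
measure. -/
theorem abs_lap_le_of_hasLaplacian {φ L : ℂ → ℝ} (hφ : ContDiff ℝ 2 φ) (hL : HasLaplacian φ L)
    {M : ℝ} (hM : ∀ᵐ z, |L z| ≤ M) (z : ℂ) : |lap φ z| ≤ M := by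
  obtain ⟨-, hLi, hLap⟩ := hL
  have hlc := continuous_lap hφ
  have hae : ∀ᵐ z, (fun z => lap φ z - L z) z = 0 := by
    refine ae_eq_zero_of_integral_contDiff_smul_eq_zero (hlc.locallyIntegrable.sub hLi)
      fun g hg hgc => ?_
    have h1 := integral_mul_lap hφ (hg.of_le (by norm_cast)) hgc
    rw [hLap g hg hgc] at h1
    have i1 : Integrable fun z => g z * lap φ z :=
      (hg.continuous.mul hlc).integrable_of_hasCompactSupport hgc.mul_right
    have i2 : Integrable fun z => g z * L z :=
      hLi.integrable_smul_left_of_hasCompactSupport hg.continuous hgc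
    simp only [smul_eq_mul, mul_sub]
    rw [integral_sub i1 i2, sub_eq_zero]
    simp only [mul_comm (g _)]
    exact h1.symm
  have hae2 : ∀ᵐ z, |lap φ z| ≤ M := by
    filter_upwards [hae, hM] with z h1 h2
    rw [sub_eq_zero.1 h1]
    exact h2
  have hcl : IsClosed {z | |lap φ z| ≤ M} := isClosed_le hlc.abs continuous_const
  have h := (Measure.dense_of_ae hae2).closure_eq
  rw [hcl.closure_eq] at h
  exact (Set.ext_iff.1 h z).2 (mem_univ z)

/-! ### Radial kernels and compactly supported potentials. -/

/-- A smooth nondecreasing step, equal to `0` on `(-∞, 1/2]` and to `1` on `[1, ∞)`. -/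
noncomputable def step (t : ℝ) : ℝ := Real.smoothTransition (2 * t - 1)

theorem contDiff_step : ContDiff ℝ ∞ step :=
  Real.smoothTransition.contDiff.comp (by fun_prop)

theorem monotone_step : Monotone step := fun _ _ h =>
  Real.smoothTransition.monotone (by linarith)

theorem step_eq_zero {t : ℝ} (h : t ≤ 1 / 2) : step t = 0 :=
  Real.smoothTransition.zero_of_nonpos (by linarith)

theorem step_eq_one {t : ℝ} (h : 1 ≤ t) : step t = 1 :=
  Real.smoothTransition.one_of_one_le (by linarith)

theorem contDiff_step_div : ContDiff ℝ ∞ fun t => step t / t := by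
  refine contDiff_iff_contDiffAt.2 fun t => ?_
  by_cases ht : t = 0
  · have : (fun t => step t / t) =ᶠ[𝓝 t] fun _ => 0 := by
      have : ∀ᶠ s in 𝓝 t, s < 1 / 2 := eventually_lt_nhds (by rw [ht]; norm_num)
      filter_upwards [this] with s hs
      rw [step_eq_zero hs.le, zero_div]
    exact contDiffAt_const.congr_of_eventuallyEq this
  · exact contDiff_step.contDiffAt.div contDiffAt_id ht

/-- A smooth function which agrees with the logarithm on `[1, ∞)`. -/
noncomputable def smoothLog (t : ℝ) : ℝ := ∫ s in (1 : ℝ)..t, step s / s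

theorem hasDerivAt_smoothLog (t : ℝ) : HasDerivAt smoothLog (step t / t) t :=
  intervalIntegral.integral_hasDerivAt_right
    (contDiff_step_div.continuous.intervalIntegrable _ _)
    (contDiff_step_div.continuous.stronglyMeasurableAtFilter _ _)
    contDiff_step_div.continuous.continuousAt

theorem contDiff_smoothLog : ContDiff ℝ ∞ smoothLog := by
  refine contDiff_infty_iff_deriv.2 ⟨fun t => (hasDerivAt_smoothLog t).differentiableAt, ?_⟩
  rw [show deriv smoothLog = _ from funext fun t => (hasDerivAt_smoothLog t).deriv]
  exact contDiff_step_div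

theorem smoothLog_eq_log {t : ℝ} (ht : 1 ≤ t) : smoothLog t = Real.log t := by
  rw [smoothLog, intervalIntegral.integral_congr (g := fun s => s⁻¹),
    integral_inv_of_pos one_pos (by linarith), div_one]
  intro s hs
  rw [uIcc_of_le ht] at hs
  simp [step_eq_one hs.1]

theorem hasFDerivAt_comp_norm_sq {η : ℝ → ℝ} {η' : ℝ} {s : ℝ} {w : ℂ}
    (h : HasDerivAt η η' (s * ‖w‖ ^ 2)) :
    HasFDerivAt (fun w : ℂ => η (s * ‖w‖ ^ 2)) ((η' * s) • ((2 : ℝ) • innerSL ℝ w)) w := by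
  have h1 : HasFDerivAt (fun w : ℂ => s * ‖w‖ ^ 2) (s • ((2 : ℝ) • innerSL ℝ w)) w := by
    have := (hasStrictFDerivAt_norm_sq w).hasFDerivAt.const_mul s
    refine this.congr_fderiv ?_
    ext v
    simp [two_smul]
  refine (h.comp_hasFDerivAt w h1).congr_fderiv ?_
  rw [smul_smul]

theorem lap_comp_norm_sq {η : ℝ → ℝ} (hη : ContDiff ℝ 2 η) (s : ℝ) (w : ℂ) :
    lap (fun w => η (s * ‖w‖ ^ 2)) w =
      s * (deriv η (s * ‖w‖ ^ 2) + s * ‖w‖ ^ 2 * deriv (deriv η) (s * ‖w‖ ^ 2)) := by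
  have hηd : Differentiable ℝ η := hη.differentiable (by norm_num)
  have hη' : ContDiff ℝ 1 (deriv η) :=
    ((contDiff_succ_iff_deriv (n := 1)).1 (by exact_mod_cast hη)).2.2
  have hηd' : Differentiable ℝ (deriv η) := hη'.differentiable (by norm_num)
  have hN : ContDiff ℝ 2 fun w : ℂ => s * ‖w‖ ^ 2 := contDiff_const.mul (contDiff_norm_sq ℝ)
  have h1 : ∀ v : ℂ, (fun w => fderiv ℝ (fun w : ℂ => η (s * ‖w‖ ^ 2)) w v) =
      fun w => 2 * s * (deriv η (s * ‖w‖ ^ 2) * (innerSL ℝ v) w) := fun v => by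
    funext w
    rw [(hasFDerivAt_comp_norm_sq (hηd _).hasDerivAt).fderiv]
    simp only [smul_apply, innerSL_apply_apply, smul_eq_mul]
    rw [real_inner_comm]
    ring
  have h2 : ∀ v : ℂ, fderiv ℝ (fun w => 2 * s * (deriv η (s * ‖w‖ ^ 2) * (innerSL ℝ v) w)) w v =
      2 * s * (deriv η (s * ‖w‖ ^ 2) * ‖v‖ ^ 2 +
        (innerSL ℝ v) w * (deriv (deriv η) (s * ‖w‖ ^ 2) * s * 2 * (innerSL ℝ v) w)) := fun v => by
    have := ((hasFDerivAt_comp_norm_sq (hηd' (s * ‖w‖ ^ 2)).hasDerivAt).mul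
      (innerSL ℝ v).hasFDerivAt).const_mul (2 * s)
    rw [HasFDerivAt.fderiv (f := fun w => 2 * s * (deriv η (s * ‖w‖ ^ 2) * (innerSL ℝ v) w)) this]
    simp only [smul_apply, add_apply, innerSL_apply_apply, smul_eq_mul, real_inner_self_eq_norm_sq]
    rw [real_inner_comm v w]
    ring
  rw [lap_eq_fderiv_fderiv (φ := fun w => η (s * ‖w‖ ^ 2)) (hη.comp hN), h1, h1, h2, h2]
  have h3 : ‖w‖ ^ 2 = ((innerSL ℝ (1 : ℂ)) w) ^ 2 + ((innerSL ℝ I) w) ^ 2 := by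
    simp [Complex.inner, Complex.sq_norm, Complex.normSq_apply]
    ring
  rw [norm_I, norm_one]
  linear_combination (-(s ^ 2 * deriv (deriv η) (s * ‖w‖ ^ 2))) * h3

/-- The radial kernel `s S'(s |w|²)`, a smooth approximation of `π` times the unit mass at `0`. -/
noncomputable def radialKernel (s : ℝ) (w : ℂ) : ℝ := s * deriv step (s * ‖w‖ ^ 2)

/-- With `t = s|w|²` the normalized Laplacian of `η(t)` is `s (t η')'`, and `t η'` is `step t` for
`η = smoothLog`. -/
theorem lap_smoothLog (s : ℝ) (w : ℂ) :
    lap (fun w => smoothLog (s * ‖w‖ ^ 2)) w = radialKernel s w := by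
  rw [lap_comp_norm_sq (contDiff_smoothLog.of_le (by norm_cast)), radialKernel]
  have h1 : deriv smoothLog = fun t => step t / t := funext fun t => (hasDerivAt_smoothLog t).deriv
  have h2 : step = fun t => t * (step t / t) := by
    funext t
    rcases eq_or_ne t 0 with rfl | ht
    · simp [step_eq_zero]
    · field_simp
  have hd := contDiff_step_div.differentiable (by norm_num) (s * ‖w‖ ^ 2)
  congr 1
  rw [h1]
  conv_rhs => rw [h2]
  rw [deriv_fun_mul differentiableAt_fun_id hd]
  simp

theorem contDiff_radialKernel (s : ℝ) : ContDiff ℝ ∞ (radialKernel s) := by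
  have h : ContDiff ℝ ∞ (deriv step) := (contDiff_infty_iff_deriv.1 contDiff_step).2
  exact contDiff_const.mul (h.comp (contDiff_const.mul (contDiff_norm_sq ℝ)))

theorem radialKernel_nonneg {s : ℝ} (hs : 0 ≤ s) (w : ℂ) : 0 ≤ radialKernel s w :=
  mul_nonneg hs monotone_step.deriv_nonneg

theorem deriv_step_eq_zero {t : ℝ} (ht : 1 ≤ t) : deriv step t = 0 := by
  have h : ∀ s ∈ Ioi (1 : ℝ), deriv step s = 0 := fun s hs => by
    have : step =ᶠ[𝓝 s] fun _ => 1 := by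
      filter_upwards [Ioi_mem_nhds hs] with u hu using step_eq_one (le_of_lt hu)
    rw [this.deriv_eq]; simp
  have hc : Continuous (deriv step) := (contDiff_infty_iff_deriv.1 contDiff_step).2.continuous
  have h2 : closure (Ioi (1 : ℝ)) ⊆ {s | deriv step s = 0} :=
    closure_minimal h (isClosed_eq hc continuous_const)
  rw [closure_Ioi] at h2
  exact h2 ht

theorem radialKernel_eq_zero {s : ℝ} {w : ℂ} (h : 1 ≤ s * ‖w‖ ^ 2) : radialKernel s w = 0 := by
  rw [radialKernel, deriv_step_eq_zero h, mul_zero]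

theorem hasCompactSupport_radialKernel {s : ℝ} (hs : 0 < s) :
    HasCompactSupport (radialKernel s) := by
  refine HasCompactSupport.intro (isCompact_closedBall (0 : ℂ) (1 + s⁻¹)) fun w hw => ?_
  refine radialKernel_eq_zero ?_
  rw [mem_closedBall_zero_iff, not_le] at hw
  have h0 : 0 < s⁻¹ := by positivity
  have h2 : s⁻¹ ≤ ‖w‖ ^ 2 := by nlinarith
  calc (1 : ℝ) = s * s⁻¹ := (mul_inv_cancel₀ hs.ne').symm
    _ ≤ _ := by gcongr

/-- The integrand is the derivative of `π * step (s ρ²)`, which climbs from `0` to `π`. -/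
theorem integral_Ioi_radial_step {s : ℝ} (hs : 0 < s) :
    IntegrableOn (fun ρ => 2 * Real.pi * ρ * (s * deriv step (s * ρ ^ 2))) (Ioi 0) ∧
    ∫ ρ in Ioi (0 : ℝ), 2 * Real.pi * ρ * (s * deriv step (s * ρ ^ 2)) = Real.pi := by
  have hd : ∀ ρ : ℝ, HasDerivAt (fun ρ => Real.pi * step (s * ρ ^ 2))
      (2 * Real.pi * ρ * (s * deriv step (s * ρ ^ 2))) ρ := fun ρ => by
    have h1 : HasDerivAt (fun ρ : ℝ => s * ρ ^ 2) (s * (2 * ρ)) ρ := by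
      simpa using (hasDerivAt_pow 2 ρ).const_mul s
    have h2 := ((contDiff_step.differentiable (by norm_num) (s * ρ ^ 2)).hasDerivAt.comp ρ
      h1).const_mul Real.pi
    refine h2.congr_deriv ?_
    ring
  have hlim : Tendsto (fun ρ : ℝ => Real.pi * step (s * ρ ^ 2)) atTop (𝓝 Real.pi) := by
    have : Tendsto (fun ρ : ℝ => s * ρ ^ 2) atTop atTop :=
      (tendsto_pow_atTop two_ne_zero).const_mul_atTop hs
    refine tendsto_const_nhds.congr' ?_
    filter_upwards [this.eventually_ge_atTop 1] with ρ hρ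
    rw [step_eq_one hρ, mul_one]
  have hnn : ∀ ρ ∈ Ioi (0 : ℝ), 0 ≤ 2 * Real.pi * ρ * (s * deriv step (s * ρ ^ 2)) :=
    fun ρ hρ => by
    have := monotone_step.deriv_nonneg (x := s * ρ ^ 2)
    have hρ' : 0 < ρ := hρ
    positivity
  refine ⟨integrableOn_Ioi_deriv_of_nonneg' (fun ρ _ => hd ρ) hnn hlim, ?_⟩
  rw [integral_Ioi_of_hasDerivAt_of_nonneg' (fun ρ _ => hd ρ) hnn hlim]
  simp [step_eq_zero]

theorem integral_radialKernel {s : ℝ} (hs : 0 < s) : ∫ w, radialKernel s w = Real.pi := by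
  have hi : Integrable (radialKernel s) :=
    (contDiff_radialKernel s).continuous.integrable_of_hasCompactSupport
      (hasCompactSupport_radialKernel hs)
  have h := integral_radial_mul_real (k := fun ρ => s * deriv step (s * ρ ^ 2))
    (F := fun _ => (1 : ℝ)) (z := 0) (by simpa [radialKernel] using! hi)
  simp only [mul_one, Real.circleAverage_const] at h
  rw [(integral_Ioi_radial_step hs).2] at h
  exact h

/-- A compactly supported function with Laplacian `χ_s - χ_{4s}`, where `χ_s` is the radial
kernel. -/
noncomputable def potential (s : ℝ) (w : ℂ) : ℝ :=
  smoothLog (s * ‖w‖ ^ 2) - smoothLog (4 * s * ‖w‖ ^ 2) + Real.log 4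

theorem contDiff_potential (s : ℝ) : ContDiff ℝ ∞ (potential s) := by
  have h : ∀ s : ℝ, ContDiff ℝ ∞ fun w : ℂ => smoothLog (s * ‖w‖ ^ 2) := fun s =>
    contDiff_smoothLog.comp (contDiff_const.mul (contDiff_norm_sq ℝ))
  exact ((h s).sub (h (4 * s))).add contDiff_const

/-- Where both arguments are at least `1`, `smoothLog` is the logarithm and the two terms differ by
`log 4`, which the additive constant in `potential` cancels. -/
theorem potential_eq_zero {s : ℝ} {w : ℂ} (h : 1 ≤ s * ‖w‖ ^ 2) : potential s w = 0 := by
  rw [potential, smoothLog_eq_log h, mul_assoc, smoothLog_eq_log (by linarith),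
    Real.log_mul (x := 4) (by norm_num) (by linarith)]
  ring

theorem hasCompactSupport_potential {s : ℝ} (hs : 0 < s) :
    HasCompactSupport (potential s) := by
  refine HasCompactSupport.intro (isCompact_closedBall (0 : ℂ) (1 + s⁻¹)) fun w hw => ?_
  refine potential_eq_zero ?_
  rw [mem_closedBall_zero_iff, not_le] at hw
  have h0 : 0 < s⁻¹ := by positivity
  have h2 : s⁻¹ ≤ ‖w‖ ^ 2 := by nlinarith
  calc (1 : ℝ) = s * s⁻¹ := (mul_inv_cancel₀ hs.ne').symm
    _ ≤ _ := by gcongr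

theorem lap_potential (s : ℝ) (w : ℂ) :
    lap (potential s) w = radialKernel s w - radialKernel (4 * s) w := by
  have h : ∀ s : ℝ, ContDiff ℝ 2 fun w : ℂ => smoothLog (s * ‖w‖ ^ 2) := fun s =>
    (contDiff_smoothLog.of_le (by norm_cast)).comp (contDiff_const.mul (contDiff_norm_sq ℝ))
  rw [← lap_smoothLog, ← lap_smoothLog]
  have h1 := (h s).contDiffAt (x := w) |>.laplacian_sub (h (4 * s)).contDiffAt
  have h2 := ((h s).sub (h (4 * s))).contDiffAt (x := w) |>.laplacian_add
    (contDiff_const (c := Real.log 4)).contDiffAt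
  have h4 : Laplacian.laplacian (fun _ : ℂ => Real.log 4) w = 0 :=
    congrFun InnerProductSpace.laplacian_const w
  have h5 : lap (potential s) w = 1 / 4 * _ := congrArg (fun x : ℝ => 1 / 4 * x) h2
  have h6 : Laplacian.laplacian
      (fun w : ℂ => smoothLog (s * ‖w‖ ^ 2) - smoothLog (4 * s * ‖w‖ ^ 2)) w = _ := h1
  rw [h5, h4, h6]
  simp only [lap]
  ring

theorem potential_scale (s : ℝ) (c : ℝ) (w : ℂ) :
    potential (c ^ 2 * s) w = potential s (c • w) := by
  simp only [potential, norm_smul, mul_pow, Real.norm_eq_abs, sq_abs]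
  ring_nf

/-! ### Convolution and smooth approximation of a weight with bounded Laplacian. -/

/-- Convolution of real functions on the plane. -/
noncomputable def conv (φ g : ℂ → ℝ) : ℂ → ℝ :=
  convolution φ g (ContinuousLinearMap.mul ℝ ℝ) volume

theorem conv_apply (φ g : ℂ → ℝ) (z : ℂ) : conv φ g z = ∫ w, φ w * g (z - w) := rfl

theorem integrable_conv {φ g : ℂ → ℝ} (hφ : LocallyIntegrable φ) (hg : Continuous g)
    (hc : HasCompactSupport g) (z : ℂ) : Integrable fun w => φ w * g (z - w) :=
  hc.convolutionExists_right (ContinuousLinearMap.mul ℝ ℝ) hφ hg z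

theorem contDiff_conv {φ g : ℂ → ℝ} (hφ : LocallyIntegrable φ) (hg : ContDiff ℝ ∞ g)
    (hc : HasCompactSupport g) : ContDiff ℝ ∞ (conv φ g) :=
  hc.contDiff_convolution_right (n := ⊤) _ hφ hg

theorem fderiv_conv {φ g : ℂ → ℝ} (hφ : LocallyIntegrable φ) (hg : ContDiff ℝ 1 g)
    (hc : HasCompactSupport g) (z v : ℂ) :
    fderiv ℝ (conv φ g) z v = conv φ (fun w => fderiv ℝ g w v) z := by
  have h := hc.hasFDerivAt_convolution_right (ContinuousLinearMap.mul ℝ ℝ) hφ hg z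
  rw [conv, h.fderiv]
  have hex : ConvolutionExistsAt φ (fderiv ℝ g) z
      ((ContinuousLinearMap.mul ℝ ℝ).precompR ℂ) volume :=
    (hc.fderiv (𝕜 := ℝ)).convolutionExists_right _ hφ (hg.continuous_fderiv one_ne_zero) z
  rw [convolution_def, ContinuousLinearMap.integral_apply hex]
  rfl

/-- The distributional identity is tested on `w ↦ g (z - w)`. -/
theorem conv_lap_eq {φ L : ℂ → ℝ} (hL : HasLaplacian φ L) {g : ℂ → ℝ} (hg : ContDiff ℝ ∞ g)
    (hc : HasCompactSupport g) : conv φ (lap g) = conv L g := by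
  funext z
  have hψ : ContDiff ℝ ∞ fun w => g (z - w) := hg.comp (contDiff_const.sub contDiff_id)
  have hψc : HasCompactSupport fun w => g (z - w) := hc.comp_homeomorph (Homeomorph.subLeft z)
  have hsub : ∀ {f : ℂ → ℝ}, Differentiable ℝ f → ∀ w v : ℂ,
      fderiv ℝ (fun w => f (z - w)) w v = -fderiv ℝ f (z - w) v := fun {f} hf w v => by
    have := (hf (z - w)).hasFDerivAt.comp w ((hasFDerivAt_const z w).sub (hasFDerivAt_id w))
    rw [HasFDerivAt.fderiv (f := fun w => f (z - w)) this]
    simp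
  have hg2 : ContDiff ℝ 2 g := hg.of_le (by norm_cast)
  have hlap : ∀ w, lap (fun w => g (z - w)) w = lap g (z - w) := fun w => by
    have hd : ∀ v, Differentiable ℝ fun w => fderiv ℝ g w v := fun v =>
      (contDiff_fderiv_apply (k := 1) hg2 v).differentiable (by norm_num)
    have h2 : ∀ v : ℂ, fderiv ℝ (fun w => fderiv ℝ (fun w => g (z - w)) w v) w v =
        fderiv ℝ (fun w => fderiv ℝ g w v) (z - w) v := fun v => by
      simp only [hsub (hg2.differentiable (by norm_num))]
      rw [fderiv_fun_neg, neg_apply, hsub (hd v), neg_neg]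
    rw [lap_eq_fderiv_fderiv (hψ.of_le (by norm_cast)), lap_eq_fderiv_fderiv hg2, h2, h2]
  have := hL.2.2 _ hψ hψc
  simp only [hlap] at this
  exact this

theorem lap_conv {φ L : ℂ → ℝ} (hL : HasLaplacian φ L) {g : ℂ → ℝ} (hg : ContDiff ℝ ∞ g)
    (hc : HasCompactSupport g) : lap (conv φ g) = conv L g := by
  rw [← conv_lap_eq hL hg hc]
  funext z
  have hg2 : ContDiff ℝ 2 g := hg.of_le (by norm_cast)
  have hg1 : ∀ v, ContDiff ℝ 1 fun w => fderiv ℝ g w v := fun v =>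
    contDiff_fderiv_apply (k := 1) hg2 v
  have h : ∀ v : ℂ, fderiv ℝ (fun w => fderiv ℝ (conv φ g) w v) z v =
      conv φ (fun w => fderiv ℝ (fun w => fderiv ℝ g w v) w v) z := fun v => by
    simp only [fderiv_conv hL.1 (hg.of_le (by norm_cast)) hc]
    exact fderiv_conv hL.1 (hg1 v) (hc.fderiv_apply (𝕜 := ℝ) v) z v
  have hi : ∀ v : ℂ, Integrable fun w =>
      φ w * fderiv ℝ (fun w => fderiv ℝ g w v) (z - w) v := fun v =>
    integrable_conv hL.1 (contDiff_fderiv_apply (k := 0) (hg1 v) v).continuous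
      ((hc.fderiv_apply (𝕜 := ℝ) v).fderiv_apply (𝕜 := ℝ) v) z
  rw [lap_eq_fderiv_fderiv ((contDiff_conv hL.1 hg hc).of_le (by norm_cast)), h, h]
  simp only [conv_apply, lap_eq_fderiv_fderiv hg2]
  rw [← integral_add (hi 1) (hi I), ← integral_const_mul]
  congr 1
  funext w
  ring

theorem abs_conv_le {L g : ℂ → ℝ} {M : ℝ} (hM : ∀ᵐ z, |L z| ≤ M) (hg : Continuous g)
    (hc : HasCompactSupport g) (z : ℂ) : |conv L g z| ≤ M * ∫ w, |g w| := by
  have hi : Integrable fun w => |g w| := (hg.integrable_of_hasCompactSupport hc).abs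
  have h1 : ∫ w, |g w| = ∫ w, |g (z - w)| := (integral_sub_left_eq_self (fun w => |g w|) _ z).symm
  have hi' : Integrable fun w => |g (z - w)| := hi.comp_sub_left z
  rw [conv_apply, h1, ← integral_const_mul, ← Real.norm_eq_abs]
  refine norm_integral_le_of_norm_le (hi'.const_mul M) ?_
  filter_upwards [hM] with w hw
  rw [Real.norm_eq_abs, abs_mul]
  exact mul_le_mul_of_nonneg_right hw (abs_nonneg _)

theorem norm_fderiv_conv_le {L g : ℂ → ℝ} {M : ℝ} (hL : LocallyIntegrable L) (hM0 : 0 ≤ M)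
    (hM : ∀ᵐ z, |L z| ≤ M) (hg : ContDiff ℝ 1 g) (hc : HasCompactSupport g) (z : ℂ) :
    ‖fderiv ℝ (conv L g) z‖ ≤ M * ∫ w, ‖fderiv ℝ g w‖ := by
  refine ContinuousLinearMap.opNorm_le_bound _ (by positivity) fun v => ?_
  have hcont := hg.continuous_fderiv one_ne_zero
  have hcv : HasCompactSupport fun w => fderiv ℝ g w v := hc.fderiv_apply (𝕜 := ℝ) v
  rw [fderiv_conv hL hg hc, Real.norm_eq_abs]
  refine (abs_conv_le hM (hcont.clm_apply continuous_const) hcv z).trans ?_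
  rw [mul_assoc, ← integral_mul_const]
  refine mul_le_mul_of_nonneg_left (integral_mono
    (((hcont.clm_apply continuous_const).integrable_of_hasCompactSupport hcv).abs)
    ((hcont.integrable_of_hasCompactSupport (hc.fderiv (𝕜 := ℝ))).norm.mul_const _) fun w => ?_) hM0
  exact (fderiv ℝ g w).le_opNorm v

theorem integrableOn_radial_mul_circleAverage {k : ℝ → ℝ} {F : ℂ → ℝ} {z : ℂ}
    (hF : Integrable fun w => k ‖w‖ * F (z + w)) :
    IntegrableOn (fun ρ => (2 * Real.pi * ρ * k ρ) * Real.circleAverage F z ρ) (Ioi 0) := by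
  have h := integrableOn_polarCoord_symm hF
  rw [IntegrableOn, Measure.volume_eq_prod, ← Measure.prod_restrict] at h
  refine (h.integral_prod_left).congr ?_
  filter_upwards [ae_restrict_mem measurableSet_Ioi] with ρ hρ
  simp only [polarCoord_symm_eq_circleMap, norm_circleMap_zero_of_pos hρ, integral_const_mul,
    smul_eq_mul]
  have : ∀ θ, z + circleMap 0 ρ θ = circleMap z ρ θ := fun θ => by simp [circleMap]
  simp only [this, integral_Ioo_circleMap_real]
  ring_nf

theorem conv_radialKernel_apply (φ : ℂ → ℝ) (s : ℝ) (z : ℂ) :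
    conv φ (radialKernel s) z = ∫ w, radialKernel s w * φ (z + w) := by
  rw [conv_apply, ← integral_add_left_eq_self _ z]
  congr 1
  funext w
  simp [radialKernel, mul_comm]

theorem integrable_radialKernel_mul {φ : ℂ → ℝ} (hφ : LocallyIntegrable φ) {s : ℝ} (hs : 0 < s)
    (z : ℂ) : Integrable fun w => radialKernel s w * φ (z + w) := by
  have h := (integrable_conv hφ (contDiff_radialKernel s).continuous
    (hasCompactSupport_radialKernel hs) z).comp_add_left z
  refine h.congr (Eventually.of_forall fun w => ?_)
  simp [radialKernel, mul_comm]

/-- The sub-mean value inequalities are averaged over the radii with a nonnegative weight of total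
mass `π`. -/
theorem le_conv_radialKernel {φ : ℂ → ℝ} (hsub : Subharmonic φ) (hφ : LocallyIntegrable φ) {s : ℝ}
    (hs : 0 < s) (z : ℂ) : Real.pi * φ z ≤ conv φ (radialKernel s) z := by
  have hi : Integrable fun w => (fun ρ => s * deriv step (s * ρ ^ 2)) ‖w‖ * φ (z + w) :=
    integrable_radialKernel_mul hφ hs z
  have h1 := integral_radial_mul_real (k := fun ρ => s * deriv step (s * ρ ^ 2)) (F := φ) hi
  have h2 := integrableOn_radial_mul_circleAverage (k := fun ρ => s * deriv step (s * ρ ^ 2)) (F := φ) hi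
  rw [conv_radialKernel_apply]
  refine le_of_le_of_eq ?_ h1.symm
  obtain ⟨h3, h4⟩ := integral_Ioi_radial_step hs
  have h5 : Real.pi * φ z =
      ∫ ρ in Ioi (0 : ℝ), 2 * Real.pi * ρ * (s * deriv step (s * ρ ^ 2)) * φ z := by
    rw [integral_mul_const, h4]
  rw [h5]
  refine setIntegral_mono_on (h3.mul_const _) h2 measurableSet_Ioi fun ρ hρ => ?_
  have := monotone_step.deriv_nonneg (x := s * ρ ^ 2)
  have hρ' : 0 < ρ := hρ
  exact mul_le_mul_of_nonneg_left (hsub.2 z ρ hρ).2 (by positivity)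

/-- The sub-mean value property bounds the convolutions from below, and upper semicontinuity bounds
them from above as the kernels shrink to a point. The limit exists at every point and not just
almost everywhere, which later gives regularity of `φ` itself. -/
theorem tendsto_conv_radialKernel {φ : ℂ → ℝ} (hsub : Subharmonic φ) (hφ : LocallyIntegrable φ)
    (z : ℂ) : Tendsto (fun s => conv φ (radialKernel s) z) atTop (𝓝 (Real.pi * φ z)) := by
  rw [tendsto_order]
  refine ⟨fun a ha => ?_, fun a ha => ?_⟩
  · filter_upwards [eventually_gt_atTop 0] with s hs
    exact ha.trans_le (le_conv_radialKernel hsub hφ hs z)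
  · obtain ⟨b, hb1, hb2⟩ : ∃ b, φ z < b ∧ Real.pi * b < a := by
      have : φ z < a / Real.pi := by rw [lt_div_iff₀ Real.pi_pos]; linarith
      obtain ⟨b, h1, h2⟩ := exists_between this
      rw [lt_div_iff₀ Real.pi_pos] at h2
      exact ⟨b, h1, by linarith⟩
    obtain ⟨δ, hδ, hball⟩ := Metric.eventually_nhds_iff.1 (hsub.1 z b hb1)
    filter_upwards [eventually_gt_atTop 0, eventually_ge_atTop (1 / δ ^ 2)] with s hs hs2
    refine lt_of_le_of_lt ?_ hb2
    rw [conv_radialKernel_apply, ← integral_radialKernel hs, ← integral_mul_const]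
    refine integral_mono (integrable_radialKernel_mul hφ hs z)
      (((contDiff_radialKernel s).continuous.integrable_of_hasCompactSupport
        (hasCompactSupport_radialKernel hs)).mul_const _) fun w => ?_
    by_cases hw : ‖w‖ < δ
    · exact mul_le_mul_of_nonneg_left (hball (by simpa using hw)).le
        (radialKernel_nonneg hs.le w)
    · have : radialKernel s w = 0 := by
        refine radialKernel_eq_zero ?_
        rw [div_le_iff₀ (by positivity)] at hs2
        refine hs2.trans ?_
        gcongr
        exact not_lt.1 hw
      simp [this]

/-- `potential (4 ^ k)` is `potential 1` dilated by `2 ^ k`, and areas shrink by `4 ^ k`. For the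
gradient in `integral_norm_fderiv_potential` the chain rule costs a factor `2 ^ k`, so `(1/2) ^ k`
remains. -/
theorem integral_abs_potential (k : ℕ) :
    ∫ w, |potential (4 ^ k) w| = (1 / 4) ^ k * ∫ w, |potential 1 w| := by
  have h : ∀ w, potential (4 ^ k) w = potential 1 ((2 : ℝ) ^ k • w) := fun w => by
    rw [← potential_scale]
    congr 1
    rw [mul_one, ← pow_mul, mul_comm, pow_mul]
    norm_num
  simp only [h]
  rw [Measure.integral_comp_smul volume (fun w => |potential 1 w|)]
  simp only [finrank_real_complex, smul_eq_mul]
  congr 1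
  rw [abs_of_pos (by positivity), ← pow_mul, mul_comm, pow_mul, ← inv_pow]
  norm_num

theorem integral_norm_fderiv_potential (k : ℕ) :
    ∫ w, ‖fderiv ℝ (potential (4 ^ k)) w‖ = (1 / 2) ^ k * ∫ w, ‖fderiv ℝ (potential 1) w‖ := by
  have h : potential (4 ^ k) = fun w => potential 1 ((2 : ℝ) ^ k • w) := by
    funext w
    rw [← potential_scale]
    congr 1
    rw [mul_one, ← pow_mul, mul_comm, pow_mul]
    norm_num
  have h2 : ∀ w, ‖fderiv ℝ (potential (4 ^ k)) w‖ =
      2 ^ k * ‖fderiv ℝ (potential 1) ((2 : ℝ) ^ k • w)‖ := fun w => by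
    rw [h, fderiv_comp_smul, norm_smul, Real.norm_of_nonneg (by positivity)]
  simp only [h2]
  rw [integral_const_mul, Measure.integral_comp_smul volume (fun w => ‖fderiv ℝ (potential 1) w‖)]
  simp only [finrank_real_complex, smul_eq_mul]
  rw [← mul_assoc]
  congr 1
  rw [abs_of_pos (by positivity)]
  simp only [one_div, inv_pow]
  field_simp

theorem conv_sub_conv_radialKernel {φ L : ℂ → ℝ} (hL : HasLaplacian φ L) {s : ℝ} (hs : 0 < s)
    (z : ℂ) : conv φ (radialKernel s) z - conv φ (radialKernel (4 * s)) z =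
      conv L (potential s) z := by
  rw [← conv_lap_eq hL (contDiff_potential s) (hasCompactSupport_potential hs)]
  simp only [conv_apply, lap_potential, mul_sub]
  rw [integral_sub]
  · exact integrable_conv hL.1 (contDiff_radialKernel s).continuous
      (hasCompactSupport_radialKernel hs) z
  · exact integrable_conv hL.1 (contDiff_radialKernel _).continuous
      (hasCompactSupport_radialKernel (by positivity)) z

/-- The regularization is `Φ = π⁻¹ φ * χ₁`, where `χ_s` is the radial kernel. Consecutive
regularizations at scales `4 ^ k` differ by `L * potential (4 ^ k)`, of size `O(4⁻ᵏ)` with gradient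
`O(2⁻ᵏ)`. The telescoping series converges in `C¹` with sum `π(Φ - φ)`, so `φ` is `C¹` and `Φ - φ`
is bounded together with its gradient. The Laplacian of `Φ` is `π⁻¹ L * χ₁`, and its gradient is
bounded because the derivative may be put on the kernel. -/
theorem exists_smooth_approximation {φ L : ℂ → ℝ} (hsub : Subharmonic φ) (hL : HasLaplacian φ L)
    {M : ℝ} (hM0 : 0 ≤ M) (hM : ∀ᵐ z, |L z| ≤ M) :
    ∃ Φ : ℂ → ℝ, ContDiff ℝ ∞ Φ ∧ ContDiff ℝ 1 φ ∧ ∃ C : ℝ, (∀ z, |Φ z - φ z| ≤ C) ∧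
      (∀ z, ‖fderiv ℝ (fun w => Φ w - φ w) z‖ ≤ C) ∧ (∀ z, |lap Φ z| ≤ C) ∧
      ∀ z, ‖fderiv ℝ (lap Φ) z‖ ≤ C := by
  set u : ℕ → ℂ → ℝ := fun k => conv L (potential (4 ^ k)) with hu
  have hpos : ∀ k : ℕ, (0 : ℝ) < 4 ^ k := fun k => by positivity
  have hus : ∀ k, ContDiff ℝ ∞ (u k) := fun k =>
    contDiff_conv hL.2.1 (contDiff_potential _) (hasCompactSupport_potential (hpos k))
  set a := M * ∫ w, |potential 1 w|
  set b := M * ∫ w, ‖fderiv ℝ (potential 1) w‖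
  have ha0 : 0 ≤ a := by positivity
  have hb0 : 0 ≤ b := by positivity
  have hua : ∀ k z, ‖u k z‖ ≤ a * (1 / 4) ^ k := fun k z => by
    refine (abs_conv_le hM (contDiff_potential _).continuous
      (hasCompactSupport_potential (hpos k)) z).trans_eq ?_
    rw [integral_abs_potential]; ring
  have hub : ∀ k z, ‖fderiv ℝ (u k) z‖ ≤ b * (1 / 2) ^ k := fun k z => by
    refine (norm_fderiv_conv_le hL.2.1 hM0 hM ((contDiff_potential _).of_le (by norm_cast))
      (hasCompactSupport_potential (hpos k)) z).trans_eq ?_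
    rw [integral_norm_fderiv_potential]; ring
  have hsa : Summable fun k : ℕ => a * (1 / 4 : ℝ) ^ k :=
    (summable_geometric_of_lt_one (by norm_num) (by norm_num)).mul_left _
  have hsb : Summable fun k : ℕ => b * (1 / 2 : ℝ) ^ k :=
    (summable_geometric_of_lt_one (by norm_num) (by norm_num)).mul_left _
  have hsum : ∀ z, Summable fun k => u k z := fun z =>
    Summable.of_norm_bounded hsa fun k => hua k z
  set δ : ℂ → ℝ := fun z => ∑' k, u k z with hδ
  have hδ1 : ContDiff ℝ 1 δ := by
    refine contDiff_tsum (N := (1 : ℕ∞)) (v := fun k i => if k = 0 then a * (1 / 4) ^ i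
      else b * (1 / 2) ^ i) (fun k => (hus k).of_le (by norm_cast)) (fun k _ => ?_)
      fun k i z hk => ?_
    · by_cases h : k = 0
      · simpa [h] using hsa
      · simpa [h] using hsb
    · have hk' : k ≤ 1 := by exact_mod_cast hk
      interval_cases k
      · simpa using hua i z
      · rw [norm_iteratedFDeriv_one]
        simpa using hub i z
  have hδd : ∀ z, ‖fderiv ℝ δ z‖ ≤ ∑' k : ℕ, b * (1 / 2 : ℝ) ^ k := fun z => by
    rw [hδ, fderiv_tsum hsb (fun k => (hus k).differentiable (by norm_num)) hub (hsum 0)]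
    exact tsum_of_norm_bounded hsb.hasSum fun k => hub k z
  have hδb : ∀ z, ‖δ z‖ ≤ ∑' k : ℕ, a * (1 / 4 : ℝ) ^ k := fun z =>
    tsum_of_norm_bounded hsa.hasSum fun k => hua k z
  -- The partial sums telescope, and the last kernel concentrates at `z`, leaving `π φ(z)`.
  have htel : ∀ z, δ z = conv φ (radialKernel 1) z - Real.pi * φ z := fun z => by
    have h1 : ∀ K, ∑ k ∈ Finset.range K, u k z =
        conv φ (radialKernel 1) z - conv φ (radialKernel (4 ^ K)) z := fun K => by
      induction K with
      | zero => simp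
      | succ K ih =>
        rw [Finset.sum_range_succ, ih, hu]
        dsimp only
        rw [← conv_sub_conv_radialKernel hL (hpos K), ← pow_succ']
        ring
    have h2 := (hsum z).hasSum.tendsto_sum_nat
    simp only [h1] at h2
    have h3 : Tendsto (fun K : ℕ => (4 : ℝ) ^ K) atTop atTop :=
      tendsto_pow_atTop_atTop_of_one_lt (by norm_num)
    have h4 := ((tendsto_conv_radialKernel hsub hL.1 z).comp h3).const_sub
      (conv φ (radialKernel 1) z)
    exact tendsto_nhds_unique h2 h4
  have hχ := contDiff_radialKernel 1
  have hχc := hasCompactSupport_radialKernel one_pos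
  have hπ := Real.pi_pos
  have hcs : ContDiff ℝ ∞ (conv φ (radialKernel 1)) := contDiff_conv hL.1 hχ hχc
  have hdiff : (fun w => Real.pi⁻¹ * conv φ (radialKernel 1) w - φ w) =
      fun w => Real.pi⁻¹ * δ w := by
    funext w; rw [htel]; field_simp
  have hφeq : φ = fun w => Real.pi⁻¹ * conv φ (radialKernel 1) w - Real.pi⁻¹ * δ w := by
    funext w; rw [htel]; field_simp; ring
  have hlapΦ : lap (fun w => Real.pi⁻¹ * conv φ (radialKernel 1) w) =
      fun w => Real.pi⁻¹ * conv L (radialKernel 1) w := by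
    funext z
    rw [← lap_conv hL hχ hχc]
    have hc2 : ContDiff ℝ 2 (conv φ (radialKernel 1)) := hcs.of_le (by norm_cast)
    have := InnerProductSpace.laplacian_smul (Real.pi⁻¹) (hc2.contDiffAt (x := z))
    have h' : lap (fun w => Real.pi⁻¹ * conv φ (radialKernel 1) w) z = 1 / 4 * _ :=
      congrArg (fun x : ℝ => 1 / 4 * x) this
    rw [h', lap, smul_eq_mul]
    ring
  refine ⟨fun w => Real.pi⁻¹ * conv φ (radialKernel 1) w, contDiff_const.mul hcs, ?_, ?_⟩
  · rw [hφeq]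
    exact (contDiff_const.mul (hcs.of_le (by norm_cast))).sub (contDiff_const.mul hδ1)
  set C1 := ∑' k : ℕ, a * (1 / 4 : ℝ) ^ k
  set C2 := ∑' k : ℕ, b * (1 / 2 : ℝ) ^ k
  set C3 := M * ∫ w, |radialKernel 1 w|
  set C4 := M * ∫ w, ‖fderiv ℝ (radialKernel 1) w‖
  have hC1 : 0 ≤ C1 := (norm_nonneg _).trans (hδb 0)
  have hC2 : 0 ≤ C2 := (norm_nonneg _).trans (hδd 0)
  have hC3 : 0 ≤ C3 := by positivity
  have hC4 : 0 ≤ C4 := by positivity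
  have hπi : 0 ≤ Real.pi⁻¹ := by positivity
  have hle : ∀ {x c : ℝ}, x ≤ c → c ≤ C1 + C2 + C3 + C4 →
      Real.pi⁻¹ * x ≤ Real.pi⁻¹ * (C1 + C2 + C3 + C4) := fun h1 h2 =>
    mul_le_mul_of_nonneg_left (h1.trans h2) hπi
  have hLs : ContDiff ℝ ∞ (conv L (radialKernel 1)) := contDiff_conv hL.2.1 hχ hχc
  refine ⟨Real.pi⁻¹ * (C1 + C2 + C3 + C4), fun z => ?_, fun z => ?_, fun z => ?_, fun z => ?_⟩
  · rw [congrFun hdiff z, abs_mul, abs_of_nonneg hπi]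
    exact hle (hδb z) (by linarith)
  · rw [hdiff, fderiv_const_mul (hδ1.differentiable (by norm_num) z), norm_smul,
      Real.norm_of_nonneg hπi]
    exact hle (hδd z) (by linarith)
  · rw [hlapΦ, abs_mul, abs_of_nonneg hπi]
    exact hle (abs_conv_le hM hχ.continuous hχc z) (by linarith)
  · rw [hlapΦ, fderiv_const_mul (hLs.differentiable (by norm_num) z), norm_smul,
      Real.norm_of_nonneg hπi]
    exact hle (norm_fderiv_conv_le hL.2.1 hM0 hM (hχ.of_le (by norm_cast)) hχc z) (by linarith)

/-! ### From bounded gauges to gauges that straighten the operator `dbarStar φ`. -/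

theorem iteratedDeriv_taylorPolynomial (d : ℕ → ℂ) (a : ℂ) {n j : ℕ} (hj : j ≤ n) :
    iteratedDeriv j (fun z => ∑ k ∈ Finset.range (n + 1), d k / k.factorial * (z - a) ^ k) a =
      d j := by
  rw [iteratedDeriv_fun_sum fun k _ => by fun_prop]
  have h : ∀ k : ℕ, iteratedDeriv j (fun z => d k / k.factorial * (z - a) ^ k) a =
      if j = k then d k else 0 := fun k => by
    rw [iteratedDeriv_const_mul_field, iteratedDeriv_comp_sub_const (f := fun z => z ^ k)]
    simp only [sub_self]
    rw [iteratedDeriv_fun_pow_zero]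
    have : (k.factorial : ℂ) ≠ 0 := by exact_mod_cast k.factorial_ne_zero
    split_ifs
    · field_simp
    · simp
  simp only [h]
  rw [Finset.sum_ite_eq]
  simp [Nat.lt_succ_of_le hj]

theorem wirtinger_iterate_sub {f g : ℂ → ℂ} {z : ℂ} {j : ℕ} (hf : ContDiffAt ℝ j f z)
    (hg : ContDiffAt ℝ j g z) :
    wirtinger^[j] (fun w => f w - g w) z = wirtinger^[j] f z - wirtinger^[j] g z := by
  induction j generalizing f g with
  | zero => rfl
  | succ j ih =>
    rw [Function.iterate_succ_apply, Function.iterate_succ_apply, Function.iterate_succ_apply,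
      ← ih hf.wirtinger hg.wirtinger]
    refine (wirtinger_iterate_congr_nhds ?_ j).eq_of_nhds
    filter_upwards [differentiableAt_eventually hf, differentiableAt_eventually hg] with w h1 h2
      using wirtinger_sub h1 h2

theorem contDiffAt_real_of_differentiableOn {f : ℂ → ℂ} {U : Set ℂ} (hU : IsOpen U)
    (hf : DifferentiableOn ℂ f U) {z : ℂ} (hz : z ∈ U) (k : ℕ) : ContDiffAt ℝ k f z :=
  ((hf.contDiffOn hU).contDiffAt (hU.mem_nhds hz)).restrict_scalars ℝ

theorem wirtinger_iterate_sub_two_re {Φ : ℂ → ℝ} {H : ℂ → ℂ} {U : Set ℂ} (hU : IsOpen U)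
    (hH : DifferentiableOn ℂ H U) {z : ℂ} (hz : z ∈ U) {j : ℕ} (hj : 1 ≤ j)
    (hΦ : ContDiffAt ℝ j Φ z) :
    wirtinger^[j] (fun w => ((Φ w - 2 * (H w).re : ℝ) : ℂ)) z =
      wirtinger^[j] (fun w => ((Φ w : ℝ) : ℂ)) z - iteratedDeriv j H z := by
  obtain ⟨i, rfl⟩ : ∃ i, j = i + 1 := ⟨j - 1, by omega⟩
  have hΦc : ContDiffAt ℝ (i + 1 : ℕ) (fun w => ((Φ w : ℝ) : ℂ)) z :=
    ofRealCLM.contDiff.contDiffAt.comp z hΦ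
  have hd : ∀ᶠ w in 𝓝 z, DifferentiableAt ℝ Φ w :=
    (hΦ.eventually (by simp)).mono fun _ hw => hw.differentiableAt (by simp)
  have hev : wirtinger (fun w => ((Φ w - 2 * (H w).re : ℝ) : ℂ)) =ᶠ[𝓝 z]
      fun w => wirtinger (fun w => ((Φ w : ℝ) : ℂ)) w - deriv H w := by
    filter_upwards [hd, hU.eventually_mem hz] with w h1 h2
      using wirtinger_sub_two_re h1 (hH.differentiableAt (hU.mem_nhds h2))
  have hH' := hH.deriv hU
  rw [Function.iterate_succ_apply, (wirtinger_iterate_congr_nhds hev i).eq_of_nhds,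
    wirtinger_iterate_sub hΦc.wirtinger (contDiffAt_real_of_differentiableOn hU hH' hz i),
    wirtinger_iterate_of_differentiableOn hU hH' i z hz, iteratedDeriv_succ',
    Function.iterate_succ_apply]

/-- The product `e^{-φ} f` factors as `e^{-(φ - 2 Re H)} · e^{-conj H} · f e^{-H}`. At `a`, the pure
`∂`-derivatives of the first factor vanish by flatness and those of the second because it is
antiholomorphic, so all derivatives fall on the third. Since `H a = φ a / 2`, the remaining
constants multiply to `e^{φ(a)/2}`. -/
theorem dbarStar_iterate_of_flat {φ : ℂ → ℝ} {H : ℂ → ℂ} {U : Set ℂ} (hU : IsOpen U) {a : ℂ}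
    (ha : a ∈ U) (hH : DifferentiableOn ℂ H U) (hHa : H a = ((φ a / 2 : ℝ) : ℂ)) {j : ℕ}
    (hφ : ContDiffAt ℝ j φ a)
    (hflat : ∀ i, 1 ≤ i → i ≤ j → wirtinger^[i] (fun w => ((φ w - 2 * (H w).re : ℝ) : ℂ)) a = 0)
    {f : ℂ → ℂ} (hf : DifferentiableOn ℂ f U) :
    (dbarStar φ)^[j] f a = (-1) ^ j * ((Real.exp (φ a / 2) : ℝ) : ℂ) *
      iteratedDeriv j (fun z => f z * exp (-H z)) a := by
  have hg : DifferentiableOn ℂ (fun z => f z * exp (-H z)) U := hf.mul hH.neg.cexp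
  have hsplit : (fun w => ((Real.exp (-φ w) : ℝ) : ℂ) * f w) = fun w =>
      exp (-((φ w - 2 * (H w).re : ℝ) : ℂ)) *
        (exp (-(starRingEnd ℂ) (H w)) * (f w * exp (-H w))) := by
    funext w
    have h1 : ((φ w - 2 * (H w).re : ℝ) : ℂ) = φ w - (H w + (starRingEnd ℂ) (H w)) := by
      rw [ofReal_sub, two_re_eq]
    rw [h1, ofReal_exp, ofReal_neg]
    have h2 : exp (-((φ w : ℂ))) = exp (-((φ w : ℂ) - (H w + (starRingEnd ℂ) (H w)))) *
        exp (-(starRingEnd ℂ) (H w)) * exp (-H w) := by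
      rw [← exp_add, ← exp_add]; ring_nf
    rw [h2]; ring
  have hHc := contDiffAt_real_of_differentiableOn hU hH ha j
  have hconj : ContDiffAt ℝ j (fun w => (starRingEnd ℂ) (H w)) a :=
    (conjCLE : ℂ →L[ℝ] ℂ).contDiff.contDiffAt.comp a hHc
  have hψ : ContDiffAt ℝ j (fun w => ((φ w - 2 * (H w).re : ℝ) : ℂ)) a :=
    ofRealCLM.contDiff.contDiffAt.comp a
      (hφ.sub (contDiffAt_const.mul (reCLM.contDiff.contDiffAt.comp a hHc)))
  have hconj0 : ∀ i, 1 ≤ i → i ≤ j → wirtinger^[i] (fun w => (starRingEnd ℂ) (H w)) a = 0 :=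
    fun i hi _ => by
    obtain ⟨i, rfl⟩ : ∃ k, i = k + 1 := ⟨i - 1, by omega⟩
    rw [Function.iterate_succ_apply]
    refine wirtinger_iterate_eq_zero_of_eventuallyEq ?_ i
    filter_upwards [hU.eventually_mem ha] with w hw
    have hd := hH.differentiableAt (hU.mem_nhds hw)
    rw [wirtinger_conj_comp (hd.restrictScalars ℝ), dbar_of_differentiableAt hd, map_zero]
  have hgc := contDiffAt_real_of_differentiableOn hU hg ha j
  have hle : ∀ {i}, i ≤ j → ((i : ℕ) : WithTop ℕ∞) ≤ ((j : ℕ) : WithTop ℕ∞) := fun h => by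
    exact_mod_cast h
  rw [dbarStar_iterate, hsplit, wirtinger_iterate_mul_of_flat hψ.neg.cexp (hconj.neg.cexp.mul hgc)
    fun i hi hij => wirtinger_iterate_exp_neg_eq_zero (hψ.of_le (hle hij))
      (fun k hk hki => hflat k hk (hki.trans hij)) hi,
    wirtinger_iterate_mul_of_flat hconj.neg.cexp hgc
    fun i hi hij => wirtinger_iterate_exp_neg_eq_zero (hconj.of_le (hle hij))
      (fun k hk hki => hconj0 k hk (hki.trans hij)) hi,
    wirtinger_iterate_of_differentiableOn hU hg j a ha, hHa, conj_ofReal, ofReal_re]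
  have h3 : φ a - 2 * (φ a / 2) = 0 := by ring
  rw [h3, ofReal_zero, neg_zero, exp_zero, one_mul, ← ofReal_neg, ← ofReal_exp]
  have h4 : Real.exp (φ a / 2) = Real.exp (φ a) * Real.exp (-(φ a / 2)) := by
    rw [← Real.exp_add]; ring_nf
  rw [h4, ofReal_mul]
  ring

/-- A family of holomorphic gauges: near each point `a`, the function `H` is holomorphic,
`φ ≤ 2 Re H + C` and `f ↦ f e^{-H}` turns the iterates of `dbarStar φ` at `a` up to order `n`
into ordinary derivatives. -/
def HasGauge (φ : ℂ → ℝ) (n : ℕ) (C : ℝ) : Prop :=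
  ∀ a : ℂ, ∃ H : ℂ → ℂ, DifferentiableOn ℂ H (Metric.ball a 1) ∧
    (∀ z ∈ Metric.ball a 1, φ z ≤ 2 * (H z).re + C) ∧
    ∀ f : ℂ → ℂ, Differentiable ℂ f → ∀ j ≤ n, (dbarStar φ)^[j] f a =
      (-1) ^ j * ((Real.exp (φ a / 2) : ℝ) : ℂ) * iteratedDeriv j (fun z => f z * exp (-H z)) a

/-- For holomorphic `P` and `j ≥ 1` one has `∂^j (2 Re P) = P^{(j)}`. Hence adding to `H` the
polynomial whose derivatives at `a` are those of `φ - 2 Re H` makes the difference flat, at the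
price of a bounded change of `H` on the unit disc. -/
theorem hasGauge_of_bounded {φ : ℂ → ℝ} {n : ℕ} (hφ : ContDiff ℝ n φ) {C : ℝ}
    (h : ∀ a : ℂ, ∃ H : ℂ → ℂ, DifferentiableOn ℂ H (Metric.ball a 1) ∧
      (∀ z ∈ Metric.ball a 1, |φ z - 2 * (H z).re| ≤ C) ∧
      ∀ j, 1 ≤ j → j ≤ n →
        ‖wirtinger^[j] (fun w => ((φ w - 2 * (H w).re : ℝ) : ℂ)) a‖ ≤ C) :
    ∃ C', HasGauge φ n C' := by
  -- One `C` is the given bound at `z`, the second is the bound at `a` for the constant term of the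
  -- polynomial, and `n * C` bounds its `n` other terms.
  refine ⟨C + C + 2 * (n * C), fun a => ?_⟩
  obtain ⟨H, hH, hHC, hHj⟩ := h a
  have haball : a ∈ Metric.ball a 1 := Metric.mem_ball_self one_pos
  -- The constant term makes the new gauge take the real value `φ a / 2` at `a`, as
  -- `dbarStar_iterate_of_flat` requires.
  let d : ℕ → ℂ := fun j => if j = 0 then ((φ a / 2 : ℝ) : ℂ) - H a else
    wirtinger^[j] (fun w => ((φ w - 2 * (H w).re : ℝ) : ℂ)) a
  let P : ℂ → ℂ := fun z => ∑ k ∈ Finset.range (n + 1), d k / k.factorial * (z - a) ^ k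
  have hP : Differentiable ℂ P := by fun_prop
  have hPa : P a = d 0 := by
    have := iteratedDeriv_taylorPolynomial d a (n := n) (Nat.zero_le n)
    simpa [P] using this
  have hHP : DifferentiableOn ℂ (fun z => H z + P z) (Metric.ball a 1) :=
    hH.add hP.differentiableOn
  have hHPa : H a + P a = ((φ a / 2 : ℝ) : ℂ) := by
    rw [hPa]; simp [d]
  refine ⟨fun z => H z + P z, hHP, fun z hz => ?_, fun f hf j hj => ?_⟩
  · have h1 : ∑ k ∈ Finset.range n, d (k + 1) / (k + 1).factorial * (z - a) ^ (k + 1) =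
        P z - d 0 := by
      simp only [P]
      rw [Finset.sum_range_succ']
      simp
    have h2 : ‖P z - d 0‖ ≤ n * C := by
      rw [← h1]
      refine (norm_sum_le _ _).trans ?_
      have : ∀ k ∈ Finset.range n,
          ‖d (k + 1) / (k + 1).factorial * (z - a) ^ (k + 1)‖ ≤ C := fun k hk => by
        have hd : ‖d (k + 1)‖ ≤ C := by
          simp only [d, Nat.succ_ne_zero, if_false]
          exact hHj (k + 1) (by omega) (Finset.mem_range.1 hk)
        rw [norm_mul, norm_div, norm_pow]
        have hC : 0 ≤ C := (norm_nonneg _).trans hd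
        have hfac : (1 : ℝ) ≤ ‖((k + 1).factorial : ℂ)‖ := by
          rw [Complex.norm_natCast]; exact_mod_cast Nat.succ_le_of_lt (Nat.factorial_pos _)
        have hza : ‖z - a‖ ≤ 1 := by
          rw [Metric.mem_ball, dist_eq] at hz; exact hz.le
        refine (mul_le_of_le_one_right (by positivity)
          (pow_le_one₀ (norm_nonneg _) hza)).trans ?_
        exact (div_le_self (norm_nonneg _) hfac).trans hd
      simpa using (Finset.sum_le_sum this)
    have h3 := (abs_re_le_norm (P z - d 0)).trans h2
    rw [sub_re] at h3
    have h4 : (d 0).re = φ a / 2 - (H a).re := by simp [d]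
    have h5 := abs_le.1 (hHC z hz)
    have h6 := abs_le.1 (hHC a haball)
    have h7 := abs_le.1 h3
    rw [add_re]
    linarith
  · refine dbarStar_iterate_of_flat Metric.isOpen_ball haball hHP hHPa
      (hφ.of_le (by exact_mod_cast hj)).contDiffAt (fun i hi hij => ?_) hf.differentiableOn
    have hHr : ContDiffAt ℝ i (fun w => φ w - 2 * (H w).re) a :=
      (hφ.of_le (by exact_mod_cast hij.trans hj)).contDiffAt.sub (contDiffAt_const.mul
        (reCLM.contDiff.contDiffAt.comp a
          (contDiffAt_real_of_differentiableOn Metric.isOpen_ball hH haball i)))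
    have := wirtinger_iterate_sub_two_re isOpen_univ hP.differentiableOn (mem_univ a) hi hHr
    have e : (fun w => ((φ w - 2 * (H w + P w).re : ℝ) : ℂ)) =
        fun w => ((φ w - 2 * (H w).re - 2 * (P w).re : ℝ) : ℂ) := by
      funext w; rw [add_re]; ring_nf
    rw [e, this, iteratedDeriv_taylorPolynomial d a (hij.trans hj)]
    simp [d, show i ≠ 0 by omega]

/-- For `n ≥ 2` compatibility supplies exactly the smoothness and the bounds needed, with `k = n -
1`; the bound for `j = 0` comes from that on `L`. For `n = 1` the gauge of the smooth approximation
`Φ` also serves `φ`, because `Φ - φ` and its gradient are bounded. -/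
theorem exists_hasGauge {φ L : ℂ → ℝ} (hφ : Subharmonic φ) (hL : HasLaplacian φ L)
    {Λ : MultSet} (hcomp : Λ.Compatible φ L) {n : ℕ} (hn : 1 ≤ n) (hmax : Λ.maxMult = n + 1) :
    ∃ C, HasGauge φ n C := by
  obtain ⟨m, M, hm, hM, hLae⟩ := hcomp.bounds
  have hMae : ∀ᵐ z, |L z| ≤ M := hLae.mono fun z hz => by
    rw [abs_of_pos (hm.trans hz.1)]; exact hz.2.le
  rcases Nat.lt_or_ge 1 n with hn2 | hn1
  · have hsm := hcomp.smooth (by omega)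
    have hder := hcomp.deriv_bounded (by omega)
    rw [hmax] at hsm hder
    obtain ⟨k, rfl⟩ : ∃ k, n = k + 1 := ⟨n - 1, by omega⟩
    have hφk : ContDiff ℝ (k + 2 : ℕ) φ := by exact_mod_cast hsm
    have hφ2 : ContDiff ℝ 2 φ := hφk.of_le (by norm_cast; omega)
    have hB : ∀ j < k + 1, ∃ A : ℝ, ∀ z,
        ‖wirtinger^[j] (fun w => ((lap φ w : ℝ) : ℂ)) z‖ ≤ A := fun j hj => by
      rcases Nat.eq_zero_or_pos j with rfl | hj0
      · refine ⟨M, fun z => ?_⟩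
        simp only [Function.iterate_zero, id_eq, norm_real]
        exact abs_lap_le_of_hasLaplacian hφ2 hL hMae z
      · exact hder j hj0 (by omega)
    obtain ⟨B, hB⟩ := exists_forall_lt_bound hB
    obtain ⟨C, hC⟩ := exists_gauge_of_wirtinger_lap_bounded (by omega) hφk
      fun j hj => hB j (by omega)
    exact hasGauge_of_bounded (hφk.of_le (by norm_cast; omega)) hC
  · obtain rfl : n = 1 := by omega
    obtain ⟨Φ, hΦ, hφ1, C, h1, h2, h3, h4⟩ := exists_smooth_approximation hφ hL hM.le hMae
    have hΦ3 : ContDiff ℝ (1 + 2 : ℕ) Φ := hΦ.of_le (by norm_cast)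
    have hlapd : Differentiable ℝ (lap Φ) := by
      have hΦ2 : ContDiff ℝ 2 Φ := hΦ.of_le (by norm_cast)
      rw [show lap Φ = _ from funext (lap_eq_fderiv_fderiv hΦ2)]
      have h : ∀ v, Differentiable ℝ fun z => fderiv ℝ (fun w => fderiv ℝ Φ w v) z v := fun v =>
        (contDiff_fderiv_apply (k := 1) (contDiff_fderiv_apply (k := 2) hΦ3 v) v).differentiable
          (by norm_num)
      exact ((h 1).add (h I)).const_mul _
    have hcast : ∀ {g : ℂ → ℝ} {z : ℂ}, DifferentiableAt ℝ g z →
        ‖wirtinger (fun w => ((g w : ℝ) : ℂ)) z‖ ≤ ‖fderiv ℝ g z‖ := fun {g z} hg => by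
      refine (norm_wirtinger_le _ _).trans ?_
      have : HasFDerivAt (fun w => ((g w : ℝ) : ℂ)) (ofRealCLM.comp (fderiv ℝ g z)) z :=
        ofRealCLM.hasFDerivAt.comp z hg.hasFDerivAt
      rw [this.fderiv]
      refine (ContinuousLinearMap.opNorm_comp_le _ _).trans ?_
      rw [ofRealCLM_norm, one_mul]
    obtain ⟨C', hC'⟩ := exists_gauge_of_wirtinger_lap_bounded le_rfl hΦ3 (B := C)
      (fun j hj z => by
        interval_cases j
        · simpa using h3 z
        · exact (hcast (hlapd z)).trans (h4 z))
    refine hasGauge_of_bounded (by exact_mod_cast hφ1) (C := C + C') fun a => ?_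
    obtain ⟨H, hH, hH1, hH2⟩ := hC' a
    refine ⟨H, hH, fun z hz => ?_, fun j hj1 hj2 => ?_⟩
    · have h5 := abs_le.1 (h1 z)
      have h6 := abs_le.1 (hH1 z hz)
      exact abs_le.2 ⟨by linarith, by linarith⟩
    · obtain rfl : j = 1 := by omega
      have h7 := hH2 1 le_rfl (by omega)
      simp only [Function.iterate_one] at h7 ⊢
      have hΦd : Differentiable ℝ Φ := hΦ.differentiable (by norm_num)
      have hφd : Differentiable ℝ φ := hφ1.differentiable (by norm_num)
      have hHd : DifferentiableAt ℂ H a :=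
        hH.differentiableAt (Metric.isOpen_ball.mem_nhds (Metric.mem_ball_self one_pos))
      have hcd : ∀ {g : ℂ → ℝ}, Differentiable ℝ g → DifferentiableAt ℝ
          (fun w => ((g w : ℝ) : ℂ)) a := fun hg => ofRealCLM.differentiableAt.comp a (hg a)
      have h8 := (hcast ((hΦd a).fun_sub (hφd a))).trans (h2 a)
      simp only [ofReal_sub] at h8
      rw [wirtinger_sub (hcd hΦd) (hcd hφd)] at h8
      rw [wirtinger_sub_two_re (hΦd a) hHd] at h7
      rw [wirtinger_sub_two_re (hφd a) hHd]
      have h9 := norm_sub_le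
        (wirtinger (fun w => ((Φ w : ℝ) : ℂ)) a - deriv H a)
        (wirtinger (fun w => ((Φ w : ℝ) : ℂ)) a - wirtinger (fun w => ((φ w : ℝ) : ℂ)) a)
      have e : wirtinger (fun w => ((Φ w : ℝ) : ℂ)) a - deriv H a -
          (wirtinger (fun w => ((Φ w : ℝ) : ℂ)) a - wirtinger (fun w => ((φ w : ℝ) : ℂ)) a) =
          wirtinger (fun w => ((φ w : ℝ) : ℂ)) a - deriv H a := by ring
      rw [e] at h9
      linarith

/-! ### Stability of surjectivity and of interpolation in `ℓ²`. -/

/-- By the open mapping theorem `T` has a bounded, possibly nonlinear, right inverse. A perturbation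
of at most half the reciprocal of its bound is absorbed by the iteration behind the inverse function
theorem. -/
theorem surjective_of_norm_sub_lt {X Y : Type*} [NormedAddCommGroup X] [NormedSpace ℂ X]
    [CompleteSpace X] [NormedAddCommGroup Y] [NormedSpace ℂ Y] [CompleteSpace Y]
    (T : X →L[ℂ] Y) (hT : Function.Surjective T) :
    ∃ δ : ℝ, 0 < δ ∧ ∀ T' : X →L[ℂ] Y, ‖T' - T‖ ≤ δ → Function.Surjective T' := by
  have hrange : T.range = ⊤ := LinearMap.range_eq_top.2 hT
  set S := T.nonlinearRightInverseOfSurjective hrange with hS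
  have hpos : 0 < S.nnnorm := T.nonlinearRightInverseOfSurjective_nnnorm_pos hrange
  have hpos' : (0 : ℝ) < (S.nnnorm : ℝ)⁻¹ := inv_pos.2 (by exact_mod_cast hpos)
  refine ⟨(S.nnnorm : ℝ)⁻¹ / 2, by positivity, fun T' hT' y => ?_⟩
  set c : NNReal := S.nnnorm⁻¹ / 2 with hc
  have hcR : (c : ℝ) = (S.nnnorm : ℝ)⁻¹ / 2 := by simp [hc]
  have happ : ApproximatesLinearOn T' T univ c := fun x _ x' _ => by
    have : T' x - T' x' - T (x - x') = (T' - T) (x - x') := by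
      simp only [map_sub, sub_apply]; abel
    rw [this, hcR]
    exact (ContinuousLinearMap.le_opNorm _ _).trans
      (mul_le_mul_of_nonneg_right hT' (norm_nonneg _))
  -- The image of the closed ball of radius `ε` covers a ball of radius `(‖S‖⁻¹ - c) ε`, which is
  -- `‖y‖` for this choice.
  set ε : ℝ := ‖y‖ / ((S.nnnorm : ℝ)⁻¹ / 2) with hε
  have hε0 : 0 ≤ ε := by positivity
  have hsurj := happ.surjOn_closedBall_of_nonlinearRightInverse S hε0 (b := 0) (subset_univ _)
  obtain ⟨x, -, hx⟩ := hsurj (show y ∈ Metric.closedBall (T' 0) _ by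
    rw [map_zero, mem_closedBall_zero_iff, hcR, hε,
      show (S.nnnorm : ℝ)⁻¹ - (S.nnnorm : ℝ)⁻¹ / 2 = (S.nnnorm : ℝ)⁻¹ / 2 by ring,
      mul_div_cancel₀ _ (by positivity)])
  exact ⟨x, hx⟩

theorem memlp_two_of_summable {ι : Type*} {y : ι → ℂ} (h : Summable fun i => ‖y i‖ ^ 2) :
    Memℓp y 2 := by
  refine memℓp_gen ?_
  simpa using h

theorem lp_two_norm_sq {ι : Type*} (f : lp (fun _ : ι => ℂ) 2) : ‖f‖ ^ 2 = ∑' i, ‖f i‖ ^ 2 := by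
  have := lp.norm_rpow_eq_tsum (p := 2) (by norm_num) f
  simpa using this

theorem exists_continuousLinearMap_lp {X ι : Type*} [NormedAddCommGroup X] [NormedSpace ℂ X]
    (l : ι → X →ₗ[ℂ] ℂ) {A : ℝ} (hA : 0 ≤ A) (hs : ∀ x, Summable fun i => ‖l i x‖ ^ 2)
    (hb : ∀ x, ∑' i, ‖l i x‖ ^ 2 ≤ A ^ 2 * ‖x‖ ^ 2) :
    ∃ T : X →L[ℂ] lp (fun _ : ι => ℂ) 2, (∀ x i, T x i = l i x) ∧ ‖T‖ ≤ A := by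
  let T₀ : X →ₗ[ℂ] lp (fun _ : ι => ℂ) 2 :=
    { toFun := fun x => ⟨fun i => l i x, memlp_two_of_summable (hs x)⟩
      map_add' := fun x y => by ext i; exact map_add (l i) x y
      map_smul' := fun c x => by ext i; exact map_smul (l i) c x }
  have hT₀ : ∀ x, ‖T₀ x‖ ≤ A * ‖x‖ := fun x => by
    refine le_of_sq_le_sq ?_ (by positivity)
    rw [lp_two_norm_sq, mul_pow]
    exact hb x
  exact ⟨T₀.mkContinuous A hT₀, fun x i => rfl, LinearMap.mkContinuous_norm_le _ hA _⟩

theorem exists_interpolation_stability {X ι : Type*} [NormedAddCommGroup X] [NormedSpace ℂ X]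
    [CompleteSpace X] (l : ι → X →ₗ[ℂ] ℂ) {A : ℝ} (hA : 0 ≤ A)
    (hs : ∀ x, Summable fun i => ‖l i x‖ ^ 2)
    (hb : ∀ x, ∑' i, ‖l i x‖ ^ 2 ≤ A ^ 2 * ‖x‖ ^ 2)
    (hsurj : ∀ y : ι → ℂ, (Summable fun i => ‖y i‖ ^ 2) → ∃ x, ∀ i, l i x = y i) :
    ∃ δ : ℝ, 0 < δ ∧ ∀ l' : ι → X →ₗ[ℂ] ℂ, (∀ x, Summable fun i => ‖l' i x - l i x‖ ^ 2) →
      (∀ x, ∑' i, ‖l' i x - l i x‖ ^ 2 ≤ δ ^ 2 * ‖x‖ ^ 2) →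
      ∀ y : ι → ℂ, (Summable fun i => ‖y i‖ ^ 2) → ∃ x, ∀ i, l' i x = y i := by
  obtain ⟨T, hT, -⟩ := exists_continuousLinearMap_lp l hA hs hb
  have hTs : Function.Surjective T := fun y => by
    obtain ⟨x, hx⟩ := hsurj y (by simpa using (lp.memℓp y).summable (by norm_num))
    exact ⟨x, by ext i; rw [hT, hx]⟩
  obtain ⟨δ, hδ, hstab⟩ := surjective_of_norm_sub_lt T hTs
  refine ⟨δ, hδ, fun l' hs' hb' y hy => ?_⟩
  obtain ⟨D, hD, hDn⟩ := exists_continuousLinearMap_lp (fun i => l' i - l i) hδ.le hs' hb'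
  obtain ⟨x, hx⟩ := hstab (T + D) (by simpa using hDn) ⟨y, memlp_two_of_summable hy⟩
  refine ⟨x, fun i => ?_⟩
  have h1 : (T + D) x i = y i := by rw [hx]
  have h2 : (T + D) x i = T x i + D x i := rfl
  rw [h2, hT, hD] at h1
  simpa using h1

/-! ### The Fock space as a complete subspace of `L²`. -/

/-- The weight `e^{-φ/2}`. -/
noncomputable def halfWeight (φ : ℂ → ℝ) (z : ℂ) : ℂ := ((Real.exp (-φ z / 2) : ℝ) : ℂ)

theorem halfWeight_ne_zero (φ : ℂ → ℝ) (z : ℂ) : halfWeight φ z ≠ 0 := by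
  simp [halfWeight]

theorem norm_mul_halfWeight_sq (φ : ℂ → ℝ) (f : ℂ → ℂ) (z : ℂ) :
    ‖f z * halfWeight φ z‖ ^ 2 = ‖f z‖ ^ 2 * Real.exp (-φ z) := by
  rw [norm_mul, mul_pow, halfWeight, norm_real, Real.norm_of_nonneg (Real.exp_pos _).le,
    ← Real.exp_nat_mul]
  congr 2
  push_cast
  ring

theorem measurable_halfWeight {φ : ℂ → ℝ} (hφ : Measurable φ) : Measurable (halfWeight φ) :=
  measurable_ofReal.comp (Real.measurable_exp.comp (hφ.neg.div_const 2))

theorem memFock_iff {φ : ℂ → ℝ} (hφ : Measurable φ) {f : ℂ → ℂ} (hf : Differentiable ℂ f) :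
    MemFock φ f ↔ MemLp (fun z => f z * halfWeight φ z) 2 := by
  rw [memLp_two_iff_integrable_sq_norm (f := fun z => f z * halfWeight φ z)
    (hf.continuous.measurable.mul (measurable_halfWeight hφ)).aestronglyMeasurable]
  simp only [norm_mul_halfWeight_sq, MemFock, hf, true_and]

/-- The Fock space as a subspace of `L²`, through `f ↦ f e^{-φ/2}`. -/
noncomputable def fockSpace (φ : ℂ → ℝ) : Submodule ℂ (Lp ℂ 2 (volume : Measure ℂ)) where
  carrier := {F | ∃ f : ℂ → ℂ, Differentiable ℂ f ∧ F =ᵐ[volume] fun z => f z * halfWeight φ z}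
  add_mem' := by
    rintro F G ⟨f, hf, hF⟩ ⟨g, hg, hG⟩
    refine ⟨fun z => f z + g z, hf.add hg, ?_⟩
    filter_upwards [Lp.coeFn_add F G, hF, hG] with z h1 h2 h3
    rw [h1, Pi.add_apply, h2, h3]
    ring
  zero_mem' := ⟨fun _ => 0, differentiable_const _, by
    filter_upwards [Lp.coeFn_zero ℂ 2 (volume : Measure ℂ)] with z h
    rw [h]; simp⟩
  smul_mem' := by
    rintro c F ⟨f, hf, hF⟩
    refine ⟨fun z => c * f z, hf.const_mul c, ?_⟩
    filter_upwards [Lp.coeFn_smul c F, hF] with z h1 h2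
    rw [h1, Pi.smul_apply, h2, smul_eq_mul]
    ring

theorem eq_of_ae_eq_mul_halfWeight {φ : ℂ → ℝ} {f g : ℂ → ℂ} (hf : Continuous f)
    (hg : Continuous g)
    (h : (fun z => f z * halfWeight φ z) =ᵐ[volume] fun z => g z * halfWeight φ z) : f = g := by
  refine (Continuous.ae_eq_iff_eq volume hf hg).1 ?_
  filter_upwards [h] with z hz
  exact mul_right_cancel₀ (halfWeight_ne_zero φ z) hz

/-- The entire function underlying an element of the Fock space. -/
noncomputable def fockFun {φ : ℂ → ℝ} (F : fockSpace φ) : ℂ → ℂ := Classical.choose F.2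

theorem differentiable_fockFun {φ : ℂ → ℝ} (F : fockSpace φ) : Differentiable ℂ (fockFun F) :=
  (Classical.choose_spec F.2).1

theorem fockFun_ae_eq {φ : ℂ → ℝ} (F : fockSpace φ) :
    (F : Lp ℂ 2 (volume : Measure ℂ)) =ᵐ[volume] fun z => fockFun F z * halfWeight φ z :=
  (Classical.choose_spec F.2).2

theorem fockFun_eq {φ : ℂ → ℝ} (F : fockSpace φ) {f : ℂ → ℂ} (hf : Differentiable ℂ f)
    (h : (F : Lp ℂ 2 (volume : Measure ℂ)) =ᵐ[volume] fun z => f z * halfWeight φ z) :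
    fockFun F = f :=
  eq_of_ae_eq_mul_halfWeight (differentiable_fockFun F).continuous hf.continuous
    ((fockFun_ae_eq F).symm.trans h)

theorem fockFun_add {φ : ℂ → ℝ} (F G : fockSpace φ) :
    fockFun (F + G) = fun z => fockFun F z + fockFun G z := by
  refine fockFun_eq _ ((differentiable_fockFun F).add (differentiable_fockFun G)) ?_
  filter_upwards [Lp.coeFn_add (F : Lp ℂ 2 (volume : Measure ℂ)) G, fockFun_ae_eq F,
    fockFun_ae_eq G] with z h1 h2 h3
  rw [Submodule.coe_add, h1, Pi.add_apply, h2, h3]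
  ring

theorem fockFun_smul {φ : ℂ → ℝ} (c : ℂ) (F : fockSpace φ) :
    fockFun (c • F) = fun z => c * fockFun F z := by
  refine fockFun_eq _ ((differentiable_fockFun F).const_mul c) ?_
  filter_upwards [Lp.coeFn_smul c (F : Lp ℂ 2 (volume : Measure ℂ)), fockFun_ae_eq F]
    with z h1 h2
  rw [Submodule.coe_smul, h1, Pi.smul_apply, h2, smul_eq_mul]
  ring

theorem memFock_fockFun {φ : ℂ → ℝ} (hφ : Measurable φ) (F : fockSpace φ) :
    MemFock φ (fockFun F) :=
  (memFock_iff hφ (differentiable_fockFun F)).2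
    ((memLp_congr_ae (fockFun_ae_eq F)).1 (Lp.memLp _))

theorem norm_sq_fockSpace {φ : ℂ → ℝ} (F : fockSpace φ) :
    ‖F‖ ^ 2 = ∫ z, ‖fockFun F z‖ ^ 2 * Real.exp (-φ z) := by
  have h1 : ‖F‖ ^ 2 = ‖(F : Lp ℂ 2 (volume : Measure ℂ))‖ ^ 2 := rfl
  have h2 := inner_self_eq_norm_sq_to_K (𝕜 := ℂ) (F : Lp ℂ 2 (volume : Measure ℂ))
  rw [L2.inner_def] at h2
  have h3 : ∫ z, inner ℂ ((F : Lp ℂ 2 (volume : Measure ℂ)) z)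
      ((F : Lp ℂ 2 (volume : Measure ℂ)) z) =
      ∫ z, ((‖fockFun F z‖ ^ 2 * Real.exp (-φ z) : ℝ) : ℂ) := by
    refine integral_congr_ae ?_
    filter_upwards [fockFun_ae_eq F] with z hz
    rw [inner_self_eq_norm_sq_to_K (𝕜 := ℂ), hz, ← norm_mul_halfWeight_sq]
    norm_cast
  rw [h3, integral_complex_ofReal] at h2
  rw [h1]
  refine Complex.ofReal_injective ?_
  rw [ofReal_pow]
  exact h2.symm

theorem exists_fockSpace_eq {φ : ℂ → ℝ} (hφ : Measurable φ) {f : ℂ → ℂ} (hf : MemFock φ f) :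
    ∃ F : fockSpace φ, fockFun F = f := by
  have h := (memFock_iff hφ hf.1).1 hf
  exact ⟨⟨h.toLp _, f, hf.1, h.coeFn_toLp⟩, fockFun_eq _ hf.1 h.coeFn_toLp⟩

/-- An upper semicontinuous `φ` is bounded above on compact sets, so `e^{-φ}` is bounded below there
and the mean value property applies. No lower bound on `φ` is needed. -/
theorem exists_norm_fockFun_le {φ : ℂ → ℝ} (hφ : UpperSemicontinuous φ) (a : ℂ) :
    ∃ C : ℝ, 0 ≤ C ∧ ∀ (F : fockSpace φ), ∀ z ∈ Metric.ball a 1, ‖fockFun F z‖ ≤ C * ‖F‖ := by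
  obtain ⟨B, hB⟩ := (hφ.upperSemicontinuousOn (Metric.closedBall a 2)).bddAbove_of_isCompact
    (isCompact_closedBall a 2)
  refine ⟨Real.sqrt ((Real.pi)⁻¹ * Real.exp B), Real.sqrt_nonneg _, fun F z hz => ?_⟩
  have hsub : Metric.ball z 1 ⊆ Metric.closedBall a 2 := fun w hw => by
    rw [Metric.mem_ball] at hz hw
    rw [Metric.mem_closedBall]
    linarith [dist_triangle w z a]
  have hd := differentiable_fockFun F
  have hi := (memFock_fockFun hφ.measurable F).2
  have hcont : Continuous fun w => ‖fockFun F w‖ ^ 2 := hd.continuous.norm.pow 2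
  have hi1 : IntegrableOn (fun w => ‖fockFun F w‖ ^ 2) (Metric.ball z 1) :=
    (hcont.continuousOn.integrableOn_compact (isCompact_closedBall z 1)).mono_set
      Metric.ball_subset_closedBall
  have h1 := norm_sq_le_setIntegral_ball one_pos hd.differentiableOn hi1
  have h2 : ∫ w in Metric.ball z 1, ‖fockFun F w‖ ^ 2 ≤
      Real.exp B * ∫ w, ‖fockFun F w‖ ^ 2 * Real.exp (-φ w) := by
    rw [← integral_const_mul]
    refine (setIntegral_mono_on hi1 (hi.const_mul _).integrableOn measurableSet_ball
      fun w hw => ?_).trans (setIntegral_le_integral (hi.const_mul _)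
        (Eventually.of_forall fun w => by positivity))
    have hw' : φ w ≤ B := hB (mem_image_of_mem φ (hsub hw))
    have : 1 ≤ Real.exp B * Real.exp (-φ w) := by
      rw [← Real.exp_add]; exact Real.one_le_exp (by linarith)
    calc ‖fockFun F w‖ ^ 2 = ‖fockFun F w‖ ^ 2 * 1 := (mul_one _).symm
      _ ≤ ‖fockFun F w‖ ^ 2 * (Real.exp B * Real.exp (-φ w)) := by gcongr
      _ = _ := by ring
  refine le_of_sq_le_sq ?_ (by positivity)
  rw [mul_pow, Real.sq_sqrt (by positivity), norm_sq_fockSpace, mul_assoc]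
  refine h1.trans ?_
  rw [one_pow, mul_one]
  exact mul_le_mul_of_nonneg_left h2 (by positivity)

theorem fockFun_sub {φ : ℂ → ℝ} (F G : fockSpace φ) (z : ℂ) :
    fockFun (F - G) z = fockFun F z - fockFun G z := by
  have := congrFun (fockFun_add (F - G) G) z
  rw [sub_add_cancel] at this
  rw [this]; ring

/-- Norm convergence forces locally uniform convergence of the entire functions, hence an entire
limit; a subsequence converging almost everywhere identifies it with the `L²` limit. The resulting
completeness is what the open mapping argument requires. -/
theorem isClosed_fockSpace {φ : ℂ → ℝ} (hφ : UpperSemicontinuous φ) :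
    IsClosed (fockSpace φ : Set (Lp ℂ 2 (volume : Measure ℂ))) := by
  refine isClosed_of_closure_subset fun G hG => ?_
  obtain ⟨F, hF, hlim⟩ := mem_closure_iff_seq_limit.1 hG
  let u : ℕ → fockSpace φ := fun k => ⟨F k, hF k⟩
  have hcau : ∀ ε > 0, ∃ N, ∀ m ≥ N, ∀ n ≥ N, ‖u m - u n‖ < ε := fun ε hε => by
    obtain ⟨N, hN⟩ := Metric.cauchySeq_iff.1 hlim.cauchySeq ε hε
    exact ⟨N, fun m hm n hn => by simpa [dist_eq_norm, u] using hN m hm n hn⟩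
  have hunif : ∀ a : ℂ, UniformCauchySeqOn (fun k => fockFun (u k)) atTop (Metric.ball a 1) :=
    fun a => by
    obtain ⟨C, hC0, hC⟩ := exists_norm_fockFun_le hφ a
    rw [Metric.uniformCauchySeqOn_iff]
    intro ε hε
    obtain ⟨N, hN⟩ := hcau (ε / (C + 1)) (by positivity)
    refine ⟨N, fun m hm n hn z hz => ?_⟩
    rw [dist_eq, ← fockFun_sub]
    refine (hC _ z hz).trans_lt ?_
    have h1 := hN m hm n hn
    rw [lt_div_iff₀ (by positivity)] at h1
    nlinarith [norm_nonneg (u m - u n)]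
  have hpt : ∀ z, ∃ w, Tendsto (fun k => fockFun (u k) z) atTop (𝓝 w) := fun z =>
    cauchySeq_tendsto_of_complete ((hunif z).cauchySeq (Metric.mem_ball_self one_pos))
  choose f hf using hpt
  have hfd : Differentiable ℂ f := fun a => by
    have h1 : TendstoUniformlyOn (fun k => fockFun (u k)) f atTop (Metric.ball a 1) :=
      (hunif a).tendstoUniformlyOn_of_tendsto fun z _ => hf z
    exact (h1.tendstoLocallyUniformlyOn.differentiableOn
      (Eventually.of_forall fun k => (differentiable_fockFun (u k)).differentiableOn)
      Metric.isOpen_ball).differentiableAt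
        (Metric.isOpen_ball.mem_nhds (Metric.mem_ball_self one_pos))
  refine ⟨f, hfd, ?_⟩
  obtain ⟨ns, hns, hae⟩ := (tendstoInMeasure_of_tendsto_Lp hlim).exists_seq_tendsto_ae
  have hall : ∀ᵐ z, ∀ k, F k z = fockFun (u k) z * halfWeight φ z :=
    ae_all_iff.2 fun k => fockFun_ae_eq (u k)
  filter_upwards [hae, hall] with z h1 h2
  have h3 := ((hf z).comp hns.tendsto_atTop).mul_const (halfWeight φ z)
  refine tendsto_nhds_unique h1 (h3.congr fun k => ?_)
  exact (h2 (ns k)).symm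

/-! ### Jets, divided differences and their local estimates. -/

theorem norm_iteratedDeriv_le_of_norm_le {g : ℂ → ℂ} {a : ℂ} {R S : ℝ} (hR : 0 < R)
    (hg : DifferentiableOn ℂ g (Metric.ball a R)) (hS : ∀ z ∈ Metric.ball a R, ‖g z‖ ≤ S) (k : ℕ) :
    ‖iteratedDeriv k g a‖ ≤ k.factorial * (S * (2 / R) ^ k) := by
  have hsub : Metric.closedBall a (R / 2) ⊆ Metric.ball a R :=
    Metric.closedBall_subset_ball (by linarith)
  have h := norm_iteratedDeriv_le_of_forall_mem_sphere_norm_le k (half_pos hR)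
    ((hg.mono ((closure_ball a (half_pos hR).ne').le.trans hsub)).diffContOnCl)
    (fun z hz => hS z (hsub (Metric.sphere_subset_closedBall hz)))
  refine h.trans_eq ?_
  rw [div_pow, div_pow]
  field_simp

/-- The Cauchy estimates on the circle of radius `R / 2` dominate the Taylor series by a geometric
series of ratio at most `1/2`, whence the factor `2`. -/
theorem norm_sub_taylor_le {g : ℂ → ℂ} {a : ℂ} {R S : ℝ} (hR : 0 < R) (hS0 : 0 ≤ S)
    (hg : DifferentiableOn ℂ g (Metric.ball a R)) (hS : ∀ z ∈ Metric.ball a R, ‖g z‖ ≤ S) {z : ℂ}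
    (hz : dist z a ≤ R / 4) (n : ℕ) :
    ‖g z - ∑ k ∈ Finset.range n, iteratedDeriv k g a / k.factorial * (z - a) ^ k‖ ≤
      2 * S * (2 / R * dist z a) ^ n := by
  have hzb : z ∈ Metric.ball a R := Metric.mem_ball.2 (by linarith)
  set q := 2 / R * dist z a with hq
  have hq0 : 0 ≤ q := by positivity
  have hq1 : q ≤ 1 / 2 := by
    rw [hq, div_mul_eq_mul_div, div_le_iff₀ hR]; linarith
  have hsum := Complex.hasSum_taylorSeries_on_ball hg hzb
  have hterm : ∀ k, ‖((k.factorial : ℂ)⁻¹ • (z - a) ^ k • iteratedDeriv k g a)‖ ≤ S * q ^ k :=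
    fun k => by
    rw [norm_smul, norm_smul, norm_inv, norm_pow, Complex.norm_natCast, ← dist_eq]
    have hk : (0 : ℝ) < k.factorial := by exact_mod_cast k.factorial_pos
    calc (k.factorial : ℝ)⁻¹ * (dist z a ^ k * ‖iteratedDeriv k g a‖)
        ≤ (k.factorial : ℝ)⁻¹ * (dist z a ^ k * (k.factorial * (S * (2 / R) ^ k))) := by
          gcongr; exact norm_iteratedDeriv_le_of_norm_le hR hg hS k
      _ = S * q ^ k := by rw [hq, mul_pow]; field_simp
  have htail := (hasSum_nat_add_iff' n).2 hsum
  have hgeo : HasSum (fun k : ℕ => S * q ^ (k + n)) (S * q ^ n * (1 - q)⁻¹) := by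
    have := (hasSum_geometric_of_lt_one hq0 (by linarith)).mul_left (S * q ^ n)
    have e : (fun k : ℕ => S * q ^ (k + n)) = fun k => S * q ^ n * q ^ k := by
      funext k; ring
    rw [e]; exact this
  have h1 := tsum_of_norm_bounded hgeo fun k => hterm (k + n)
  rw [htail.tsum_eq] at h1
  have h2 : ∑ k ∈ Finset.range n, (k.factorial : ℂ)⁻¹ • (z - a) ^ k • iteratedDeriv k g a =
      ∑ k ∈ Finset.range n, iteratedDeriv k g a / k.factorial * (z - a) ^ k := by
    refine Finset.sum_congr rfl fun k _ => ?_
    simp only [smul_eq_mul]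
    ring
  rw [h2] at h1
  refine h1.trans ?_
  have h3 : (1 - q)⁻¹ ≤ 2 := by
    rw [inv_le_comm₀ (by linarith) (by norm_num)]; linarith
  calc S * q ^ n * (1 - q)⁻¹ ≤ S * q ^ n * 2 := by gcongr
    _ = 2 * S * q ^ n := by ring

theorem summable_sigma_fin {α : Type*} {m : α → ℕ} {N : ℕ} (hm : ∀ z, m z ≤ N)
    {v : (Σ z : α, Fin (m z)) → ℝ} {E : α → ℝ} (hv0 : ∀ i, 0 ≤ v i) (hvE : ∀ i, v i ≤ E i.1)
    (hE0 : ∀ z, 0 ≤ E z) (hE : Summable E) : Summable v ∧ ∑' i, v i ≤ N * ∑' z, E z := by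
  have h1 : ∀ z, ∑' j, v ⟨z, j⟩ ≤ N * E z := fun z => by
    rw [tsum_fintype]
    refine (Finset.sum_le_sum fun j _ => hvE ⟨z, j⟩).trans ?_
    simp only [Finset.sum_const]
    rw [Finset.card_univ, Fintype.card_fin, nsmul_eq_mul]
    exact mul_le_mul_of_nonneg_right (by exact_mod_cast hm z) (hE0 z)
  have h2 : Summable fun z => ∑' j, v ⟨z, j⟩ :=
    (hE.mul_left (N : ℝ)).of_nonneg_of_le (fun z => tsum_nonneg fun j => hv0 _) h1
  have h3 : Summable v := (summable_sigma_of_nonneg hv0).2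
    ⟨fun z => (hasSum_fintype _).summable, h2⟩
  refine ⟨h3, ?_⟩
  rw [h3.tsum_sigma, ← tsum_mul_left]
  exact h2.tsum_le_tsum h1 (hE.mul_left _)

/-- Separation makes the discs disjoint, so the local energies add up to at most the total energy.
-/
theorem summable_setIntegral_ball {Λ : Set ℂ} {r : ℝ}
    (hΛ : ∀ z ∈ Λ, ∀ w ∈ Λ, z ≠ w → 2 * r ≤ dist z w) {h : ℂ → ℝ} (h0 : ∀ z, 0 ≤ h z)
    (hi : Integrable h) :
    Summable (fun z : Λ => ∫ w in Metric.ball (z : ℂ) r, h w) ∧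
      ∑' z : Λ, ∫ w in Metric.ball (z : ℂ) r, h w ≤ ∫ w, h w := by
  have hdisj : Pairwise (Function.onFun Disjoint fun z : Λ => Metric.ball (z : ℂ) r) :=
    fun z w hzw => Metric.ball_disjoint_ball (by
      have := hΛ z z.2 w w.2 (fun h => hzw (Subtype.ext h))
      linarith)
  have hfin : ∀ s : Finset Λ, ∑ z ∈ s, ∫ w in Metric.ball (z : ℂ) r, h w ≤ ∫ w, h w := fun s => by
    rw [← integral_biUnion_finset s (fun z _ => measurableSet_ball)
      (fun z _ w _ hzw => hdisj hzw) (fun z _ => hi.integrableOn)]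
    exact setIntegral_le_integral hi (Eventually.of_forall h0)
  have hnn : ∀ z : Λ, 0 ≤ ∫ w in Metric.ball (z : ℂ) r, h w := fun z =>
    integral_nonneg fun w => h0 w
  exact ⟨summable_of_sum_le hnn hfin, Real.tsum_le_of_sum_le hnn hfin⟩

theorem contDiffAt_gauged {φ : ℂ → ℝ} {H : ℂ → ℂ} {a : ℂ}
    (hH : DifferentiableOn ℂ H (Metric.ball a 1)) (j : ℕ) (F : fockSpace φ) :
    ContDiffAt ℂ j (fun z => fockFun F z * exp (-H z)) a :=
  (((differentiable_fockFun F).differentiableOn.mul hH.neg.cexp).contDiffOn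
    Metric.isOpen_ball).contDiffAt (Metric.ball_mem_nhds a one_pos)

/-- The `j`-th derivative at `a` of `f e^{-H}`, as a functional of the Fock space. -/
noncomputable def jet (φ : ℂ → ℝ) {H : ℂ → ℂ} {a : ℂ}
    (hH : DifferentiableOn ℂ H (Metric.ball a 1)) (j : ℕ) : fockSpace φ →ₗ[ℂ] ℂ where
  toFun F := iteratedDeriv j (fun z => fockFun F z * exp (-H z)) a
  map_add' F G := by
    rw [fockFun_add, ← iteratedDeriv_add (contDiffAt_gauged hH j F)
      (contDiffAt_gauged hH j G)]
    congr 1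
    funext z
    simp only [Pi.add_apply]
    ring
  map_smul' c F := by
    rw [fockFun_smul, RingHom.id_apply, smul_eq_mul, ← iteratedDeriv_const_mul_field]
    congr 1
    funext z
    ring

/-- The value at `w` of `f e^{-H}`, as a functional of the Fock space. -/
noncomputable def gaugedEval (φ : ℂ → ℝ) (H : ℂ → ℂ) (w : ℂ) : fockSpace φ →ₗ[ℂ] ℂ where
  toFun F := fockFun F w * exp (-H w)
  map_add' F G := by rw [fockFun_add]; ring
  map_smul' c F := by rw [fockFun_smul, RingHom.id_apply, smul_eq_mul]; ring

/-- The `n`-th divided difference with an `n`-fold node at `a` and a simple node at `w`. -/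
noncomputable def jetDiff (φ : ℂ → ℝ) {H : ℂ → ℂ} {a : ℂ}
    (hH : DifferentiableOn ℂ H (Metric.ball a 1)) (n : ℕ) (w : ℂ) : fockSpace φ →ₗ[ℂ] ℂ :=
  ((n.factorial : ℂ) / (w - a) ^ n) • (gaugedEval φ H w -
    ∑ k ∈ Finset.range n, ((w - a) ^ k / (k.factorial : ℂ)) • jet φ hH k)

theorem jetDiff_apply {φ : ℂ → ℝ} {H : ℂ → ℂ} {a : ℂ}
    (hH : DifferentiableOn ℂ H (Metric.ball a 1)) (n : ℕ) (w : ℂ) (F : fockSpace φ) :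
    jetDiff φ hH n w F = (n.factorial : ℂ) / (w - a) ^ n * (fockFun F w * exp (-H w) -
      ∑ k ∈ Finset.range n, (w - a) ^ k / (k.factorial : ℂ) * jet φ hH k F) := by
  simp [jetDiff, gaugedEval]

/-- The local energy of an element of the Fock space. -/
noncomputable def localEnergy {φ : ℂ → ℝ} (F : fockSpace φ) (a : ℂ) (r : ℝ) : ℝ :=
  ∫ w in Metric.ball a r, ‖fockFun F w‖ ^ 2 * Real.exp (-φ w)

theorem localEnergy_nonneg {φ : ℂ → ℝ} (F : fockSpace φ) (a : ℂ) (r : ℝ) :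
    0 ≤ localEnergy F a r := integral_nonneg fun _ => by positivity

/-- The one-sided gauge inequality suffices: it gives `|e^{-H}|² ≤ e^C e^{-φ}`, and the mean value
property is applied on the disc of radius `r / 2` about `z`, which lies in that of radius `r` about
`a`. -/
theorem norm_gauged_sq_le {φ : ℂ → ℝ} (hφ : Measurable φ) {H : ℂ → ℂ} {a : ℂ}
    (hH : DifferentiableOn ℂ H (Metric.ball a 1)) {C : ℝ}
    (hC : ∀ z ∈ Metric.ball a 1, φ z ≤ 2 * (H z).re + C) {r : ℝ} (hr0 : 0 < r) (hr1 : r ≤ 1)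
    (F : fockSpace φ) {z : ℂ} (hz : z ∈ Metric.ball a (r / 2)) :
    ‖fockFun F z * exp (-H z)‖ ^ 2 ≤
      (Real.pi * (r / 2) ^ 2)⁻¹ * Real.exp C * localEnergy F a r := by
  have hsub : Metric.ball z (r / 2) ⊆ Metric.ball a r := fun w hw => by
    rw [Metric.mem_ball] at hz hw ⊢
    linarith [dist_triangle w z a]
  have hsub1 : Metric.ball z (r / 2) ⊆ Metric.ball a 1 :=
    hsub.trans (Metric.ball_subset_ball hr1)
  have hi := (memFock_fockFun hφ F).2
  have hd : DifferentiableOn ℂ (fun w => fockFun F w * exp (-H w)) (Metric.ball z (r / 2)) :=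
    ((differentiable_fockFun F).differentiableOn.mul hH.neg.cexp).mono hsub1
  have hle : ∀ w ∈ Metric.ball z (r / 2), ‖fockFun F w * exp (-H w)‖ ^ 2 ≤
      Real.exp C * (‖fockFun F w‖ ^ 2 * Real.exp (-φ w)) := fun w hw => by
    rw [norm_mul, mul_pow, norm_exp, ← Real.exp_nat_mul]
    have h1 : Real.exp ((2 : ℕ) * (-H w).re) ≤ Real.exp C * Real.exp (-φ w) := by
      rw [← Real.exp_add]
      refine Real.exp_le_exp.2 ?_
      have := hC w (hsub1 hw)
      push_cast
      rw [neg_re]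
      linarith
    calc ‖fockFun F w‖ ^ 2 * Real.exp ((2 : ℕ) * (-H w).re)
        ≤ ‖fockFun F w‖ ^ 2 * (Real.exp C * Real.exp (-φ w)) := by gcongr
      _ = _ := by ring
  have hiC := hi.const_mul (Real.exp C)
  have hig : IntegrableOn (fun w => ‖fockFun F w * exp (-H w)‖ ^ 2) (Metric.ball z (r / 2)) := by
    refine (hiC.integrableOn).mono'
      ((hd.continuousOn.norm.pow 2).aestronglyMeasurable measurableSet_ball) ?_
    filter_upwards [ae_restrict_mem measurableSet_ball] with w hw
    rw [Real.norm_of_nonneg (by positivity)]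
    exact hle w hw
  refine (norm_sq_le_setIntegral_ball (half_pos hr0) hd hig).trans ?_
  rw [mul_assoc]
  refine mul_le_mul_of_nonneg_left ?_ (by positivity)
  refine (setIntegral_mono_on hig hiC.integrableOn measurableSet_ball hle).trans ?_
  rw [localEnergy, ← integral_const_mul]
  exact setIntegral_mono_set hiC.integrableOn (Eventually.of_forall fun w => by positivity)
    (Eventually.of_forall hsub)

/-- The constant in the local bounds for the jets. -/
noncomputable def jetConst (C r : ℝ) : ℝ := (Real.pi * (r / 2) ^ 2)⁻¹ * Real.exp C

theorem norm_jet_sq_le {φ : ℂ → ℝ} (hφ : Measurable φ) {H : ℂ → ℂ} {a : ℂ}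
    (hH : DifferentiableOn ℂ H (Metric.ball a 1)) {C : ℝ}
    (hC : ∀ z ∈ Metric.ball a 1, φ z ≤ 2 * (H z).re + C) {r : ℝ} (hr0 : 0 < r) (hr1 : r ≤ 1)
    (F : fockSpace φ) (j : ℕ) :
    ‖jet φ hH j F‖ ^ 2 ≤
      (j.factorial * (4 / r) ^ j) ^ 2 * (jetConst C r * localEnergy F a r) := by
  have hE := localEnergy_nonneg F a r
  have hK : 0 ≤ jetConst C r * localEnergy F a r := by unfold jetConst; positivity
  have hS : ∀ z ∈ Metric.ball a (r / 2), ‖fockFun F z * exp (-H z)‖ ≤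
      Real.sqrt (jetConst C r * localEnergy F a r) := fun z hz =>
    Real.le_sqrt_of_sq_le (norm_gauged_sq_le hφ hH hC hr0 hr1 F hz)
  have hd : DifferentiableOn ℂ (fun w => fockFun F w * exp (-H w)) (Metric.ball a (r / 2)) :=
    ((differentiable_fockFun F).differentiableOn.mul hH.neg.cexp).mono
      (Metric.ball_subset_ball (by linarith))
  have h := norm_iteratedDeriv_le_of_norm_le (half_pos hr0) hd hS j
  have h2 : ‖jet φ hH j F‖ ≤ j.factorial * (4 / r) ^ j *
      Real.sqrt (jetConst C r * localEnergy F a r) := by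
    refine h.trans_eq ?_
    rw [show 2 / (r / 2) = 4 / r by field_simp; norm_num]
    ring
  calc ‖jet φ hH j F‖ ^ 2 ≤ (j.factorial * (4 / r) ^ j *
      Real.sqrt (jetConst C r * localEnergy F a r)) ^ 2 := by gcongr
    _ = _ := by rw [mul_pow, Real.sq_sqrt hK]

/-- The difference is `n!/(w - a)^n` times the Taylor remainder of order `n + 1`, so one power of
`|w - a|` survives. The condition `dist w a ≤ r / 8` is the requirement of `norm_sub_taylor_le` for
the disc of radius `r / 2`. -/
theorem norm_jetDiff_sub_jet_sq_le {φ : ℂ → ℝ} (hφ : Measurable φ) {H : ℂ → ℂ} {a : ℂ}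
    (hH : DifferentiableOn ℂ H (Metric.ball a 1)) {C : ℝ}
    (hC : ∀ z ∈ Metric.ball a 1, φ z ≤ 2 * (H z).re + C) {r : ℝ} (hr0 : 0 < r) (hr1 : r ≤ 1)
    (F : fockSpace φ) (n : ℕ) {w : ℂ} (hw0 : 0 < dist w a) (hw : dist w a ≤ r / 8) :
    ‖jetDiff φ hH n w F - jet φ hH n F‖ ^ 2 ≤
      (2 * n.factorial * (4 / r) ^ (n + 1) * dist w a) ^ 2 *
        (jetConst C r * localEnergy F a r) := by
  have hE := localEnergy_nonneg F a r
  have hK : 0 ≤ jetConst C r * localEnergy F a r := by unfold jetConst; positivity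
  have hS : ∀ z ∈ Metric.ball a (r / 2), ‖fockFun F z * exp (-H z)‖ ≤
      Real.sqrt (jetConst C r * localEnergy F a r) := fun z hz =>
    Real.le_sqrt_of_sq_le (norm_gauged_sq_le hφ hH hC hr0 hr1 F hz)
  have hd : DifferentiableOn ℂ (fun w => fockFun F w * exp (-H w)) (Metric.ball a (r / 2)) :=
    ((differentiable_fockFun F).differentiableOn.mul hH.neg.cexp).mono
      (Metric.ball_subset_ball (by linarith))
  have h := norm_sub_taylor_le (half_pos hr0) (Real.sqrt_nonneg _) hd hS
    (z := w) (by linarith) (n + 1)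
  have hwa : w - a ≠ 0 := by
    rw [dist_eq] at hw0; exact norm_pos_iff.1 hw0
  have hfac : (n.factorial : ℂ) ≠ 0 := by exact_mod_cast n.factorial_ne_zero
  have hid : jetDiff φ hH n w F - jet φ hH n F = (n.factorial : ℂ) / (w - a) ^ n *
      (fockFun F w * exp (-H w) - ∑ k ∈ Finset.range (n + 1),
        iteratedDeriv k (fun z => fockFun F z * exp (-H z)) a / k.factorial * (w - a) ^ k) := by
    rw [jetDiff_apply, Finset.sum_range_succ]
    have e : ∑ k ∈ Finset.range n, (w - a) ^ k / (k.factorial : ℂ) * jet φ hH k F =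
        ∑ k ∈ Finset.range n,
          iteratedDeriv k (fun z => fockFun F z * exp (-H z)) a / k.factorial * (w - a) ^ k :=
      Finset.sum_congr rfl fun k _ => by
        change _ * iteratedDeriv k (fun z => fockFun F z * exp (-H z)) a = _
        ring
    have e2 : jet φ hH n F = iteratedDeriv n (fun z => fockFun F z * exp (-H z)) a := rfl
    rw [e, e2]
    field_simp
    ring
  have h2 : ‖jetDiff φ hH n w F - jet φ hH n F‖ ≤ 2 * n.factorial * (4 / r) ^ (n + 1) * dist w a *
      Real.sqrt (jetConst C r * localEnergy F a r) := by
    rw [hid, norm_mul, norm_div, norm_pow, Complex.norm_natCast, ← dist_eq]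
    refine (mul_le_mul_of_nonneg_left h (by positivity)).trans_eq ?_
    rw [show 2 / (r / 2) = 4 / r by field_simp; norm_num, mul_pow]
    field_simp
    ring
  calc ‖jetDiff φ hH n w F - jet φ hH n F‖ ^ 2 ≤ (2 * n.factorial * (4 / r) ^ (n + 1) * dist w a *
      Real.sqrt (jetConst C r * localEnergy F a r)) ^ 2 := by gcongr
    _ = _ := by rw [mul_pow, Real.sq_sqrt hK]

/-! ### Interpolation by perturbed jets and transfer to the new nodes. -/

theorem MultSet.mult_le_maxMult (Λ : MultSet) {z : ℂ} (hz : z ∈ Λ.points) :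
    Λ.mult z ≤ Λ.maxMult := le_csSup Λ.bddAbove_mult ⟨z, hz, rfl⟩

theorem neg_one_pow_mul_exp_half_cancel (j : ℕ) (t : ℝ) (x : ℂ) :
    (-1) ^ j * ((Real.exp (t / 2) : ℝ) : ℂ) * ((-1) ^ j * ((Real.exp (-t / 2) : ℝ) : ℂ) * x) =
      x := by
  have h1 : ((-1 : ℂ) ^ j) * (-1) ^ j = 1 := by rw [← mul_pow]; norm_num
  have h2 : ((Real.exp (t / 2) : ℝ) : ℂ) * ((Real.exp (-t / 2) : ℝ) : ℂ) = 1 := by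
    rw [← ofReal_mul, ← Real.exp_add]
    simp [neg_div]
  linear_combination x * h1 * ((Real.exp (t / 2) : ℝ) : ℂ) * ((Real.exp (-t / 2) : ℝ) : ℂ) + x * h2

theorem norm_neg_one_pow_mul_exp_half_sq (j : ℕ) (t : ℝ) (x : ℂ) :
    ‖(-1) ^ j * ((Real.exp (t / 2) : ℝ) : ℂ) * x‖ ^ 2 = ‖x‖ ^ 2 * Real.exp t := by
  rw [norm_mul, norm_mul, norm_pow, norm_neg, norm_one, one_pow, one_mul, norm_real,
    Real.norm_of_nonneg (Real.exp_pos _).le, mul_pow, ← Real.exp_nat_mul, mul_comm]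
  congr 2
  push_cast
  ring

open Classical in
/-- The jets at the points of `Λ`, where the top jet at a point `z` of maximal multiplicity is
replaced by the divided difference with an additional node at `p z`. -/
noncomputable def perturbedJet (φ : ℂ → ℝ) {H : ℂ → ℂ → ℂ}
    (hH : ∀ a, DifferentiableOn ℂ (H a) (Metric.ball a 1)) (Λ : MultSet) (n : ℕ) (p : ℂ → ℂ)
    (i : Σ z : Λ.points, Fin (Λ.mult z)) : fockSpace φ →ₗ[ℂ] ℂ :=
  if (i.1 : ℂ) ∈ Λ.maxPoints ∧ (i.2 : ℕ) = n then jetDiff φ (hH i.1) n (p i.1)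
  else jet φ (hH i.1) i.2

/-- In the gauge, the interpolation hypothesis says that the jets map the Fock space onto `ℓ²`. Only
the top jets change, each by `O(ε)` relative to the square root of the local energy, so the
perturbation is `O(ε)` in operator norm and stability applies. The threshold is uniform in the
choice of the points `p z`. -/
theorem exists_perturbedJet_eq {φ : ℂ → ℝ} (hφ : UpperSemicontinuous φ) {Λ : MultSet} {n : ℕ}
    (hmax : Λ.maxMult = n + 1) {C : ℝ} {H : ℂ → ℂ → ℂ}
    (hH : ∀ a, DifferentiableOn ℂ (H a) (Metric.ball a 1))
    (hC : ∀ a, ∀ z ∈ Metric.ball a 1, φ z ≤ 2 * (H a z).re + C)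
    (hjet : ∀ a, ∀ f, Differentiable ℂ f → ∀ j ≤ n, (dbarStar φ)^[j] f a =
      (-1) ^ j * ((Real.exp (φ a / 2) : ℝ) : ℂ) * iteratedDeriv j (fun z => f z * exp (-H a z)) a)
    {ρ : ℝ} (hρ : 0 < ρ) (hsep : ∀ z ∈ Λ.points, ∀ w ∈ Λ.points, z ≠ w → ρ ≤ dist z w)
    (hint : Λ.IsInterpolating φ) :
    ∃ ε₁ : ℝ, 0 < ε₁ ∧ ∀ ε, 0 < ε → ε < ε₁ → ∀ p : ℂ → ℂ,
      (∀ z ∈ Λ.maxPoints, dist z (p z) = ε) →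
      ∀ y : (Σ z : Λ.points, Fin (Λ.mult z)) → ℂ, (Summable fun i => ‖y i‖ ^ 2) →
        ∃ F : fockSpace φ, ∀ i, perturbedJet φ hH Λ n p i F = y i := by
  classical
  have hφm : Measurable φ := hφ.measurable
  have : CompleteSpace (fockSpace φ) := (isClosed_fockSpace hφ).completeSpace_coe
  -- `r ≤ 1` keeps the discs inside the domains of the gauges, and `2 * r ≤ ρ` makes them disjoint.
  obtain ⟨r, hr0, hr1, hrρ⟩ : ∃ r : ℝ, 0 < r ∧ r ≤ 1 ∧ 2 * r ≤ ρ :=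
    ⟨min 1 (ρ / 2), by positivity, min_le_left _ _, by
      linarith [min_le_right 1 (ρ / 2)]⟩
  have hm : ∀ z : Λ.points, Λ.mult z ≤ n + 1 := fun z => hmax ▸ Λ.mult_le_maxMult z.2
  have hjc : 0 < jetConst C r := by unfold jetConst; positivity
  have hE : ∀ F : fockSpace φ, (Summable fun z : Λ.points => localEnergy F z r) ∧
      ∑' z : Λ.points, localEnergy F z r ≤ ‖F‖ ^ 2 := fun F => by
    rw [norm_sq_fockSpace]
    exact summable_setIntegral_ball (fun z hz w hw hzw => hrρ.trans (hsep z hz w hw hzw))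
      (fun z => by positivity) (memFock_fockFun hφm F).2
  have hbound : ∀ (B : ℝ), 0 ≤ B → ∀ (F : fockSpace φ) (v : (Σ z : Λ.points, Fin (Λ.mult z)) → ℝ),
      (∀ i, 0 ≤ v i) → (∀ i, v i ≤ B * localEnergy F i.1 r) →
      Summable v ∧ ∑' i, v i ≤ (n + 1) * B * ‖F‖ ^ 2 := fun B hB F v hv0 hv => by
    obtain ⟨h1, h2⟩ := summable_sigma_fin hm hv0 (E := fun z => B * localEnergy F z r) hv
      (fun z => mul_nonneg hB (localEnergy_nonneg F z r)) ((hE F).1.mul_left B)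
    refine ⟨h1, h2.trans ?_⟩
    rw [tsum_mul_left, mul_assoc]
    push_cast
    gcongr
    exact (hE F).2
  set B₀ : ℝ := (n.factorial * (4 / r) ^ n) ^ 2 * jetConst C r with hB₀
  have h4r : 1 ≤ 4 / r := by rw [le_div_iff₀ hr0]; linarith
  have hl : ∀ (F : fockSpace φ) (i : Σ z : Λ.points, Fin (Λ.mult z)),
      ‖jet φ (hH i.1) i.2 F‖ ^ 2 ≤ B₀ * localEnergy F i.1 r := fun F i => by
    have hj : (i.2 : ℕ) ≤ n := Nat.lt_succ_iff.1 (i.2.2.trans_le (hm i.1))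
    refine (norm_jet_sq_le hφm (hH i.1) (hC i.1) hr0 hr1 F i.2).trans ?_
    have := localEnergy_nonneg F i.1 r
    have hf : ((i.2 : ℕ).factorial : ℝ) ≤ n.factorial := by exact_mod_cast Nat.factorial_le hj
    rw [hB₀, mul_assoc]
    gcongr
  obtain ⟨δ, hδ, hstab⟩ := exists_interpolation_stability
    (fun i : Σ z : Λ.points, Fin (Λ.mult z) => jet φ (hH i.1) i.2)
    (A := Real.sqrt ((n + 1) * B₀)) (Real.sqrt_nonneg _)
    (fun F => (hbound B₀ (by positivity) F _ (fun i => by positivity) (hl F)).1)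
    (fun F => by
      rw [Real.sq_sqrt (by positivity)]
      exact (hbound B₀ (by positivity) F _ (fun i => by positivity) (hl F)).2)
    (fun y hy => by
      -- The factor `(-1)^j e^{φ/2}` translates prescribed jets into prescribed values of the
      -- iterates of `dbarStar φ`; the weight `e^{-φ}` in the data norm cancels its square. Outside
      -- the index set the value `0` is a dummy.
      set c : ℂ → ℕ → ℂ := fun z j => if h : ∃ hz : z ∈ Λ.points, j < Λ.mult z then
        (-1) ^ j * ((Real.exp (φ z / 2) : ℝ) : ℂ) * y ⟨⟨z, h.1⟩, ⟨j, h.2⟩⟩ else 0 with hc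
      have hcy : ∀ (z : Λ.points) (j : Fin (Λ.mult z)), c z j =
          (-1) ^ (j : ℕ) * ((Real.exp (φ z / 2) : ℝ) : ℂ) * y ⟨z, j⟩ := fun z j => by
        rw [hc]; exact dif_pos ⟨z.2, j.2⟩
      obtain ⟨f, hf, hfc⟩ := hint c (by
        have h := hy.sigma
        refine h.congr fun z => ?_
        rw [tsum_fintype, ← Fin.sum_univ_eq_sum_range
          (fun j => ‖c z j‖ ^ 2 * Real.exp (-φ z))]
        refine Finset.sum_congr rfl fun j _ => ?_
        rw [hcy, norm_neg_one_pow_mul_exp_half_sq, mul_assoc, ← Real.exp_add]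
        simp)
      obtain ⟨F, hF⟩ := exists_fockSpace_eq hφm hf
      refine ⟨F, fun i => ?_⟩
      have h1 := hfc i.1 i.1.2 i.2 i.2.2
      rw [hjet i.1 f hf.1 i.2 (Nat.lt_succ_iff.1 (i.2.2.trans_le (hm i.1))), hcy] at h1
      have h2 := mul_left_cancel₀ (mul_ne_zero (pow_ne_zero _ (by norm_num))
        (ofReal_ne_zero.2 (Real.exp_pos _).ne')) h1
      rw [← h2, ← hF]
      rfl)
  set G : ℝ := (n + 1) * ((2 * n.factorial * (4 / r) ^ (n + 1)) ^ 2 * jetConst C r) with hG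
  have hG0 : 0 < G := by positivity
  -- `r / 8` is needed for the Taylor remainder, and `δ / √G` makes the squared norm of the
  -- perturbation, at most `G * ε ^ 2`, no larger than `δ ^ 2`.
  refine ⟨min (r / 8) (δ / Real.sqrt G), by positivity, fun ε hε0 hε p hp => ?_⟩
  have hGε : G * ε ^ 2 ≤ δ ^ 2 := by
    have h1 : ε * Real.sqrt G ≤ δ :=
      (le_div_iff₀ (Real.sqrt_pos.2 hG0)).1 (hε.le.trans (min_le_right _ _))
    calc G * ε ^ 2 = (ε * Real.sqrt G) ^ 2 := by rw [mul_pow, Real.sq_sqrt hG0.le]; ring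
      _ ≤ δ ^ 2 := by gcongr
  have hd : ∀ (F : fockSpace φ) (i : Σ z : Λ.points, Fin (Λ.mult z)),
      ‖perturbedJet φ hH Λ n p i F - jet φ (hH i.1) i.2 F‖ ^ 2 ≤
        ((2 * n.factorial * (4 / r) ^ (n + 1) * ε) ^ 2 * jetConst C r) *
          localEnergy F i.1 r := fun F i => by
    have := localEnergy_nonneg F i.1 r
    unfold perturbedJet
    split_ifs with h
    · have hdist : dist (p i.1) i.1 = ε := by rw [dist_comm]; exact hp i.1 h.1
      have h1 := norm_jetDiff_sub_jet_sq_le hφm (hH i.1) (hC i.1) hr0 hr1 F n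
        (w := p i.1) (by rw [hdist]; exact hε0) (by
          rw [hdist]; exact hε.le.trans (min_le_left _ _))
      rw [hdist] at h1
      rw [h.2, mul_assoc]
      exact h1
    · rw [sub_self, norm_zero, zero_pow two_ne_zero]
      positivity
  refine hstab (perturbedJet φ hH Λ n p)
    (fun F => (hbound _ (by positivity) F _ (fun i => by positivity) (hd F)).1) (fun F => ?_)
  refine (hbound _ (by positivity) F _ (fun i => by positivity) (hd F)).2.trans ?_
  refine mul_le_mul_of_nonneg_right (le_trans (le_of_eq ?_) hGε) (by positivity)
  rw [hG]
  ring

/-- Given data for the new set, the jets below the top are prescribed directly, and the top entry is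
the divided difference that these jets and the desired value at `p z` would produce. Solving for the
perturbed jets and cancelling the lower ones returns the value at `p z`. -/
theorem isInterpolating_lower {φ : ℂ → ℝ} (hφ : UpperSemicontinuous φ) {Λ : MultSet} {n : ℕ}
    (hn : 1 ≤ n) (hmax : Λ.maxMult = n + 1) {C : ℝ} (hg : HasGauge φ n C)
    {ρ : ℝ} (hρ : 0 < ρ) (hsep : ∀ z ∈ Λ.points, ∀ w ∈ Λ.points, z ≠ w → ρ ≤ dist z w)
    (hint : Λ.IsInterpolating φ) :
    ∃ ε₁ : ℝ, 0 < ε₁ ∧ ∀ ε, 0 < ε → ε < ε₁ → ∀ p : ℂ → ℂ,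
      (∀ z ∈ Λ.maxPoints, dist z (p z) = ε) → (Λ.lower p).IsInterpolating φ := by
  classical
  choose H hH hC hjet using hg
  obtain ⟨ε₁, hε₁, hstab⟩ := exists_perturbedJet_eq hφ hmax hH hC hjet hρ hsep hint
  -- `ρ / 4` keeps the new points off `Λ` and distinct from each other; `1 / 2` keeps them in the
  -- unit discs where the gauges live, and makes the powers of `ε` at most `1`.
  refine ⟨min ε₁ (min (ρ / 4) (1 / 2)), by positivity, fun ε hε0 hε p hp c hc => ?_⟩
  have hερ : ε < ρ / 4 := hε.trans_le ((min_le_right _ _).trans (min_le_left _ _))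
  have hε1 : ε < 1 / 2 := hε.trans_le ((min_le_right _ _).trans (min_le_right _ _))
  have hpΛ : ∀ z ∈ Λ.maxPoints, p z ∉ Λ.points := fun z hz h => by
    have h1 := hp z hz
    have h2 := hsep z hz.1 (p z) h fun e => by rw [← e, dist_self] at h1; linarith
    linarith
  have hpinj : ∀ z ∈ Λ.maxPoints, ∀ w ∈ Λ.maxPoints, p z = p w → z = w := fun z hz w hw e => by
    by_contra hne
    have h1 := hsep z hz.1 w hw.1 hne
    have h2 := dist_triangle_right z w (p z)
    rw [hp z hz, e, hp w hw] at h2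
    linarith
  have hmult : ∀ z ∈ Λ.points, (Λ.lower p).mult z = min (Λ.mult z) n := fun z hz => by
    change (if z ∈ Λ.points then min (Λ.mult z) (Λ.maxMult - 1) else 1) = _
    rw [if_pos hz, hmax, Nat.add_sub_cancel]
  have hmultp : ∀ z ∈ Λ.maxPoints, (Λ.lower p).mult (p z) = 1 := fun z hz => if_neg (hpΛ z hz)
  have hlow : ∀ z ∈ Λ.points, ∀ j < Λ.mult z, ¬ (z ∈ Λ.maxPoints ∧ j = n) →
      j < (Λ.lower p).mult z := fun z hz j hj h => by
    rw [hmult z hz, lt_min_iff]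
    refine ⟨hj, ?_⟩
    have h1 := Λ.mult_le_maxMult hz
    have h2 : z ∈ Λ.maxPoints ↔ Λ.mult z = Λ.maxMult := ⟨fun h => h.2, fun h => ⟨hz, h⟩⟩
    rw [h2] at h
    by_contra h3
    omega
  have hmaxn : ∀ z ∈ Λ.maxPoints, (Λ.lower p).mult z = n := fun z hz => by
    rw [hmult z hz.1, hz.2, hmax]; simp
  set S : ℂ → ℝ := fun z => ∑ j ∈ Finset.range ((Λ.lower p).mult z),
    ‖c z j‖ ^ 2 * Real.exp (-φ z) with hS
  have hS0 : ∀ z, 0 ≤ S z := fun z => Finset.sum_nonneg fun j _ => by positivity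
  have hS1 : Summable fun z : Λ.points => S z :=
    hc.comp_injective (i := fun z : Λ.points => (⟨z, Or.inl z.2⟩ : (Λ.lower p).points))
      fun z w h => Subtype.ext (congrArg (fun t : (Λ.lower p).points => (t : ℂ)) h)
  have hS2 : Summable fun z : Λ.maxPoints => S (p z) :=
    hc.comp_injective (i := fun z : Λ.maxPoints =>
      (⟨p z, Or.inr ⟨z, z.2, rfl⟩⟩ : (Λ.lower p).points))
      fun z w h => Subtype.ext (hpinj z z.2 w w.2
        (congrArg (fun t : (Λ.lower p).points => (t : ℂ)) h))
  have hS3 : Summable fun z : Λ.points => indicator Λ.maxPoints (fun z => S (p z)) z :=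
    ((summable_subtype_iff_indicator (f := fun z => S (p z))).1 hS2).subtype Λ.points
  set Y : ℂ → ℕ → ℂ := fun z j => (-1) ^ j * ((Real.exp (-φ z / 2) : ℝ) : ℂ) * c z j with hY
  have hYS : ∀ z, ∀ j, ‖Y z j‖ ^ 2 = ‖c z j‖ ^ 2 * Real.exp (-φ z) := fun z j => by
    rw [hY]; exact norm_neg_one_pow_mul_exp_half_sq j (-φ z) (c z j)
  set top : ℂ → ℂ := fun z => (n.factorial : ℂ) / (p z - z) ^ n *
    (c (p z) 0 * exp (-H z (p z)) -
      ∑ k ∈ Finset.range n, (p z - z) ^ k / (k.factorial : ℂ) * Y z k) with htop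
  -- The term `2 * n` combines `|u - v|² ≤ 2|u|² + 2|v|²` with the Cauchy-Schwarz inequality for `n`
  -- summands. That `D` blows up as `ε → 0` is harmless: only summability of the data is at stake,
  -- and `ε` is fixed.
  set D : ℝ := (n.factorial / ε ^ n) ^ 2 * (2 * Real.exp C + 2 * n) with hD
  have hD0 : 0 ≤ D := by positivity
  have htopS : ∀ z ∈ Λ.maxPoints, ‖top z‖ ^ 2 ≤ D * (S z + S (p z)) := fun z hz => by
    have hdist : ‖p z - z‖ = ε := by rw [← dist_eq, dist_comm]; exact hp z hz
    have hpb : p z ∈ Metric.ball z 1 := by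
      rw [Metric.mem_ball, dist_eq, hdist]; linarith
    have h1 : ‖c (p z) 0 * exp (-H z (p z))‖ ^ 2 ≤ Real.exp C * S (p z) := by
      have e : S (p z) = ‖c (p z) 0‖ ^ 2 * Real.exp (-φ (p z)) := by
        simp only [hS]
        rw [hmultp z hz, Finset.sum_range_one]
      rw [norm_mul, mul_pow, norm_exp, ← Real.exp_nat_mul, e]
      have : Real.exp ((2 : ℕ) * (-H z (p z)).re) ≤ Real.exp C * Real.exp (-φ (p z)) := by
        rw [← Real.exp_add]
        refine Real.exp_le_exp.2 ?_
        have := hC z (p z) hpb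
        push_cast
        rw [neg_re]
        linarith
      calc _ ≤ ‖c (p z) 0‖ ^ 2 * (Real.exp C * Real.exp (-φ (p z))) := by gcongr
        _ = _ := by ring
    have h2 : ‖∑ k ∈ Finset.range n, (p z - z) ^ k / (k.factorial : ℂ) * Y z k‖ ^ 2 ≤
        n * S z := by
      have hterm : ∀ k ∈ Finset.range n,
          ‖(p z - z) ^ k / (k.factorial : ℂ) * Y z k‖ ≤ ‖Y z k‖ := fun k _ => by
        rw [norm_mul, norm_div, norm_pow, hdist, Complex.norm_natCast]
        refine mul_le_of_le_one_left (norm_nonneg _) (div_le_one_of_le₀ ?_ (by positivity))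
        have hk : (1 : ℝ) ≤ k.factorial := by exact_mod_cast k.factorial_pos
        exact (pow_le_one₀ hε0.le (by linarith)).trans hk
      have e : S z = ∑ k ∈ Finset.range n, ‖Y z k‖ ^ 2 := by
        simp only [hS, hYS]
        rw [hmaxn z hz]
      calc _ ≤ (∑ k ∈ Finset.range n, ‖Y z k‖) ^ 2 := by
            gcongr; exact norm_sum_le_of_le _ hterm
        _ ≤ (Finset.range n).card * ∑ k ∈ Finset.range n, ‖Y z k‖ ^ 2 :=
            sq_sum_le_card_mul_sum_sq
        _ = _ := by rw [Finset.card_range, e]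
    rw [htop]
    dsimp only
    rw [norm_mul, mul_pow, norm_div, norm_pow, hdist, Complex.norm_natCast, hD, mul_assoc]
    refine mul_le_mul_of_nonneg_left ?_ (by positivity)
    set u := c (p z) 0 * exp (-H z (p z))
    set v := ∑ k ∈ Finset.range n, (p z - z) ^ k / (k.factorial : ℂ) * Y z k
    have h3 : ‖u - v‖ ^ 2 ≤ 2 * ‖u‖ ^ 2 + 2 * ‖v‖ ^ 2 := by
      have h4 : ‖u - v‖ ^ 2 ≤ (‖u‖ + ‖v‖) ^ 2 := by gcongr; exact norm_sub_le u v
      nlinarith [sq_nonneg (‖u‖ - ‖v‖)]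
    have h5 : 0 ≤ Real.exp C * S z := mul_nonneg (Real.exp_pos _).le (hS0 z)
    have h6 : 0 ≤ n * S (p z) := mul_nonneg (by positivity) (hS0 _)
    nlinarith
  set y : (Σ z : Λ.points, Fin (Λ.mult z)) → ℂ := fun i =>
    if (i.1 : ℂ) ∈ Λ.maxPoints ∧ (i.2 : ℕ) = n then top i.1 else Y i.1 i.2 with hy
  have hySum : Summable fun i => ‖y i‖ ^ 2 := by
    refine (summable_sigma_fin (fun z : Λ.points => Λ.mult_le_maxMult z.2)
      (fun i => by positivity)
      (E := fun z => (1 + D) * (S z + indicator Λ.maxPoints (fun z => S (p z)) z))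
      (fun i => ?_) (fun z => ?_) ((hS1.add hS3).mul_left _)).1
    · simp only [hy]
      split_ifs with h
      · rw [indicator_of_mem h.1]
        refine (htopS i.1 h.1).trans ?_
        have := hS0 i.1
        have := hS0 (p i.1)
        gcongr
        linarith
      · rw [hYS]
        have h1 : ‖c i.1 i.2‖ ^ 2 * Real.exp (-φ i.1) ≤ S i.1 :=
          Finset.single_le_sum (f := fun j => ‖c i.1 j‖ ^ 2 * Real.exp (-φ i.1))
            (fun j _ => by positivity)
            (Finset.mem_range.2 (hlow i.1 i.1.2 i.2 i.2.2 h))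
        have h2 : 0 ≤ indicator Λ.maxPoints (fun z => S (p z)) i.1 :=
          indicator_nonneg (fun z _ => hS0 _) _
        have h3 := hS0 i.1
        nlinarith [mul_nonneg hD0 (add_nonneg h3 h2)]
    · exact mul_nonneg (by positivity)
        (add_nonneg (hS0 z) (indicator_nonneg (fun z _ => hS0 _) _))
  obtain ⟨F, hF⟩ := hstab ε hε0 (hε.trans_le (min_le_left _ _)) p hp y hySum
  have hjetY : ∀ z ∈ Λ.points, ∀ j < Λ.mult z, ¬ (z ∈ Λ.maxPoints ∧ j = n) →
      iteratedDeriv j (fun w => fockFun F w * exp (-H z w)) z = Y z j := fun z hz j hj h => by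
    have h1 := hF ⟨⟨z, hz⟩, ⟨j, hj⟩⟩
    simp only [perturbedJet, hy] at h1
    rw [if_neg h, if_neg h] at h1
    exact h1
  refine ⟨fockFun F, memFock_fockFun hφ.measurable F, ?_⟩
  rintro w (hw | ⟨z, hz, rfl⟩) j hj
  · rw [hmult w hw, lt_min_iff] at hj
    rw [hjet w _ (differentiable_fockFun F) j hj.2.le, hjetY w hw j hj.1 (by omega), hY]
    exact neg_one_pow_mul_exp_half_cancel j (φ w) (c w j)
  · rw [hmultp z hz, Nat.lt_one_iff] at hj
    subst hj
    have hzn : Λ.mult z = n + 1 := hz.2.trans hmax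
    have h1 := hF ⟨⟨z, hz.1⟩, ⟨n, by rw [hzn]; exact n.lt_succ_self⟩⟩
    simp only [perturbedJet, hy] at h1
    rw [if_pos ⟨hz, trivial⟩, if_pos ⟨hz, trivial⟩, jetDiff_apply, htop] at h1
    have hpz : p z - z ≠ 0 := sub_ne_zero.2 fun e => hpΛ z hz (by rw [e]; exact hz.1)
    -- The normalization of the divided difference is nonzero and the lower jets are already the
    -- prescribed ones, so only the values at `p z` remain to be compared.
    have h2 := mul_left_cancel₀ (div_ne_zero (by exact_mod_cast n.factorial_ne_zero)
      (pow_ne_zero n hpz)) h1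
    have h3 : ∑ k ∈ Finset.range n, (p z - z) ^ k / (k.factorial : ℂ) * jet φ (hH z) k F =
        ∑ k ∈ Finset.range n, (p z - z) ^ k / (k.factorial : ℂ) * Y z k :=
      Finset.sum_congr rfl fun k hk => by
        have hk := Finset.mem_range.1 hk
        congr 1
        exact hjetY z hz.1 k (by omega) (by omega)
    rw [h3] at h2
    exact mul_right_cancel₀ (exp_ne_zero _) (sub_left_injective h2)

/-! ### Comparison of densities under bounded displacement. -/

theorem integral_ball_bounds {L : ℂ → ℝ} (hL : LocallyIntegrable L) {m M : ℝ}
    (hm : ∀ᵐ z, m < L z ∧ L z < M) (z : ℂ) {r s : ℝ} (hr : 0 ≤ r) (hrs : r ≤ s) :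
    m * (Real.pi * r ^ 2) ≤ ∫ w in Metric.ball z r, L w ∧
      ∫ w in Metric.ball z s, L w ≤
        (∫ w in Metric.ball z r, L w) + M * (Real.pi * (s ^ 2 - r ^ 2)) := by
  have hint : ∀ t, IntegrableOn L (Metric.ball z t) := fun t =>
    (hL.integrableOn_isCompact (isCompact_closedBall z t)).mono_set Metric.ball_subset_closedBall
  have hvol : ∀ t : ℝ, 0 ≤ t → volume.real (Metric.ball z t) = Real.pi * t ^ 2 := fun t ht => by
    rw [measureReal_def, Complex.volume_ball, ENNReal.toReal_mul, ENNReal.toReal_pow,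
      ENNReal.toReal_ofReal ht, mul_comm]
    rfl
  have hsub : Metric.ball z r ⊆ Metric.ball z s := Metric.ball_subset_ball hrs
  have hfin : ∀ t, volume (Metric.ball z t) ≠ ⊤ := fun t => measure_ball_lt_top.ne
  constructor
  · have h := setIntegral_mono_ae (μ := volume) (s := Metric.ball z r) (f := fun _ => m) (g := L)
      (integrableOn_const (hfin r)) (hint r) (hm.mono fun w hw => hw.1.le)
    rwa [setIntegral_const, hvol r hr, smul_eq_mul, mul_comm] at h
  · have h := setIntegral_mono_ae (μ := volume) (s := Metric.ball z s \ Metric.ball z r)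
      (f := L) (g := fun _ => M) ((hint s).mono_set sdiff_subset)
      (integrableOn_const (ne_top_of_le_ne_top (hfin s) (measure_mono sdiff_subset)))
      (hm.mono fun w hw => hw.2.le)
    rw [setIntegral_const, measureReal_sdiff hsub measurableSet_ball, hvol r hr,
      hvol s (hr.trans hrs), smul_eq_mul, setIntegral_sdiff measurableSet_ball (hint s) hsub] at h
    linarith

theorem tendsto_dilation_ratio (m M ε : ℝ) (hm : m ≠ 0) :
    Tendsto (fun r : ℝ => ENNReal.ofReal (1 + M * ((r + ε) ^ 2 - r ^ 2) / (m * r ^ 2)))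
      atTop (𝓝 1) := by
  rw [← ENNReal.ofReal_one]
  refine (ENNReal.continuous_ofReal.tendsto 1).comp ?_
  have h1 : Tendsto (fun r : ℝ => r⁻¹) atTop (𝓝 0) := tendsto_inv_atTop_zero
  have h2 : Tendsto (fun r : ℝ => 1 + M / m * (2 * ε * r⁻¹ + ε ^ 2 * r⁻¹ ^ 2)) atTop (𝓝 1) := by
    have := (((h1.const_mul (2 * ε)).add ((h1.pow 2).const_mul (ε ^ 2))).const_mul
      (M / m)).const_add 1
    simpa using this
  refine h2.congr' ?_
  filter_upwards [eventually_gt_atTop 0] with r hr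
  field_simp
  ring

/-- The integral over the enlarged disc exceeds that over the disc by at most the integral over the
annulus, which is at most `Mπ((r + ε)² - r²)`, while the integral over the disc is at least `mπr²`.
The factor in front is one plus the quotient of these. -/
theorem count_div_le {Λ₁ Λ₂ : MultSet} {ε : ℝ} (hε : 0 ≤ ε)
    (hc : ∀ z r, Λ₁.count z r ≤ Λ₂.count z (r + ε)) {L : ℂ → ℝ} (hL : LocallyIntegrable L)
    {m M : ℝ} (hm0 : 0 < m) (hM0 : 0 ≤ M) (hm : ∀ᵐ z, m < L z ∧ L z < M) (z : ℂ) {r : ℝ}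
    (hr : 0 < r) :
    Λ₁.count z r / ENNReal.ofReal (∫ w in Metric.ball z r, L w) ≤
      ENNReal.ofReal (1 + M * ((r + ε) ^ 2 - r ^ 2) / (m * r ^ 2)) *
        (Λ₂.count z (r + ε) / ENNReal.ofReal (∫ w in Metric.ball z (r + ε), L w)) := by
  obtain ⟨h1, h2⟩ := integral_ball_bounds hL hm z hr.le (le_add_of_nonneg_right hε)
  obtain ⟨h3, -⟩ := integral_ball_bounds hL hm z (add_nonneg hr.le hε) le_rfl
  set I := ∫ w in Metric.ball z r, L w
  set J := ∫ w in Metric.ball z (r + ε), L w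
  have hpi := Real.pi_pos
  have hI : 0 < I := h1.trans_lt' (by positivity)
  have hJ : 0 < J := h3.trans_lt' (by positivity)
  have hd : 0 ≤ (r + ε) ^ 2 - r ^ 2 := by nlinarith
  set κ := 1 + M * ((r + ε) ^ 2 - r ^ 2) / (m * r ^ 2) with hκ
  have hκ0 : 0 < κ := by positivity
  have hJI : J ≤ κ * I := by
    have e : M * (Real.pi * ((r + ε) ^ 2 - r ^ 2)) =
        M * ((r + ε) ^ 2 - r ^ 2) / (m * r ^ 2) * (m * (Real.pi * r ^ 2)) := by
      field_simp
    rw [e] at h2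
    rw [hκ, add_mul, one_mul]
    refine h2.trans ?_
    gcongr
  have hJ' : ENNReal.ofReal J ≠ 0 := by simpa using hJ
  have hI' : ENNReal.ofReal I ≠ 0 := by simpa using hI
  rw [← mul_div_assoc]
  refine ENNReal.div_le_of_le_mul ?_
  rw [div_eq_mul_inv, mul_assoc, mul_comm (ENNReal.ofReal J)⁻¹, ← div_eq_mul_inv, mul_comm
    (ENNReal.ofReal κ), mul_assoc]
  refine (hc z r).trans (le_mul_of_one_le_right' ?_)
  rw [← mul_div_assoc, ← ENNReal.ofReal_mul hκ0.le,
    ENNReal.le_div_iff_mul_le (Or.inl hJ') (Or.inl ENNReal.ofReal_ne_top), one_mul]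
  exact ENNReal.ofReal_le_ofReal hJI

/-- The correction factor does not depend on `z` and tends to `1`, and translating the radius by `ε`
affects neither the lower nor the upper limit. -/
theorem density_le {Λ₁ Λ₂ : MultSet} {ε : ℝ} (hε : 0 ≤ ε)
    (hc : ∀ z r, Λ₁.count z r ≤ Λ₂.count z (r + ε)) {L : ℂ → ℝ} (hL : LocallyIntegrable L)
    {m M : ℝ} (hm0 : 0 < m) (hM0 : 0 ≤ M) (hm : ∀ᵐ z, m < L z ∧ L z < M) :
    Λ₁.lowerDensity L ≤ Λ₂.lowerDensity L ∧ Λ₁.upperDensity L ≤ Λ₂.upperDensity L := by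
  set K : ℝ → ℝ≥0∞ := fun r => ENNReal.ofReal (1 + M * ((r + ε) ^ 2 - r ^ 2) / (m * r ^ 2)) with hK
  have hKl : limsup K atTop = 1 := (tendsto_dilation_ratio m M ε hm0.ne').limsup_eq
  have hle := fun (z : ℂ) {r : ℝ} (hr : 0 < r) => count_div_le hε hc hL hm0 hM0 hm z hr
  have hmap : map (fun r : ℝ => r + ε) atTop = atTop := map_add_atTop_eq ε
  unfold MultSet.lowerDensity MultSet.upperDensity
  constructor
  · set F : ℝ → ℝ≥0∞ := fun r => ⨅ z : ℂ, Λ₂.count z r /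
      ENNReal.ofReal (∫ w in Metric.ball z r, L w) with hF
    calc _ ≤ liminf (K * fun r => F (r + ε)) atTop := by
          refine liminf_le_liminf ?_
          filter_upwards [eventually_gt_atTop 0] with r hr
          rw [Pi.mul_apply, hF, ENNReal.mul_iInf_of_ne]
          · exact iInf_mono fun z => hle z hr
          · exact (ENNReal.ofReal_pos.2 (by
              have : 0 ≤ (r + ε) ^ 2 - r ^ 2 := by nlinarith
              positivity)).ne'
          · exact ENNReal.ofReal_ne_top
      _ ≤ limsup K atTop * liminf (fun r => F (r + ε)) atTop :=
          ENNReal.liminf_mul_le (by simp [hKl]) (by simp [hKl])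
      _ = liminf (F ∘ fun r => r + ε) atTop := by rw [hKl, one_mul, Function.comp_def]
      _ = liminf F atTop := by rw [liminf_comp, hmap]
  · set F : ℝ → ℝ≥0∞ := fun r => ⨆ z : ℂ, Λ₂.count z r /
      ENNReal.ofReal (∫ w in Metric.ball z r, L w) with hF
    calc _ ≤ limsup (K * fun r => F (r + ε)) atTop := by
          refine limsup_le_limsup ?_
          filter_upwards [eventually_gt_atTop 0] with r hr
          rw [Pi.mul_apply, hF, ENNReal.mul_iSup]
          exact iSup_mono fun z => hle z hr
      _ ≤ limsup K atTop * limsup (fun r => F (r + ε)) atTop :=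
          ENNReal.limsup_mul_le' (by simp [hKl]) (by simp [hKl])
      _ = limsup (F ∘ fun r => r + ε) atTop := by rw [hKl, one_mul, Function.comp_def]
      _ = limsup F atTop := by rw [limsup_comp, hmap]

namespace MultSet

/-! ### Counting function, maximal multiplicity and separation of the new set. -/

/-- One unit of mass is split off at every point of maximal multiplicity. In `count_lower_eq` the
first summand is the same and only these units have moved. Extended cardinalities make finiteness in
discs unnecessary. -/
theorem count_eq_tsum_min_add_encard (Λ : MultSet) {n : ℕ} (hmax : Λ.maxMult = n + 1)
    (z : ℂ) (r : ℝ) :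
    Λ.count z r = ∑' w : ↥(Λ.points ∩ Metric.ball z r), ((min (Λ.mult w) n : ℕ) : ℝ≥0∞) +
      ((Λ.maxPoints ∩ Metric.ball z r).encard : ℝ≥0∞) := by
  rw [← ENNReal.tsum_set_one]
  unfold count
  rw [tsum_subtype (Λ.points ∩ Metric.ball z r) (fun w => (Λ.mult w : ℝ≥0∞)),
    tsum_subtype (Λ.points ∩ Metric.ball z r) (fun w => ((min (Λ.mult w) n : ℕ) : ℝ≥0∞)),
    tsum_subtype (Λ.maxPoints ∩ Metric.ball z r) (fun _ => (1 : ℝ≥0∞)), ← ENNReal.tsum_add]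
  refine tsum_congr fun w => ?_
  by_cases hw : w ∈ Λ.points ∩ Metric.ball z r
  · rw [indicator_of_mem hw, indicator_of_mem hw]
    by_cases hw' : w ∈ Λ.maxPoints
    · rw [indicator_of_mem (show w ∈ Λ.maxPoints ∩ _ from ⟨hw', hw.2⟩), hw'.2, hmax]
      simp
    · rw [indicator_of_notMem (fun h => hw' h.1), add_zero, min_eq_left]
      have h1 := Λ.mult_le_maxMult hw.1
      have h2 : Λ.mult w ≠ Λ.maxMult := fun h => hw' ⟨hw.1, h⟩
      omega
  · rw [indicator_of_notMem hw, indicator_of_notMem hw,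
      indicator_of_notMem (fun h => hw ⟨h.1.1, h.2⟩), add_zero]

theorem count_lower_eq (Λ : MultSet) {n : ℕ} (hmax : Λ.maxMult = n + 1) {p : ℂ → ℂ}
    (hp : ∀ z ∈ Λ.maxPoints, p z ∉ Λ.points) (hinj : InjOn p Λ.maxPoints) (z : ℂ) (r : ℝ) :
    (Λ.lower p).count z r =
      ∑' w : ↥(Λ.points ∩ Metric.ball z r), ((min (Λ.mult w) n : ℕ) : ℝ≥0∞) +
      ((Λ.maxPoints ∩ p ⁻¹' Metric.ball z r).encard : ℝ≥0∞) := by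
  rw [← (hinj.mono inter_subset_left).encard_image, image_inter_preimage,
    ← ENNReal.tsum_set_one]
  unfold count
  rw [tsum_subtype ((Λ.lower p).points ∩ Metric.ball z r)
      (fun w => ((Λ.lower p).mult w : ℝ≥0∞)),
    tsum_subtype (Λ.points ∩ Metric.ball z r) (fun w => ((min (Λ.mult w) n : ℕ) : ℝ≥0∞)),
    tsum_subtype (p '' Λ.maxPoints ∩ Metric.ball z r) (fun _ => (1 : ℝ≥0∞)), ← ENNReal.tsum_add]
  refine tsum_congr fun w => ?_
  by_cases hwr : w ∈ Metric.ball z r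
  · by_cases hw : w ∈ Λ.points
    · rw [indicator_of_mem (show w ∈ (Λ.lower p).points ∩ _ from ⟨Or.inl hw, hwr⟩),
        indicator_of_mem (show w ∈ Λ.points ∩ _ from ⟨hw, hwr⟩),
        indicator_of_notMem (by rintro ⟨⟨v, hv, rfl⟩, -⟩; exact hp v hv hw), add_zero]
      simp [lower, hw, hmax]
    · rw [indicator_of_notMem (fun h : w ∈ Λ.points ∩ _ => hw h.1), zero_add]
      by_cases hw' : w ∈ p '' Λ.maxPoints
      · rw [indicator_of_mem (show w ∈ (Λ.lower p).points ∩ _ from ⟨Or.inr hw', hwr⟩),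
          indicator_of_mem (show w ∈ p '' Λ.maxPoints ∩ _ from ⟨hw', hwr⟩)]
        simp [lower, hw]
      · rw [indicator_of_notMem (fun h : w ∈ (Λ.lower p).points ∩ _ => h.1.elim hw hw'),
          indicator_of_notMem (fun h => hw' h.1)]
  · rw [indicator_of_notMem (fun h => hwr h.2), indicator_of_notMem (fun h => hwr h.2),
      indicator_of_notMem (fun h => hwr h.2), add_zero]

theorem count_le_count_lower (Λ : MultSet) {n : ℕ} (hmax : Λ.maxMult = n + 1) {p : ℂ → ℂ} {ε : ℝ}
    (hε : 0 ≤ ε) (hpε : ∀ z ∈ Λ.maxPoints, dist z (p z) = ε)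
    (hp : ∀ z ∈ Λ.maxPoints, p z ∉ Λ.points) (hinj : InjOn p Λ.maxPoints) (z : ℂ) (r : ℝ) :
    Λ.count z r ≤ (Λ.lower p).count z (r + ε) ∧ (Λ.lower p).count z r ≤ Λ.count z (r + ε) := by
  rw [Λ.count_eq_tsum_min_add_encard hmax, Λ.count_eq_tsum_min_add_encard hmax,
    Λ.count_lower_eq hmax hp hinj, Λ.count_lower_eq hmax hp hinj]
  have h1 : ∑' w : ↥(Λ.points ∩ Metric.ball z r), ((min (Λ.mult w) n : ℕ) : ℝ≥0∞) ≤
      ∑' w : ↥(Λ.points ∩ Metric.ball z (r + ε)), ((min (Λ.mult w) n : ℕ) : ℝ≥0∞) :=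
    ENNReal.tsum_mono_subtype (fun w => ((min (Λ.mult w) n : ℕ) : ℝ≥0∞))
      (inter_subset_inter_right _ (Metric.ball_subset_ball (by linarith)))
  refine ⟨add_le_add h1 (ENat.toENNReal_le.2 (encard_le_encard ?_)),
    add_le_add h1 (ENat.toENNReal_le.2 (encard_le_encard ?_))⟩
  · rintro w ⟨hw, hwr⟩
    refine ⟨hw, ?_⟩
    have h2 := hpε w hw
    rw [mem_preimage, Metric.mem_ball]
    rw [Metric.mem_ball] at hwr
    linarith [dist_triangle_left (p w) z w]
  · rintro w ⟨hw, hwr⟩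
    refine ⟨hw, ?_⟩
    have h2 := hpε w hw
    rw [mem_preimage, Metric.mem_ball] at hwr
    rw [Metric.mem_ball]
    linarith [dist_triangle w (p w) z]

theorem maxMult_lower (Λ : MultSet) {n : ℕ} (hn : 1 ≤ n) (hmax : Λ.maxMult = n + 1) (p : ℂ → ℂ) :
    (Λ.lower p).maxMult = n := by
  have hle : ∀ w ∈ (Λ.lower p).points, (Λ.lower p).mult w ≤ n := fun w _ => by
    by_cases h : w ∈ Λ.points
    · simp [lower, h, hmax]
    · simpa [lower, h] using hn
  obtain ⟨z, hz, hzm⟩ : Λ.maxMult ∈ Λ.mult '' Λ.points := by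
    refine Nat.sSup_mem (nonempty_iff_ne_empty.2 fun h => ?_) Λ.bddAbove_mult
    -- In `ℕ` the supremum of the empty set is `0`, which is not `n + 1`.
    rw [maxMult, h, csSup_empty] at hmax
    exact absurd hmax (by simp)
  refine le_antisymm (csSup_le ⟨_, z, Or.inl hz, rfl⟩ ?_) ?_
  · rintro _ ⟨w, hw, rfl⟩
    exact hle w hw
  · have h1 : (Λ.lower p).mult z = n := by simp [lower, hz, hzm, hmax]
    exact h1 ▸ (Λ.lower p).mult_le_maxMult (Or.inl hz)

/-- A new point is at distance exactly `ε` from its own node. All other pairs are further apart: at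
least `ρ - ε` for a new point and a foreign node, and at least `ρ - 2ε` for two new points, both
larger than `ε`. -/
theorem isSeparated_lower (Λ : MultSet) {ρ ε : ℝ} (hε0 : 0 < ε) (hερ : ε < ρ / 4)
    (hsep : ∀ z ∈ Λ.points, ∀ w ∈ Λ.points, z ≠ w → ρ ≤ dist z w) {p : ℂ → ℂ}
    (hp : ∀ z ∈ Λ.maxPoints, dist z (p z) = ε) : (Λ.lower p).IsSeparated := by
  refine einfsep_pos.2 ⟨ENNReal.ofReal ε, ENNReal.ofReal_pos.2 hε0, fun x hx y hy hxy => ?_⟩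
  rw [edist_dist]
  refine ENNReal.ofReal_le_ofReal ?_
  have hmix : ∀ z ∈ Λ.points, ∀ w ∈ Λ.maxPoints, ε ≤ dist z (p w) := fun z hz w hw => by
    have h1 := hp w hw
    by_cases h : z = w
    · rw [h, h1]
    · have h2 := hsep z hz w hw.1 h
      linarith [dist_triangle_right z w (p w)]
  rcases hx with hx | ⟨z, hz, rfl⟩ <;> rcases hy with hy | ⟨w, hw, rfl⟩
  · linarith [hsep x hx y hy hxy]
  · exact hmix x hx w hw
  · rw [dist_comm]; exact hmix y hy z hz
  · have h1 := hp w hw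
    have h2 := hp z hz
    have h3 := hsep z hz.1 w hw.1 fun h => hxy (by rw [h])
    linarith [dist_triangle4 z (p z) (p w) w, dist_comm (p w) w]

end MultSet

end Fock

/-! ### Assembly of the result. -/

theorem mainTheorem3 (φ L : ℂ → ℝ) (hφ : Fock.Subharmonic φ) (hL : Fock.HasLaplacian φ L)
    (Λ : Fock.MultSet) (hsep : Λ.IsSeparated) (hcomp : Λ.Compatible φ L)
    (hint : Λ.IsInterpolating φ) (n : ℕ) (hn : 1 ≤ n) (hmax : Λ.maxMult = n + 1) :
    ∃ ε₀ : ℝ, 0 < ε₀ ∧ ∀ ε : ℝ, 0 < ε → ε < ε₀ →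
      ∀ p : ℂ → ℂ, (∀ z ∈ Λ.maxPoints, dist z (p z) = ε) →
        (Λ.lower p).IsSeparated ∧
        (Λ.lower p).IsInterpolating φ ∧
        (Λ.lower p).maxMult = n ∧
        (Λ.lower p).lowerDensity L = Λ.lowerDensity L ∧
        (Λ.lower p).upperDensity L = Λ.upperDensity L := by
  obtain ⟨C, hg⟩ := Fock.exists_hasGauge hφ hL hcomp hn hmax
  -- The separation constant is infinite for a set with at most one point, so a finite positive
  -- number below it is used instead.
  obtain ⟨c, hc0, hc⟩ := ENNReal.lt_iff_exists_nnreal_btwn.1 hsep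
  have hρ : (0 : ℝ) < c := by exact_mod_cast hc0
  have hsepc : ∀ z ∈ Λ.points, ∀ w ∈ Λ.points, z ≠ w → (c : ℝ) ≤ dist z w :=
    fun z hz w hw hzw => by
      have h := hc.le.trans (Set.einfsep_le_edist_of_mem hz hw hzw)
      rw [edist_nndist] at h
      exact_mod_cast h
  obtain ⟨ε₁, hε₁, hlow⟩ := Fock.isInterpolating_lower hφ.1 hn hmax hg hρ hsepc hint
  obtain ⟨m, M, hm0, hM0, hmM⟩ := hcomp.bounds
  refine ⟨min ε₁ (c / 4), by positivity, fun ε hε0 hε p hp => ?_⟩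
  have hε4 : ε < c / 4 := hε.trans_le (min_le_right _ _)
  have hpΛ : ∀ z ∈ Λ.maxPoints, p z ∉ Λ.points := fun z hz h => by
    have h1 := hp z hz
    have h2 := hsepc z hz.1 (p z) h fun e => by rw [← e, dist_self] at h1; linarith
    linarith
  have hinj : Set.InjOn p Λ.maxPoints := fun z hz w hw e => by
    by_contra hne
    have h1 := hsepc z hz.1 w hw.1 hne
    have h2 := dist_triangle_right z w (p z)
    rw [hp z hz, e, hp w hw] at h2
    linarith
  have hcount := Λ.count_le_count_lower hmax hε0.le hp hpΛ hinj
  -- Displacement by `ε` is a symmetric relation between the two sets, so the comparison applies in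
  -- both directions and yields equality.
  obtain ⟨h1, h2⟩ := Fock.density_le hε0.le (fun z r => (hcount z r).1) hL.2.1 hm0 hM0.le hmM
  obtain ⟨h3, h4⟩ := Fock.density_le hε0.le (fun z r => (hcount z r).2) hL.2.1 hm0 hM0.le hmM
  exact ⟨Λ.isSeparated_lower hε0 hε4 hsepc hp, hlow ε hε0 (hε.trans_le (min_le_left _ _)) p hp,
    Λ.maxMult_lower hn hmax p, le_antisymm h3 h1, le_antisymm h4 h2⟩
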